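/- Let $k\ge 1$, let $\{0,1,\dots,k\}$ be the set of types, and write $\mathbb N=\{1,2,\dots\}$, $[n]=\{1,\dots,n\}$. \textbf{Mass-partitions with types.} $\bar{\mathcal P}_{\rm m}$ is the set of sequences $\bar{\mathbf x}=((x_1,i_1),(x_2,i_2),\dots)$ with $x_n\in[0,1]$, $i_n\in\{0,\dots,k\}$, non-increasing in the lexicographic order, such that $\sum_n x_n\le 1$ and $x_n=0\Leftrightarrow i_n=0$. Put $x_0=1-\sum_{n\ge1}x_n$. It carries the Borel $\sigma$-algebra of the distance $d(\bar{\mathbf x},\bar{\mathbf x}')$ given by the Prohorov distance between $\varphi_{\bar{\mathbf x}}$ and $\varphi_{\bar{\mathbf x}'}$, where $\varphi_{\bar{\mathbf x}}=x_0\delta_0+\sum_{n\ge1}x_n\delta_{x_ne_{i_n}}$ is a probability measure on $\mathbb R^k$ with canonical basis $(e_1,\dots,e_k)$. For $i\neq0$ let $\mathbf 1_i=((1,i),(0,0),\dots)$. \textbf{Partitions with types.} A partition with types $\bar\pi$ of a set $B\subseteq\mathbb N$ is a partition of $B$ into non-empty blocks, each block having a type in $\{0,\dots,k\}$, which is $0$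 if and only if the block is a singleton. The restriction $\bar\pi_{|B'}$ to $B'\subseteq B$ has as blocks the non-empty traces on $B'$ of the blocks of $\bar\pi$, each keeping its type, except that singletons get type $0$. $\bar{\mathcal P}_{\mathbb N}$ is the set of partitions with types of $\mathbb N$, with the Borel $\sigma$-algebra of the distance $1/\sup\{n:\bar\pi_{|[n]}=\bar\pi'_{|[n]}\}$. For $i\ne0$ and $B$ with at least two elements, $\mathbf 1_{B,i}$ is the partition with the single block $B$, of type $i$; $\epsilon_{(n,i)}$ is the partition of $\mathbb N$ with the blocks $\mathbb N\setminus\{n\}$ of type $i$ and $\{n\}$ of type $0$; and $\epsilon_i=\sum_{n\in\mathbb N}\delta_{\epsilon_{(n,i)}}$ is the erosion measure. For a permutation $\sigma$ of $\mathbb N$, the blocks of $\sigma(\bar\pi)$ are the sets $\sigma^{-1}(B)$, $B$ a block of $\bar\pi$, with the type of $B$; a measure on $\bar{\mathcal P}_{\mathbb N}$ is exchangeable if it is invariant under all permutations moving only finitely many integers. $\bar\pi\in\bar{\mathcal P}_{\mathbb N}$ has asymptotic frequencies if $|B|=\lim_n n^{-1}{\rm Card}(B\cap[n])$ exists for each of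 its blocks $B$. Then $|\bar\pi|^\downarrow\in\bar{\mathcal P}_{\rm m}$ is the sequence of the pairs ($|B|$, type of $B$), over the blocks with $|B|>0$, ranked in the non-increasing lexicographic order and completed by terms $(0,0)$ if there are finitely many. \textbf{Paintbox.} For $\bar{\mathbf x}\in\bar{\mathcal P}_{\rm m}$, let $(\xi_m,\tau_m)_{m\in\mathbb N}$ be i.i.d. with $\mathbb P((\xi_m,\tau_m)=(n,i_n))=x_n$ for $n\ge1$ and $\mathbb P((\xi_m,\tau_m)=(0,0))=x_0$. The paintbox $\rho_{\bar{\mathbf x}}$ is the law of the random partition with types in which distinct $\ell,m$ are in the same block if and only if $\xi_\ell=\xi_m\ge1$, the block then having type $\tau_\ell=\tau_m$. \textbf{Theorem.} The map $\bar{\mathbf x}\mapsto\rho_{\bar{\mathbf x}}$ is measurable. Fix a type $i\in\{1,\dots,k\}$ and let $\mu_i$ be an exchangeable measure on $\bar{\mathcal P}_{\mathbb N}$ such that $$\mu_i(\{\mathbf 1_{\mathbb N,i}\})=0\quad\text{and}\quad \mu_i(\bar\pi:\bar\pi_{|[2]}\neq\mathbf 1_{[2],i})<\infty.\tag{5}$$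 Then: (i) $\mu_i$-almost every $\bar\pi$ possesses asymptotic frequencies. (ii) The map $\bar\pi\mapsto|\bar\pi|^\downarrow$ is $\mu_i$-almost everywhere defined and measurable. Let $|\mu_i|^\downarrow$ be the image of $\mu_i$ by it. The restriction $$\nu_i(d\bar{\mathbf x})=\mathbf 1_{\{\bar{\mathbf x}\ne\mathbf 1_i\}}|\mu_i|^\downarrow(d\bar{\mathbf x})\tag{6}$$ satisfies $$\int_{\bar{\mathcal P}_{\rm m}}(1-x_1\mathbf 1_{\{i_1=i\}})\,\nu_i(d\bar{\mathbf x})<\infty\tag{7}$$ and $\mathbf 1_{\{|\bar\pi|^\downarrow\neq\mathbf 1_i\}}\mu_i(d\bar\pi)=\int_{\bar{\mathcal P}_{\rm m}}\rho_{\bar{\mathbf x}}(d\bar\pi)\,\nu_i(d\bar{\mathbf x})$. (iii) There is a real number $c_i\ge0$ such that $\mathbf 1_{\{|\bar\pi|^\downarrow=\mathbf 1_i\}}\mu_i(d\bar\pi)=c_i\,\epsilon_i(d\bar\pi)$. Conversely, for every real $c_i\ge0$ and every measure $\nu_i$ on $\bar{\mathcal P}_{\rm m}$ with $\nu_i(\{\mathbf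 1_i\})=0$ that satisfies (7), the measure $$\mu_i(d\bar\pi)=c_i\,\epsilon_i(d\bar\pi)+\int_{\bar{\mathcal P}_{\rm m}}\rho_{\bar{\mathbf x}}(d\bar\pi)\,\nu_i(d\bar{\mathbf x})$$ is exchangeable and satisfies (5); $\mu_i$-almost every $\bar\pi$ has asymptotic frequencies, $\bar\pi\mapsto|\bar\pi|^\downarrow$ is $\mu_i$-almost everywhere measurable, and (6) holds. -/

import Mathlib

open MeasureTheory Filter Topology
open scoped ENNReal NNReal

noncomputable section

/-! Types are the elements of `Fin (k + 1) = {0, 1, …, k}`; the type `0` is the special one.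
The positive integers `1, 2, 3, …` (labels of blocks and elements being partitioned) are
relabelled `0, 1, 2, …`, so that `[n]` becomes `Fin n`. -/

/-- Mass-partitions with types: sequences `(x_n, i_n)`, non-increasing in the lexicographic
order, with total mass at most one, and with `x_n = 0` exactly when `i_n = 0`. -/
@[ext]
structure MassPartition (k : ℕ) where
  mass : ℕ → ℝ
  typ : ℕ → Fin (k + 1)
  nonneg : ∀ n, 0 ≤ mass n
  antitone : Antitone mass
  summable : Summable mass
  tsum_le_one : ∑' n, mass n ≤ 1
  mass_eq_zero_iff : ∀ n, mass n = 0 ↔ typ n = 0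
  typ_le : ∀ n, mass n = mass (n + 1) → typ (n + 1) ≤ typ n

namespace MassPartition

variable {k : ℕ}

/-- The mass of dust `x_0 = 1 - ∑ x_n`. -/
def dust (x : MassPartition k) : ℝ := 1 - ∑' n, x.mass n

/-- The measure `x_0 δ_{e} + ∑ x_n δ_{f n}`. -/
def scatter {E : Type*} [MeasurableSpace E] (x : MassPartition k) (e : E) (f : ℕ → E) :
    Measure E :=
  ENNReal.ofReal x.dust • Measure.dirac e +
    Measure.sum fun n => ENNReal.ofReal (x.mass n) • Measure.dirac (f n)

instance {E : Type*} [MeasurableSpace E] (x : MassPartition k) (e : E) (f : ℕ → E) :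
    IsProbabilityMeasure (x.scatter e f) := by
  constructor
  have h : 0 ≤ x.dust := sub_nonneg.2 x.tsum_le_one
  simp only [scatter, Measure.add_apply, Measure.smul_apply, measure_univ, smul_eq_mul, mul_one,
    Measure.sum_apply _ MeasurableSet.univ]
  rw [← ENNReal.ofReal_tsum_of_nonneg x.nonneg x.summable,
    ← ENNReal.ofReal_add h (tsum_nonneg x.nonneg)]
  simp [dust]

/-- The point `y e_j` of `ℝ^k`, where `(e_1, …, e_k)` is the canonical basis
(and the origin if `j = 0`). -/
def axisPoint (y : ℝ) (j : Fin (k + 1)) : EuclideanSpace ℝ (Fin k) :=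
  WithLp.toLp 2 fun l => if j = l.succ then y else 0

/-- The probability measure `φ_x = x_0 δ_0 + ∑ x_n δ_{x_n e_{i_n}}` on `ℝ^k`. -/
def phi (x : MassPartition k) : ProbabilityMeasure (EuclideanSpace ℝ (Fin k)) :=
  ⟨x.scatter 0 fun n => axisPoint (x.mass n) (x.typ n), inferInstance⟩

/-- The distance between `x` and `x'` is the Prohorov distance between `φ_x` and `φ_{x'}`. -/
instance : PseudoMetricSpace (MassPartition k) :=
  PseudoMetricSpace.induced (fun x => LevyProkhorov.ofMeasure x.phi) inferInstance

instance : MeasurableSpace (MassPartition k) := borel _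

instance : BorelSpace (MassPartition k) := ⟨rfl⟩

/-- The mass-partition with types `((0, 0), (0, 0), …)` (pure dust). -/
def pureDust (k : ℕ) : MassPartition k where
  mass _ := 0
  typ _ := 0
  nonneg _ := le_rfl
  antitone := antitone_const
  summable := summable_zero
  tsum_le_one := by simp
  mass_eq_zero_iff _ := by simp
  typ_le _ _ := le_rfl

/-- The mass-partition with types `1_i = ((1, i), (0, 0), …)`, for a type `i ≠ 0`. -/
def one (i : Fin (k + 1)) (hi : i ≠ 0) : MassPartition k where
  mass n := if n = 0 then 1 else 0
  typ n := if n = 0 then i else 0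
  nonneg n := by split_ifs <;> norm_num
  antitone m n h := by
    by_cases hm : m = 0
    · simp only [hm, if_true]; split_ifs <;> norm_num
    · have hn : n ≠ 0 := by omega
      simp [hm, hn]
  summable := (hasSum_ite_eq 0 (1 : ℝ)).summable
  tsum_le_one := (tsum_ite_eq 0 (fun _ => (1 : ℝ))).le
  mass_eq_zero_iff n := by split_ifs <;> simp [hi]
  typ_le n h := by simp

end MassPartition

/-- Partitions with types of a set `α`: an equivalence relation on `α` (whose classes are the
blocks) and a type for every block, given as the type of each element of the block; a block has
type `0` if and only if it is a singleton. -/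
@[ext]
structure TypedPartition (k : ℕ) (α : Type*) where
  rel : Setoid α
  typ : α → Fin (k + 1)
  typ_congr : ∀ a b, rel a b → typ a = typ b
  typ_eq_zero_iff : ∀ a, typ a = 0 ↔ ∀ b, rel a b → b = a

namespace TypedPartition

variable {k : ℕ} {α β γ : Type*}

open Classical in
/-- The pull-back of a partition with types along an injection `f`. The type of a block is the type
of the original block that it comes from, except that singletons get the type `0`. -/
def comap (f : β ↪ α) (π : TypedPartition k α) : TypedPartition k β where
  rel := Setoid.comap f π.rel
  typ b := if ∀ c, π.rel (f b) (f c) → c = b then 0 else π.typ (f b)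
  typ_congr a b h := by
    have hab : π.rel (f a) (f b) := h
    have key : (∀ c, π.rel (f a) (f c) → c = a) ↔ ∀ c, π.rel (f b) (f c) → c = b := by
      constructor
      · intro H c hc
        exact (H c (π.rel.trans hab hc)).trans (H b hab).symm
      · intro H c hc
        exact (H c (π.rel.trans (π.rel.symm hab) hc)).trans (H a (π.rel.symm hab)).symm
    simp only [key, π.typ_congr _ _ hab]
  typ_eq_zero_iff a := by
    constructor
    · intro h
      split_ifs at h with h'
      · exact h'
      · exact fun c hc => f.injective ((π.typ_eq_zero_iff (f a)).1 h (f c) hc)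
    · intro h
      exact if_pos h

/-- The restriction `π|[n]`. -/
def restrict (n : ℕ) (π : TypedPartition k ℕ) : TypedPartition k (Fin n) :=
  π.comap Fin.valEmbedding

/-- The action of a permutation: the blocks of `σ(π)` are the `σ⁻¹(B)`, for `B` a block of `π`,
with the type of `B`. -/
def permute (σ : Equiv.Perm ℕ) (π : TypedPartition k ℕ) : TypedPartition k ℕ :=
  π.comap σ.toEmbedding

theorem permute_typ (σ : Equiv.Perm ℕ) (π : TypedPartition k ℕ) (n : ℕ) :
    (π.permute σ).typ n = π.typ (σ n) := by
  simp only [permute, comap, Equiv.coe_toEmbedding]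
  split_ifs with h
  · refine ((π.typ_eq_zero_iff _).2 fun b hb => ?_).symm
    have := h (σ.symm b) (by simpa using hb)
    simp [← this]
  · rfl

/-- The partition `1_{α,i}` with the single block `α`, of type `i ≠ 0`. -/
def single (α : Type*) [Nontrivial α] (i : Fin (k + 1)) (hi : i ≠ 0) : TypedPartition k α where
  rel := ⊤
  typ _ := i
  typ_congr _ _ _ := rfl
  typ_eq_zero_iff a := by
    obtain ⟨b, hb⟩ := exists_ne a
    exact ⟨fun h => absurd h hi, fun h => absurd (h b trivial) hb⟩

/-- The partition `ε_{(n,i)}` of `ℕ` with the blocks `ℕ \ {n}`, of type `i ≠ 0`, and `{n}`. -/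
def erode (n : ℕ) (i : Fin (k + 1)) (hi : i ≠ 0) : TypedPartition k ℕ where
  rel := ⟨fun a b => (a = n ↔ b = n),
    ⟨fun _ => Iff.rfl, fun h => h.symm, fun h h' => h.trans h'⟩⟩
  typ a := if a = n then 0 else i
  typ_congr a b h := by
    have h' : (a = n ↔ b = n) := h
    simp only [h']
  typ_eq_zero_iff a := by
    constructor
    · intro h b hb
      have h' : (a = n ↔ b = n) := hb
      by_cases ha : a = n
      · exact (h'.1 ha).trans ha.symm
      · simp [ha, hi] at h
    · intro h
      by_contra h0
      have ha : a ≠ n := fun ha => h0 (if_pos ha)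
      have e1 : a + n + 1 = a :=
        h (a + n + 1) (show (a = n ↔ a + n + 1 = n) from ⟨fun e => absurd e ha, fun e => by omega⟩)
      omega

theorem restrict_typ_of_forall {n : ℕ} {π : TypedPartition k ℕ} {a : Fin n}
    (h : ∀ c : Fin n, π.rel a c → c = a) : (π.restrict n).typ a = 0 :=
  if_pos h

theorem restrict_typ_of_not_forall {n : ℕ} {π : TypedPartition k ℕ} {a : Fin n}
    (h : ¬ ∀ c : Fin n, π.rel a c → c = a) : (π.restrict n).typ a = π.typ a :=
  if_neg h

theorem restrict_eq_of_le {m n : ℕ} (h : m ≤ n) {π π' : TypedPartition k ℕ}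
    (e : π.restrict n = π'.restrict n) : π.restrict m = π'.restrict m := by
  have hr : ∀ a b, a < n → b < n → (π.rel a b ↔ π'.rel a b) := fun a b ha hb => by
    have := congrArg (fun p : TypedPartition k (Fin n) => p.rel ⟨a, ha⟩ ⟨b, hb⟩) e
    exact iff_of_eq this
  ext a b
  · exact hr a b (by omega) (by omega)
  · have ht := congrArg (fun p : TypedPartition k (Fin n) => p.typ ⟨a, by omega⟩) e
    have key : (∀ c : Fin m, π.rel a c → c = a) ↔ ∀ c : Fin m, π'.rel a c → c = a :=
      forall_congr' fun c => by rw [hr a c (by omega) (by omega)]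
    by_cases h1 : ∀ c : Fin m, π'.rel a c → c = a
    · rw [restrict_typ_of_forall h1, restrict_typ_of_forall (key.2 h1)]
    · rw [restrict_typ_of_not_forall h1, restrict_typ_of_not_forall (mt key.1 h1)]
      have h2 : ¬ ∀ c : Fin n, π'.rel a c → c = ⟨a, by omega⟩ := fun H => h1 fun c hc => by
        have := H ⟨c, by omega⟩ hc
        simpa [Fin.ext_iff] using this
      have h3 : ¬ ∀ c : Fin n, π.rel a c → c = ⟨a, by omega⟩ := fun H => h2 fun c hc =>
        H c ((hr a c (by omega) (by omega)).2 hc)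
      rw [restrict_typ_of_not_forall h3, restrict_typ_of_not_forall h2] at ht
      rw [ht]

theorem restrict_one (π π' : TypedPartition k ℕ) : π.restrict 1 = π'.restrict 1 := by
  ext a b
  · have : a = b := Subsingleton.elim _ _
    subst this
    exact ⟨fun _ => Setoid.refl' _ _, fun _ => Setoid.refl' _ _⟩
  · simp only [restrict, comap]
    rw [if_pos fun c _ => Subsingleton.elim _ _, if_pos fun c _ => Subsingleton.elim _ _]

theorem eq_of_forall_restrict {π π' : TypedPartition k ℕ}
    (h : ∀ n, π.restrict n = π'.restrict n) : π = π' := by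
  have hr : ∀ a b, π.rel a b ↔ π'.rel a b := fun a b => by
    have := congrArg (fun p : TypedPartition k (Fin (a + b + 1)) =>
      p.rel ⟨a, by omega⟩ ⟨b, by omega⟩) (h (a + b + 1))
    exact iff_of_eq this
  ext a b
  · exact hr a b
  · by_cases hs : ∀ b, π.rel a b → b = a
    · rw [(π.typ_eq_zero_iff a).2 hs,
        (π'.typ_eq_zero_iff a).2 fun b hb => hs b ((hr a b).2 hb)]
    · push Not at hs
      obtain ⟨b, hb, hne⟩ := hs
      have ht := congrArg (fun p : TypedPartition k (Fin (a + b + 1)) => p.typ ⟨a, by omega⟩)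
        (h (a + b + 1))
      rw [restrict_typ_of_not_forall fun H => hne (by simpa using H ⟨b, by omega⟩ hb),
        restrict_typ_of_not_forall fun H =>
          hne (by simpa using H ⟨b, by omega⟩ ((hr a b).1 hb))] at ht
      rw [ht]

open Classical in
/-- `d(π, π') = 1 / sup {n : π|[n] = π'|[n]}`, which is `0` if the supremum is infinite, i.e. if
`π = π'`. -/
def distance (π π' : TypedPartition k ℕ) : ℝ :=
  if π = π' then 0 else 1 / ((sSup {n : ℕ | π.restrict n = π'.restrict n} : ℕ) : ℝ)

theorem bddAbove_agree {π π' : TypedPartition k ℕ} (h : π ≠ π') :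
    BddAbove {n : ℕ | π.restrict n = π'.restrict n} := by
  by_contra hb
  refine h (eq_of_forall_restrict fun n => ?_)
  rw [not_bddAbove_iff] at hb
  obtain ⟨m, hm, hnm⟩ := hb n
  exact restrict_eq_of_le hnm.le hm

theorem one_le_sSup_agree {π π' : TypedPartition k ℕ} (h : π ≠ π') :
    1 ≤ sSup {n : ℕ | π.restrict n = π'.restrict n} :=
  le_csSup (bddAbove_agree h) (restrict_one π π')

theorem sSup_agree_mem {π π' : TypedPartition k ℕ} (h : π ≠ π') :
    π.restrict (sSup {n : ℕ | π.restrict n = π'.restrict n}) =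
      π'.restrict (sSup {n : ℕ | π.restrict n = π'.restrict n}) :=
  Nat.sSup_mem ⟨1, restrict_one π π'⟩ (bddAbove_agree h)

theorem distance_nonneg (π π' : TypedPartition k ℕ) : 0 ≤ distance π π' := by
  unfold distance; split_ifs <;> positivity

theorem distance_triangle (π π' π'' : TypedPartition k ℕ) :
    distance π π'' ≤ distance π π' + distance π' π'' := by
  by_cases h1 : π = π'
  · subst h1; linarith [distance_nonneg π π]
  by_cases h2 : π' = π''
  · subst h2; linarith [distance_nonneg π' π']
  by_cases h3 : π = π''
  · subst h3
    have := distance_nonneg π π'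
    have := distance_nonneg π' π
    simp only [distance, if_true] at *
    linarith
  have p1 := one_le_sSup_agree h1
  have p2 := one_le_sSup_agree h2
  have m1 := sSup_agree_mem h1
  have m2 := sSup_agree_mem h2
  simp only [distance, h1, h2, h3, if_false]
  generalize sSup {n : ℕ | π.restrict n = π'.restrict n} = a at *
  generalize sSup {n : ℕ | π'.restrict n = π''.restrict n} = b at *
  have hm : min a b ≤ sSup {n : ℕ | π.restrict n = π''.restrict n} :=
    le_csSup (bddAbove_agree h3)
      ((restrict_eq_of_le (min_le_left a b) m1).trans (restrict_eq_of_le (min_le_right a b) m2))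
  have hpos : 1 ≤ min a b := le_min p1 p2
  have hle : 1 / ((sSup {n : ℕ | π.restrict n = π''.restrict n} : ℕ) : ℝ) ≤
      1 / ((min a b : ℕ) : ℝ) :=
    one_div_le_one_div_of_le (by exact_mod_cast hpos) (by exact_mod_cast hm)
  refine hle.trans ?_
  rcases min_choice a b with e | e <;> rw [e]
  · exact le_add_of_nonneg_right (by positivity)
  · exact le_add_of_nonneg_left (by positivity)

instance : MetricSpace (TypedPartition k ℕ) where
  dist := distance
  dist_self π := by simp [distance]
  dist_comm π π' := by
    have h : ∀ n, (π.restrict n = π'.restrict n) = (π'.restrict n = π.restrict n) :=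
      fun n => propext eq_comm
    by_cases e : π = π'
    · rw [e]
    · simp only [distance, if_neg e, if_neg (Ne.symm e), h]
  dist_triangle := distance_triangle
  eq_of_dist_eq_zero {π π'} h := by
    by_contra hne
    have hd : distance π π' = 0 := h
    have := one_le_sSup_agree hne
    rw [distance, if_neg hne, one_div, inv_eq_zero] at hd
    have : sSup {n : ℕ | π.restrict n = π'.restrict n} = 0 := by exact_mod_cast hd
    omega

instance : MeasurableSpace (TypedPartition k ℕ) := borel _

instance : BorelSpace (TypedPartition k ℕ) := ⟨rfl⟩

/-- The block `B` has the asymptotic frequency `y = lim Card(B ∩ [n]) / n`. -/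
def HasFrequency (B : Set ℕ) (y : ℝ) : Prop :=
  Tendsto (fun n : ℕ => ((B ∩ Set.Iio n).ncard : ℝ) / n) atTop (𝓝 y)

/-- All the blocks of `π` possess an asymptotic frequency. -/
def HasFrequencies (π : TypedPartition k ℕ) : Prop :=
  ∀ B ∈ π.rel.classes, ∃ y, HasFrequency B y

/-- `x` is the ranked sequence of the asymptotic frequencies and types of the blocks of `π`: every
pair `(y, j)` with `y > 0` occurs as often in `x` as there are blocks of `π` with asymptotic
frequency `y` and type `j`. Blocks with frequency zero only contribute to the terms `(0, 0)`. -/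
def IsRanking (π : TypedPartition k ℕ) (x : MassPartition k) : Prop :=
  ∀ y : ℝ, 0 < y → ∀ j : Fin (k + 1),
    {n | x.mass n = y ∧ x.typ n = j}.encard =
      {B | B ∈ π.rel.classes ∧ HasFrequency B y ∧ ∀ a ∈ B, π.typ a = j}.encard

open Classical in
/-- The mass-partition with types `|π|↓`, if `π` has asymptotic frequencies (by convention it is
the pure dust otherwise). -/
def rank (π : TypedPartition k ℕ) : MassPartition k :=
  if h : π.HasFrequencies ∧ ∃ x, π.IsRanking x then h.2.choose else MassPartition.pureDust k

open Classical in
/-- The partition with types that is obtained from a sequence `p = ((ξ_0, τ_0), (ξ_1, τ_1), …)` of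
colours with types: two distinct integers are in the same block when they have the same colour
with the same type, this type being not `0`; the type of that block is then the common type.
All the other integers are singletons. -/
def paint (p : ℕ → ℕ × Fin (k + 1)) : TypedPartition k ℕ where
  rel := ⟨fun a b => a = b ∨ (p a = p b ∧ (p a).2 ≠ 0),
    ⟨fun _ => Or.inl rfl,
      fun {a b} h => h.elim (fun e => Or.inl e.symm) fun e => Or.inr ⟨e.1.symm, e.1 ▸ e.2⟩,
      fun {a b c} h h' => by
        rcases h with rfl | h
        · exact h'
        · rcases h' with rfl | h'
          · exact Or.inr h
          · exact Or.inr ⟨h.1.trans h'.1, h.2⟩⟩⟩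
  typ a := if ∃ b, b ≠ a ∧ p b = p a then (p a).2 else 0
  typ_congr a b h := by
    rcases h with rfl | ⟨h, -⟩
    · rfl
    · by_cases e : a = b
      · rw [e]
      · rw [if_pos ⟨b, Ne.symm e, h.symm⟩, if_pos ⟨a, e, h⟩, h]
  typ_eq_zero_iff a := by
    constructor
    · intro h b hb
      rcases hb with rfl | ⟨h1, h2⟩
      · rfl
      · by_contra hne
        rw [if_pos ⟨b, hne, h1.symm⟩] at h
        exact h2 h
    · intro h
      split_ifs with h'
      · obtain ⟨b, hb, e⟩ := h'
        by_contra h0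
        exact hb (h b (Or.inr ⟨e.symm, h0⟩))
      · rfl

end TypedPartition

variable {k : ℕ}

/-- The law of `(ξ, τ)`: it is `(n, i_n)` with probability `x_n`, for `n ≥ 1`, and `(0, 0)` with
probability `x_0`. In view of the shift of the indices, the `n`-th colour is `n + 1`. -/
def colourLaw (x : MassPartition k) : Measure (ℕ × Fin (k + 1)) :=
  x.scatter (0, 0) fun n => (n + 1, x.typ n)

instance (x : MassPartition k) : IsProbabilityMeasure (colourLaw x) :=
  inferInstanceAs (IsProbabilityMeasure (x.scatter _ _))

/-- The paintbox `ρ_x` based on `x`: the law of the partition with types that is obtained from a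
sequence of independent copies of `(ξ, τ)`. -/
def paintbox (x : MassPartition k) : Measure (TypedPartition k ℕ) :=
  (Measure.infinitePi fun _ : ℕ => colourLaw x).map TypedPartition.paint

/-- The erosion measure `ε_i = ∑ₙ δ_{ε_{(n,i)}}`. -/
def erosion (i : Fin (k + 1)) (hi : i ≠ 0) : Measure (TypedPartition k ℕ) :=
  Measure.sum fun n => Measure.dirac (TypedPartition.erode n i hi)

/-- Invariance under the action of the permutations of `ℕ` that move finitely many integers. -/
def Exchangeable (μ : Measure (TypedPartition k ℕ)) : Prop :=
  ∀ σ : Equiv.Perm ℕ, {n | σ n ≠ n}.Finite → MeasurePreserving (TypedPartition.permute σ) μ μ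

/-- `μ({1_{ℕ,i}}) = 0` and `μ(π : π|[2] ≠ 1_{[2],i}) < ∞`. -/
def SplittingCondition (i : Fin (k + 1)) (hi : i ≠ 0) (μ : Measure (TypedPartition k ℕ)) : Prop :=
  μ {TypedPartition.single ℕ i hi} = 0 ∧
    μ {π | π.restrict 2 ≠ TypedPartition.single (Fin 2) i hi} < ∞

/-- `∫ (1 - x_1 1_{i_1 = i}) ν(dx) < ∞`; the integrand is nonnegative. -/
def DislocationCondition (i : Fin (k + 1)) (ν : Measure (MassPartition k)) : Prop :=
  ∫⁻ x, ENNReal.ofReal (1 - x.mass 0 * (if x.typ 0 = i then 1 else 0)) ∂ν < ∞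

/-- The restriction to `{x ≠ 1_i}` of the image `|μ|↓` of `μ` by `π ↦ |π|↓`. -/
def dislocationMeasure (i : Fin (k + 1)) (hi : i ≠ 0) (μ : Measure (TypedPartition k ℕ)) :
    Measure (MassPartition k) :=
  (μ.map TypedPartition.rank).restrict {x | x ≠ MassPartition.one i hi}

end

/-! The infinite measure `μ` is cut into finite pieces. By exchangeability every `splitSet i a b`
has the same finite measure as the set in `SplittingCondition`, and these countably many sets cover
everything except the null point `single ℕ i hi`. On a piece described by a finite set `F` of
integers, `μ` is finite and invariant under the finite permutations fixing `F` (`ExchangeableOff`).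

For such finite measures a Kingman-type theorem is proved directly. A law of large numbers based on
second moments yields the asymptotic frequencies, and a comparison of means shows that almost every
partition is generic (`ExchangeableOff.ae_isGeneric`): outside `F` an integer is a singleton or lies
in a block of positive frequency, and the singletons have the frequency of the dust. A generic
partition is then sampled by permutations spreading the first `n` integers over `n` long disjoint
windows. In the limit, the proportion of samples in an event is at least its probability under the
paintbox of the ranked frequencies (`IsGeneric.paintbox_le_liminf`). Each such permutation preserves
`μ`, so Fatou's lemma gives an inequality between measures, and the complementary event turns it
into an equality (`ExchangeableOff.lintegral_paintbox_eq`).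

On `{rank ≠ one}`, an event determined by the first `n` integers is tested on pieces whose set `F`
lies beyond `n`. These pieces exhaust `{rank ≠ one}`, because otherwise a block of type `i` would be
cofinite. This gives the mixture of paintboxes (`Exchangeable.restrict_eq_bind`). The integrability
of the dislocation measure holds because `defect i x` and the paintbox probability that `0` and `1`
are split are each at most twice the other.

On `{rank = one}` there is no dust, so all integers outside a split pair lie in one block of type
`i`. Having two integers outside the big block has measure zero, since infinitely many disjoint
copies of that event fit into a set of finite measure. Only the partitions `erode n i hi` are left,
with equal masses by exchangeability.

For the converse, the strong law shows that the rank is almost surely `x` under `paintbox x`, so the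
dislocation measure is recovered as an image measure. All measurability questions rest on two facts:
the Prohorov distance induces the σ-algebra of the coordinates (`measurableEmbedding_ofCoord`), and
the σ-algebra of typed partitions is generated by the events determined by finite restrictions. -/

noncomputable section

/-! ### Mass-partitions: uniqueness and existence of rankings -/

namespace MassPartition

variable {k : ℕ}

/-- The pair `(x_n, i_n)`, in the lexicographic order. -/
def key (x : MassPartition k) (n : ℕ) : ℝ ×ₗ Fin (k + 1) := toLex (x.mass n, x.typ n)

theorem key_antitone (x : MassPartition k) : Antitone x.key := by
  refine antitone_nat_of_succ_le fun n => ?_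
  rw [key, key, Prod.Lex.toLex_le_toLex]
  rcases (x.antitone n.le_succ).lt_or_eq with h | h
  · exact Or.inl h
  · exact Or.inr ⟨h, x.typ_le n h.symm⟩

theorem typ_ne_zero (x : MassPartition k) {n : ℕ} (h : 0 < x.mass n) : x.typ n ≠ 0 :=
  fun e => h.ne' ((x.mass_eq_zero_iff n).2 e)

theorem sum_le_one (x : MassPartition k) (s : Finset ℕ) : ∑ n ∈ s, x.mass n ≤ 1 :=
  (x.summable.sum_le_tsum s fun n _ => x.nonneg n).trans x.tsum_le_one

theorem mass_le (x : MassPartition k) (n : ℕ) : x.mass n ≤ 1 / (n + 1) := by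
  rw [le_div_iff₀ (by positivity), mul_comm]
  calc ((n : ℝ) + 1) * x.mass n = ∑ _m ∈ Finset.range (n + 1), x.mass n := by simp
    _ ≤ ∑ m ∈ Finset.range (n + 1), x.mass m :=
      Finset.sum_le_sum fun m hm => x.antitone (by simp at hm; omega)
    _ ≤ 1 := x.sum_le_one _

theorem mass_le_one (x : MassPartition k) (n : ℕ) : x.mass n ≤ 1 := by
  simpa using x.sum_le_one {n}

theorem dust_nonneg (x : MassPartition k) : 0 ≤ x.dust := sub_nonneg.2 x.tsum_le_one

theorem finite_le_mass (x : MassPartition k) {y : ℝ} (hy : 0 < y) : {n | y ≤ x.mass n}.Finite := by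
  have h := x.summable.tendsto_atTop_zero.eventually (gt_mem_nhds hy)
  obtain ⟨N, hN⟩ := eventually_atTop.1 h
  refine (Set.finite_Iio N).subset fun n hn => ?_
  by_contra hn'
  exact (hN n (not_lt.1 hn')).not_ge hn

/-- If `x'.key n < x.key n`, count the indices whose key is at least `x.key n`. There are finitely
many, and equally many for `x` and `x'` by summing multiplicities over keys. But monotonicity gives
at least `n + 1` of them for `x` and at most `n` for `x'`. -/
theorem key_le_of_encard {x x' : MassPartition k}
    (h : ∀ y : ℝ, 0 < y → ∀ j : Fin (k + 1), {n | x.mass n = y ∧ x.typ n = j}.encard =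
      {n | x'.mass n = y ∧ x'.typ n = j}.encard) (n : ℕ) : x.key n ≤ x'.key n := by
  classical
  rcases (x.nonneg n).eq_or_lt with h0 | h0
  · rw [key, key, Prod.Lex.toLex_le_toLex, ← h0, (x.mass_eq_zero_iff n).1 h0.symm]
    rcases (x'.nonneg n).lt_or_eq with h1 | h1
    · exact Or.inl h1
    · exact Or.inr ⟨h1, Fin.zero_le _⟩
  by_contra hlt
  rw [not_le] at hlt
  have hfin : ∀ z : MassPartition k, {m | x.key n ≤ z.key m}.Finite := fun z => by
    refine (z.finite_le_mass h0).subset fun m hm => ?_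
    have hm' : x.key n ≤ z.key m := hm
    rw [key, key, Prod.Lex.toLex_le_toLex] at hm'
    rcases hm' with h | h
    · exact h.le
    · exact h.1.le
  set S := (hfin x).toFinset
  set S' := (hfin x').toFinset
  have hcard : S.card = S'.card := by
    rw [Finset.card_eq_sum_card_fiberwise (f := x.key) (t := S.image x.key ∪ S'.image x'.key)
        fun m hm => Finset.mem_union_left _ (Finset.mem_image_of_mem _ hm),
      Finset.card_eq_sum_card_fiberwise (f := x'.key) (t := S.image x.key ∪ S'.image x'.key)
        fun m hm => Finset.mem_union_right _ (Finset.mem_image_of_mem _ hm)]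
    refine Finset.sum_congr rfl fun v hv => ?_
    have hv' : x.key n ≤ v := by
      simp only [Finset.mem_union, Finset.mem_image, S, S', Set.Finite.mem_toFinset,
        Set.mem_ofPred_eq] at hv
      rcases hv with ⟨m, hm, rfl⟩ | ⟨m, hm, rfl⟩ <;> exact hm
    have hpos : 0 < (ofLex v).1 := by
      have e : v = toLex ((ofLex v).1, (ofLex v).2) := rfl
      rw [e, key, Prod.Lex.toLex_le_toLex] at hv'
      rcases hv' with h | h
      · exact h0.trans h
      · exact h0.trans_eq h.1
    have hset : ∀ z : MassPartition k, ((hfin z).toFinset.filter fun m => z.key m = v : Set ℕ) =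
        {m | z.mass m = (ofLex v).1 ∧ z.typ m = (ofLex v).2} := fun z => by
      ext m
      simp only [Finset.coe_filter, Set.Finite.mem_toFinset, Set.mem_ofPred_eq]
      have e : z.key m = v ↔ z.mass m = (ofLex v).1 ∧ z.typ m = (ofLex v).2 := by
        rw [key, ← toLex_ofLex v, toLex_inj, Prod.ext_iff]; rfl
      rw [← e]
      exact ⟨fun h => h.2, fun h => ⟨h ▸ hv', h⟩⟩
    have key := h _ hpos (ofLex v).2
    rw [← hset x, ← hset x', Set.encard_coe_eq_coe_finsetCard,
      Set.encard_coe_eq_coe_finsetCard] at key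
    exact_mod_cast key
  have h1 : Finset.range (n + 1) ⊆ S := fun m hm => by
    simp only [S, Set.Finite.mem_toFinset, Set.mem_ofPred_eq]
    exact x.key_antitone (by simp at hm; omega)
  have h2 : S' ⊆ Finset.range n := fun m hm => by
    simp only [S', Set.Finite.mem_toFinset, Set.mem_ofPred_eq] at hm
    rw [Finset.mem_range]
    by_contra hm'
    exact (hm.trans (x'.key_antitone (not_lt.1 hm'))).not_gt hlt
  have := Finset.card_le_card h1
  have := Finset.card_le_card h2
  simp only [Finset.card_range] at *
  omega

/-- A mass-partition with types is determined by the multiplicities of its terms. -/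
theorem ext_of_encard {x x' : MassPartition k}
    (h : ∀ y : ℝ, 0 < y → ∀ j : Fin (k + 1), {n | x.mass n = y ∧ x.typ n = j}.encard =
      {n | x'.mass n = y ∧ x'.typ n = j}.encard) : x = x' := by
  have e : ∀ n, x.key n = x'.key n := fun n =>
    le_antisymm (key_le_of_encard h n) (key_le_of_encard (fun y hy j => (h y hy j).symm) n)
  have e' : ∀ n, x.mass n = x'.mass n ∧ x.typ n = x'.typ n := fun n => by
    have := e n
    rwa [key, key, toLex_inj, Prod.ext_iff] at this
  ext n
  · exact (e' n).1
  · exact congrArg Fin.val (e' n).2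

theorem eq_one_of_mass_eq_one {x : MassPartition k} {i : Fin (k + 1)} (hi : i ≠ 0)
    (h1 : x.mass 0 = 1) (h2 : x.typ 0 = i) : x = one i hi := by
  have h : ∀ n, n ≠ 0 → x.mass n = 0 := fun n hn => by
    have := x.sum_le_one {0, n}
    rw [Finset.sum_pair hn.symm, h1] at this
    exact le_antisymm (by linarith) (x.nonneg n)
  ext n
  · by_cases hn : n = 0
    · subst hn; simp [one, h1]
    · simp [one, hn, h n hn]
  · by_cases hn : n = 0
    · subst hn; simp [one, h2]
    · simp [one, hn, (x.mass_eq_zero_iff n).1 (h n hn)]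

/-! ### Ranking a summable family -/

/-- `Precedes w t m' m` says that `m'` has to be ranked strictly before `m`. -/
def Precedes (w : ℕ → ℝ) (t : ℕ → Fin (k + 1)) (m' m : ℕ) : Prop :=
  w m < w m' ∨ (w m = w m' ∧ (t m < t m' ∨ (t m = t m' ∧ m' < m)))

/-- The rank of `m`. -/
def rankIndex (w : ℕ → ℝ) (t : ℕ → Fin (k + 1)) (m : ℕ) : ℕ := {m' | Precedes w t m' m}.ncard

section Ranking

variable {w : ℕ → ℝ} {t : ℕ → Fin (k + 1)}

theorem Precedes.trans {a b c : ℕ} (h : Precedes w t a b) (h' : Precedes w t b c) :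
    Precedes w t a c := by
  unfold Precedes at *
  grind

theorem Precedes.irrefl (a : ℕ) : ¬ Precedes w t a a := by
  unfold Precedes
  grind

theorem precedes_trichotomy {a b : ℕ} (h : a ≠ b) : Precedes w t a b ∨ Precedes w t b a := by
  unfold Precedes
  grind

theorem Precedes.le {a b : ℕ} (h : Precedes w t a b) : w b ≤ w a := by
  unfold Precedes at *
  grind

theorem finite_precedes (hs : Summable w) {m : ℕ} (hm : 0 < w m) :
    {m' | Precedes w t m' m}.Finite := by
  obtain ⟨N, hN⟩ := eventually_atTop.1 (hs.tendsto_atTop_zero.eventually (gt_mem_nhds hm))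
  refine (Set.finite_Iio N).subset fun n hn => ?_
  by_contra hn'
  exact (hN n (not_lt.1 hn')).not_ge (Precedes.le hn)

theorem rankIndex_lt (hs : Summable w) {a b : ℕ} (hb : 0 < w b) (h : Precedes w t a b) :
    rankIndex w t a < rankIndex w t b := by
  refine Set.ncard_lt_ncard ⟨fun c hc => Precedes.trans hc h, fun H => ?_⟩ (finite_precedes hs hb)
  exact Precedes.irrefl a (H h)

theorem rankIndex_injOn (hs : Summable w) : Set.InjOn (rankIndex w t) {m | 0 < w m} := by
  intro a ha b hb h
  by_contra hne
  rcases precedes_trichotomy (w := w) (t := t) hne with h' | h'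
  · exact (rankIndex_lt hs hb h').ne h
  · exact (rankIndex_lt hs ha h').ne h.symm

/-- Pigeonhole: the predecessors of `b` number `rankIndex w t b` and have distinct ranks below it,
so every smaller rank occurs among them. -/
theorem exists_rankIndex_eq (hs : Summable w) {b n : ℕ} (hb : 0 < w b)
    (hn : n < rankIndex w t b) : ∃ a, Precedes w t a b ∧ rankIndex w t a = n := by
  classical
  have hfin := finite_precedes (t := t) hs hb
  have hsub : hfin.toFinset.image (rankIndex w t) ⊆ Finset.range (rankIndex w t b) := by
    intro i hi
    simp only [Finset.mem_image, Set.Finite.mem_toFinset, Set.mem_ofPred_eq] at hi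
    obtain ⟨a, ha, rfl⟩ := hi
    exact Finset.mem_range.2 (rankIndex_lt hs hb ha)
  have hcard : (Finset.range (rankIndex w t b)).card ≤
      (hfin.toFinset.image (rankIndex w t)).card := by
    rw [Finset.card_image_of_injOn, Finset.card_range, rankIndex, Set.ncard_eq_toFinset_card _ hfin]
    intro a ha c hc
    simp only [Set.Finite.coe_toFinset, Set.mem_ofPred_eq] at ha hc
    exact fun e => rankIndex_injOn hs (hb.trans_le ha.le) (hb.trans_le hc.le) e
  have := Finset.eq_of_subset_of_card_le hsub hcard
  have hmem : n ∈ Finset.range (rankIndex w t b) := Finset.mem_range.2 hn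
  rw [← this] at hmem
  simpa using hmem

/-- A summable family of typed masses can be ranked into a mass-partition with types. -/
theorem exists_sort (hw : ∀ m, 0 ≤ w m) (hs : Summable w) (h1 : ∑' m, w m ≤ 1)
    (ht : ∀ m, 0 < w m → t m ≠ 0) :
    ∃ x : MassPartition k, (∀ m, 0 < w m → x.mass (rankIndex w t m) = w m ∧
      x.typ (rankIndex w t m) = t m) ∧ ∀ n, 0 < x.mass n → ∃ m, 0 < w m ∧ rankIndex w t m = n := by
  classical
  set r := rankIndex w t
  have hinj := rankIndex_injOn (t := t) hs
  -- Only positive masses are placed. A zero mass may have infinitely many predecessors, in which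
  -- case its `ncard` rank is a default value without meaning.
  let P : ℕ → Prop := fun n => ∃ m, 0 < w m ∧ r m = n
  let M : ℕ → ℝ := fun n => if h : P n then w h.choose else 0
  let T : ℕ → Fin (k + 1) := fun n => if h : P n then t h.choose else 0
  have hch : ∀ m, 0 < w m → ∃ h : P (r m), h.choose = m := fun m hm =>
    ⟨⟨m, hm, rfl⟩, hinj (Exists.choose_spec (⟨m, hm, rfl⟩ : P (r m))).1 hm
      (Exists.choose_spec (⟨m, hm, rfl⟩ : P (r m))).2⟩
  have hM : ∀ m, 0 < w m → M (r m) = w m := fun m hm => by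
    obtain ⟨h, e⟩ := hch m hm
    simp only [M, dif_pos h, e]
  have hT : ∀ m, 0 < w m → T (r m) = t m := fun m hm => by
    obtain ⟨h, e⟩ := hch m hm
    simp only [T, dif_pos h, e]
  have hM0 : ∀ n, ¬ P n → M n = 0 := fun n h => by simp only [M, dif_neg h]
  have hT0 : ∀ n, ¬ P n → T n = 0 := fun n h => by simp only [T, dif_neg h]
  have hnn : ∀ n, 0 ≤ M n := fun n => by
    by_cases h : P n
    · obtain ⟨m, hm, rfl⟩ := h
      rw [hM m hm]; exact hm.le
    · rw [hM0 n h]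
  -- The ranks of positive masses form an initial segment, so monotonicity can be checked on
  -- consecutive ranks.
  have hsucc : ∀ n, P (n + 1) → ∃ a b, 0 < w a ∧ 0 < w b ∧ r a = n ∧ r b = n + 1 ∧
      Precedes w t a b := by
    rintro n ⟨b, hb, hbn⟩
    obtain ⟨a, ha, han⟩ := exists_rankIndex_eq (t := t) (n := n) hs hb (by
      change n < r b; omega)
    exact ⟨a, b, hb.trans_le ha.le, hb, han, hbn, ha⟩
  let e : {m | 0 < w m} → ℕ := fun m => r m
  have he : Function.Injective e := fun a b h => Subtype.ext (hinj a.2 b.2 h)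
  have hsupp : Function.support M ⊆ Set.range e := fun n hn => by
    by_contra h
    refine hn (hM0 n ?_)
    rintro ⟨m, hm, rfl⟩
    exact h ⟨⟨m, hm⟩, rfl⟩
  have hcomp : M ∘ e = fun m : {m | 0 < w m} => w m := funext fun m => hM m m.2
  have hsum : Summable M := by
    rw [← he.summable_iff (fun n hn => by_contra fun h => hn (hsupp h)), hcomp]
    exact hs.subtype _
  have htsum : ∑' n, M n ≤ 1 := by
    rw [← he.tsum_eq hsupp]
    calc ∑' m, M (e m) = ∑' m : {m | 0 < w m}, w m := by rw [← hcomp]; rfl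
      _ ≤ ∑' m, w m := hs.tsum_subtype_le w _ hw
      _ ≤ 1 := h1
  refine ⟨⟨M, T, hnn, ?_, hsum, htsum, ?_, ?_⟩, fun m hm => ⟨hM m hm, hT m hm⟩, ?_⟩
  · refine antitone_nat_of_succ_le fun n => ?_
    by_cases h : P (n + 1)
    · obtain ⟨a, b, ha, hb, rfl, h2, h3⟩ := hsucc n h
      rw [← h2, hM a ha, hM b hb]
      exact h3.le
    · rw [hM0 _ h]; exact hnn n
  · intro n
    by_cases h : P n
    · obtain ⟨m, hm, rfl⟩ := h
      rw [hM m hm, hT m hm]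
      exact iff_of_false hm.ne' (ht m hm)
    · rw [hM0 _ h, hT0 _ h]; simp
  · intro n hn
    by_cases h : P (n + 1)
    · obtain ⟨a, b, ha, hb, rfl, h2, h3⟩ := hsucc n h
      rw [← h2, hM a ha, hM b hb] at hn
      rw [← h2, hT a ha, hT b hb]
      unfold Precedes at h3
      grind
    · rw [hT0 _ h]; exact Fin.zero_le _
  · intro n hn
    by_contra h
    exact hn.ne' (hM0 n h)

end Ranking

end MassPartition

end

/-! ### The Borel structure of the space of mass-partitions -/

noncomputable section

namespace MassPartition

variable {k : ℕ}

theorem lintegral_scatter {E : Type*} [MeasurableSpace E] [MeasurableSingletonClass E]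
    (x : MassPartition k) (e : E) (f : ℕ → E) (g : E → ℝ≥0∞) :
    ∫⁻ u, g u ∂(x.scatter e f) =
      ENNReal.ofReal x.dust * g e + ∑' n, ENNReal.ofReal (x.mass n) * g (f n) := by
  simp [scatter, lintegral_sum_measure]

theorem scatter_apply {E : Type*} [MeasurableSpace E] [MeasurableSingletonClass E]
    (x : MassPartition k) (e : E) (f : ℕ → E) {s : Set E} (hs : MeasurableSet s) :
    x.scatter e f s =
      ENNReal.ofReal x.dust * s.indicator 1 e +
        ∑' n, ENNReal.ofReal (x.mass n) * s.indicator 1 (f n) := by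
  rw [← lintegral_indicator_one hs, lintegral_scatter]

theorem integral_scatter {E : Type*} [MeasurableSpace E] [MeasurableSingletonClass E]
    (x : MassPartition k) (e : E) (f : ℕ → E) {g : E → ℝ} (hg : StronglyMeasurable g) {C : ℝ}
    (hC : ∀ u, |g u| ≤ C) :
    ∫ u, g u ∂(x.scatter e f) = g e + ∑' n, x.mass n * (g (f n) - g e) := by
  have hint : ∀ μ : Measure E, IsFiniteMeasure μ → Integrable g μ := fun μ _ =>
    Integrable.of_bound hg.aestronglyMeasurable C (ae_of_all _ hC)
  have hfin := (inferInstance : IsProbabilityMeasure (x.scatter e f))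
  have hle : (Measure.sum fun n => ENNReal.ofReal (x.mass n) • Measure.dirac (f n)) ≤
      x.scatter e f := Measure.le_add_left le_rfl
  have hfin' : IsFiniteMeasure
      (Measure.sum fun n => ENNReal.ofReal (x.mass n) • Measure.dirac (f n)) :=
    isFiniteMeasure_of_le _ hle
  have hs : Summable fun n => x.mass n * g (f n) :=
    Summable.of_norm_bounded (x.summable.mul_right C) fun n => by
      rw [norm_mul, Real.norm_of_nonneg (x.nonneg n)]
      exact mul_le_mul_of_nonneg_left (hC _) (x.nonneg n)
  rw [scatter, integral_add_measure ((hint _ inferInstance).smul_measure ENNReal.ofReal_ne_top)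
    (hint _ hfin'), integral_smul_measure, integral_dirac, integral_sum_measure (hint _ hfin')]
  simp only [integral_smul_measure, integral_dirac, ENNReal.toReal_ofReal (x.nonneg _),
    ENNReal.toReal_ofReal x.dust_nonneg, smul_eq_mul, mul_sub]
  rw [hs.tsum_sub (x.summable.mul_right _), tsum_mul_right, dust]
  ring

theorem norm_axisPoint (y : ℝ) {j : Fin (k + 1)} (hj : j ≠ 0) : ‖axisPoint y j‖ = |y| := by
  obtain ⟨l, rfl⟩ := Fin.exists_succ_eq.2 hj
  have : axisPoint y l.succ = EuclideanSpace.single l y := by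
    ext m
    simp [axisPoint, EuclideanSpace.single, Fin.succ_inj, eq_comm]
  rw [this, PiLp.norm_single, Real.norm_eq_abs]

theorem axisPoint_apply (y : ℝ) (j : Fin (k + 1)) (l : Fin k) :
    axisPoint y j l = if j = l.succ then y else 0 := rfl

theorem axisPoint_eq_iff {y y' : ℝ} {j j' : Fin (k + 1)} (hy' : y' ≠ 0) (hj' : j' ≠ 0) :
    axisPoint y j = axisPoint y' j' ↔ y = y' ∧ j = j' := by
  constructor
  · intro h
    obtain ⟨l, rfl⟩ := Fin.exists_succ_eq.2 hj'
    have := congrArg (fun v : EuclideanSpace ℝ (Fin k) => v l) h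
    simp only [axisPoint_apply, if_true] at this
    split_ifs at this with h1
    · exact ⟨this, h1⟩
    · exact absurd this.symm hy'
  · rintro ⟨rfl, rfl⟩; rfl

/-- For `y > 0` and `j ≠ 0`, the atom of `φ_x` at `y e_j` weighs `y` times the number of terms `(y,
j)`. So `φ_x` determines all multiplicities, hence `x`. -/
theorem phi_injective : Function.Injective (phi (k := k)) := by
  intro x x' h
  refine ext_of_encard fun y hy j => ?_
  by_cases hj : j = 0
  · have : ∀ z : MassPartition k, {n | z.mass n = y ∧ z.typ n = j} = ∅ := fun z => by
      ext n
      simp only [Set.mem_ofPred_eq, Set.mem_empty_iff_false, iff_false, not_and]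
      rintro e rfl
      exact hy.ne' (e ▸ (z.mass_eq_zero_iff n).2 hj)
    rw [this, this]
  have key : ∀ z : MassPartition k, (z.phi : Measure (EuclideanSpace ℝ (Fin k))) {axisPoint y j} =
      ENNReal.ofReal y * {n | z.mass n = y ∧ z.typ n = j}.encard := fun z => by
    have h0 : (0 : EuclideanSpace ℝ (Fin k)) ≠ axisPoint y j := fun e => by
      have := congrArg norm e
      rw [norm_zero, norm_axisPoint y hj] at this
      exact hy.ne' (abs_eq_zero.1 this.symm)
    change z.scatter _ _ _ = _
    rw [scatter_apply _ _ _ (measurableSet_singleton _)]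
    have e1 : ∀ n, ENNReal.ofReal (z.mass n) *
        ({axisPoint y j} : Set (EuclideanSpace ℝ (Fin k))).indicator 1
          (axisPoint (z.mass n) (z.typ n)) =
        ENNReal.ofReal y * {n | z.mass n = y ∧ z.typ n = j}.indicator 1 n := fun n => by
      have hmem : n ∈ {n | z.mass n = y ∧ z.typ n = j} ↔ z.mass n = y ∧ z.typ n = j := Iff.rfl
      by_cases hn : z.mass n = y ∧ z.typ n = j
      · rw [Set.indicator_of_mem (by simp [hn]), Set.indicator_of_mem (hmem.2 hn), hn.1]
        simp
      · rw [Set.indicator_of_notMem (by simpa [axisPoint_eq_iff hy.ne' hj] using hn),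
          Set.indicator_of_notMem (mt hmem.1 hn)]
        simp
    simp only [e1]
    rw [Set.indicator_of_notMem (by simpa using h0), mul_zero, zero_add, ENNReal.tsum_mul_left]
    congr 1
    rw [← Measure.count_apply .of_discrete, ← lintegral_indicator_one .of_discrete, lintegral_count]
  have hh := key x
  rw [h, key x'] at hh
  have := (ENNReal.mul_right_inj (ENNReal.ofReal_pos.2 hy).ne' ENNReal.ofReal_ne_top).1 hh
  exact_mod_cast this.symm

/-- The pseudometric separates points because `phi` is injective. This makes singletons measurable
and allows the Lusin–Souslin theorem to be used below. -/
instance : T0Space (MassPartition k) := by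
  refine (t0Space_iff_inseparable _).2 fun x x' h => ?_
  have h1 : dist x x' = 0 := Metric.inseparable_iff.1 h
  have h2 : dist (LevyProkhorov.ofMeasure x.phi) (LevyProkhorov.ofMeasure x'.phi) = 0 := h1
  have h3 := dist_eq_zero.1 h2
  exact phi_injective (congrArg LevyProkhorov.toMeasure h3)

/-- The sequences of masses and types. -/
def coord (x : MassPartition k) : (ℕ → ℝ) × (ℕ → Fin (k + 1)) := (x.mass, x.typ)

theorem coord_injective : Function.Injective (coord (k := k)) := by
  intro x y h
  ext n
  · exact congrFun (congrArg Prod.fst h) n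
  · exact congrArg Fin.val (congrFun (congrArg Prod.snd h) n)

/-- Summability and the bound on the total mass are expressed through partial sums, which leaves
countably many measurable conditions on coordinates. -/
theorem range_coord : Set.range (coord (k := k)) =
    {c | (∀ n, 0 ≤ c.1 n) ∧ (∀ n, c.1 (n + 1) ≤ c.1 n) ∧ (∀ N, ∑ n ∈ Finset.range N, c.1 n ≤ 1) ∧
      (∀ n, c.1 n = 0 ↔ c.2 n = 0) ∧ ∀ n, c.1 n = c.1 (n + 1) → c.2 (n + 1) ≤ c.2 n} := by
  ext ⟨m, t⟩
  constructor
  · rintro ⟨x, hx⟩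
    obtain ⟨rfl, rfl⟩ := Prod.ext_iff.1 hx
    exact ⟨x.nonneg, fun n => x.antitone n.le_succ, fun N => x.sum_le_one _, x.mass_eq_zero_iff,
      x.typ_le⟩
  · rintro ⟨h1, h2, h3, h4, h5⟩
    have hs : Summable m := summable_of_sum_range_le h1 h3
    exact ⟨⟨m, t, h1, antitone_nat_of_succ_le h2, hs,
      Real.tsum_le_of_sum_range_le h1 h3, h4, h5⟩, rfl⟩

theorem measurableSet_range_coord : MeasurableSet (Set.range (coord (k := k))) := by
  rw [range_coord]
  have h1 : ∀ n, Measurable fun c : (ℕ → ℝ) × (ℕ → Fin (k + 1)) => c.1 n := fun n => by fun_prop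
  have h2 : ∀ n, Measurable fun c : (ℕ → ℝ) × (ℕ → Fin (k + 1)) => c.2 n := fun n => by fun_prop
  simp only [Set.ofPred_and, Set.ofPred_forall]
  refine (MeasurableSet.iInter fun n => measurableSet_le measurable_const (h1 n)).inter
    ((MeasurableSet.iInter fun n => measurableSet_le (h1 _) (h1 n)).inter
    ((MeasurableSet.iInter fun n => measurableSet_le
      (Finset.measurable_sum _ fun i _ => h1 i) measurable_const).inter
    ((MeasurableSet.iInter fun n => ?_).inter (MeasurableSet.iInter fun n => ?_))))
  · exact MeasurableSet.iff (measurableSet_eq_fun (h1 n) measurable_const)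
      (measurableSet_eq_fun (h2 n) measurable_const)
  · exact MeasurableSet.imp (measurableSet_eq_fun (h1 n) (h1 _))
      (measurableSet_le (h2 _) (h2 n))

/-- A sequence of masses and types as a mass-partition with types. -/
def ofCoord (c : Set.range (coord (k := k))) : MassPartition k := c.2.choose

theorem coord_ofCoord (c : Set.range (coord (k := k))) : (ofCoord c).coord = c := c.2.choose_spec

theorem ofCoord_coord (x : MassPartition k) : ofCoord ⟨x.coord, x, rfl⟩ = x :=
  coord_injective (coord_ofCoord _)

theorem ofCoord_injective : Function.Injective (ofCoord (k := k)) := fun c d h =>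
  Subtype.ext (by rw [← coord_ofCoord, h, coord_ofCoord])

/-- Weak convergence is tested on a bounded continuous `g`. The series for the integral of `g` is a
uniform limit of its partial sums: the `n`-th mass is at most `1 / (n + 1)`, so far terms sit near
the origin, where `g` is close to `g 0`, and their total weight is at most one. -/
theorem continuous_ofCoord : Continuous (ofCoord (k := k)) := by
  have hind : Topology.IsInducing fun x : MassPartition k => LevyProkhorov.ofMeasure x.phi :=
    ⟨rfl⟩
  rw [hind.continuous_iff]
  refine (LevyProkhorov.continuous_ofMeasure_probabilityMeasure).comp ?_
  rw [continuous_iff_continuousAt]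
  intro c
  change Tendsto _ _ _
  rw [ProbabilityMeasure.tendsto_iff_forall_integral_tendsto]
  intro g
  obtain ⟨C, hC⟩ : ∃ C, ∀ u, |g u| ≤ C := ⟨‖g‖, fun u => g.norm_coe_le_norm u⟩
  have hrw : ∀ d : Set.range (coord (k := k)),
      ∫ u, g u ∂((ofCoord d).phi : Measure (EuclideanSpace ℝ (Fin k))) =
      g 0 + ∑' n, d.1.1 n * (g (axisPoint (d.1.1 n) (d.1.2 n)) - g 0) := fun d => by
    have h1 : (ofCoord d).mass = d.1.1 := congrArg Prod.fst (coord_ofCoord d)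
    have h2 : (ofCoord d).typ = d.1.2 := congrArg Prod.snd (coord_ofCoord d)
    rw [← h1, ← h2]
    exact integral_scatter _ _ _ g.continuous.stronglyMeasurable hC
  simp only [hrw]
  refine Tendsto.const_add _ ?_
  refine Continuous.tendsto (f := fun d : Set.range (coord (k := k)) =>
    ∑' n, d.1.1 n * (g (axisPoint (d.1.1 n) (d.1.2 n)) - g 0)) ?_ c
  rw [← continuousOn_univ]
  refine continuousOn_of_uniform_approx_of_continuousOn fun U hU => ?_
  obtain ⟨ε, hε, hU⟩ := Metric.mem_uniformity_dist.1 hU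
  obtain ⟨δ, hδ, hg⟩ := Metric.continuousAt_iff.1 (g.continuous.continuousAt (x := 0)) (ε / 2)
    (by positivity)
  obtain ⟨N, hN⟩ := exists_nat_one_div_lt hδ
  refine ⟨fun d => ∑ n ∈ Finset.range N,
    d.1.1 n * (g (axisPoint (d.1.1 n) (d.1.2 n)) - g 0), ?_, ?_⟩
  · refine continuousOn_univ.2 (continuous_finsetSum _ fun n _ => ?_)
    have c1 : Continuous fun d : Set.range (coord (k := k)) => d.1.1 n := by fun_prop
    have c2 : Continuous fun d : Set.range (coord (k := k)) => d.1.2 n := by fun_prop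
    have c3 : Continuous fun p : ℝ × Fin (k + 1) => axisPoint p.1 p.2 := by
      refine continuous_prod_of_discrete_right.2 fun j => ?_
      refine (PiLp.continuous_toLp 2 _).comp (continuous_pi fun l => ?_)
      by_cases h : j = l.succ
      · simp only [h, if_true]; exact continuous_id
      · simp only [h, if_false]; exact continuous_const
    exact c1.mul ((g.continuous.comp (c3.comp (c1.prodMk c2))).sub continuous_const)
  · intro d _
    refine hU ?_
    set x := ofCoord d with hx
    have h1 : d.1.1 = x.mass := (congrArg Prod.fst (coord_ofCoord d)).symm
    have h2 : d.1.2 = x.typ := (congrArg Prod.snd (coord_ofCoord d)).symm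
    simp only [h1, h2]
    set f : ℕ → ℝ := fun n => x.mass n * (g (axisPoint (x.mass n) (x.typ n)) - g 0)
    have hs : Summable f :=
      Summable.of_norm_bounded (x.summable.mul_right (C + C)) fun n => by
        rw [norm_mul, Real.norm_of_nonneg (x.nonneg n)]
        refine mul_le_mul_of_nonneg_left ?_ (x.nonneg n)
        exact (norm_sub_le _ _).trans (add_le_add (hC _) (hC _))
    rw [← hs.sum_add_tsum_nat_add N, Real.dist_eq, add_sub_cancel_left]
    have hterm : ∀ n, ‖f (n + N)‖ ≤ x.mass (n + N) * (ε / 2) := fun n => by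
      rw [norm_mul, Real.norm_of_nonneg (x.nonneg _)]
      rcases (x.nonneg (n + N)).eq_or_lt with h0 | h0
      · rw [← h0]; simp
      refine mul_le_mul_of_nonneg_left (le_of_lt ?_) h0.le
      rw [← dist_eq_norm]
      refine hg ?_
      rw [dist_zero_right, norm_axisPoint _ (x.typ_ne_zero h0), abs_of_pos h0]
      calc x.mass (n + N) ≤ x.mass N := x.antitone (by omega)
        _ ≤ 1 / (N + 1) := x.mass_le N
        _ < δ := hN
    have hsN : Summable fun n => x.mass (n + N) := (summable_nat_add_iff N).2 x.summable
    calc |∑' n, f (n + N)| ≤ ∑' n, x.mass (n + N) * (ε / 2) :=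
          tsum_of_norm_bounded (hsN.mul_right _).hasSum hterm
      _ = (∑' n, x.mass (n + N)) * (ε / 2) := tsum_mul_right
      _ ≤ 1 * (ε / 2) := by
          refine mul_le_mul_of_nonneg_right ?_ (by positivity)
          have := x.summable.sum_add_tsum_nat_add N
          have h3 := x.tsum_le_one
          have h4 : 0 ≤ ∑ i ∈ Finset.range N, x.mass i := Finset.sum_nonneg fun i _ => x.nonneg i
          linarith
      _ < ε := by linarith

/-- Lusin–Souslin: a continuous injection of a Borel subset of a Polish space. Consequently the
Prohorov σ-algebra is the one generated by masses and types. -/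
theorem measurableEmbedding_ofCoord : MeasurableEmbedding (ofCoord (k := k)) := by
  have hsurj : Function.Surjective (ofCoord (k := k)) := fun x => ⟨_, ofCoord_coord x⟩
  have : TopologicalSpace.SeparableSpace (MassPartition k) :=
    hsurj.denseRange.separableSpace continuous_ofCoord
  have : SecondCountableTopology (MassPartition k) :=
    UniformSpace.secondCountable_of_separable _
  have : StandardBorelSpace (Set.range (coord (k := k))) :=
    measurableSet_range_coord.standardBorel
  exact continuous_ofCoord.measurable.measurableEmbedding ofCoord_injective

/-- A map into the mass-partitions with types is measurable if its coordinates are. -/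
theorem measurable_of_coord {Ω : Type*} [MeasurableSpace Ω] {g : Ω → MassPartition k}
    (h1 : ∀ n, Measurable fun ω => (g ω).mass n) (h2 : ∀ n, Measurable fun ω => (g ω).typ n) :
    Measurable g := by
  have h : g = ofCoord ∘ fun ω => ⟨(g ω).coord, g ω, rfl⟩ :=
    funext fun ω => (ofCoord_coord (g ω)).symm
  rw [h]
  refine measurableEmbedding_ofCoord.measurable.comp (Measurable.subtype_mk ?_)
  exact (measurable_pi_lambda _ h1).prodMk (measurable_pi_lambda _ h2)

theorem measurable_coord : Measurable (coord (k := k)) := by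
  have h : Measurable fun x : MassPartition k =>
      (⟨x.coord, x, rfl⟩ : Set.range (coord (k := k))) := by
    intro s hs
    have := measurableEmbedding_ofCoord.measurableSet_image.2 hs
    convert this using 1
    ext x
    constructor
    · exact fun hx => ⟨_, hx, ofCoord_coord x⟩
    · rintro ⟨c, hc, rfl⟩
      have e : (⟨(ofCoord c).coord, ofCoord c, rfl⟩ : Set.range (coord (k := k))) = c :=
        Subtype.ext (coord_ofCoord c)
      rw [Set.mem_preimage, e]
      exact hc
  exact measurable_subtype_coe.comp h

theorem measurable_mass (n : ℕ) : Measurable fun x : MassPartition k => x.mass n :=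
  (measurable_pi_apply n).comp (measurable_fst.comp measurable_coord)

theorem measurable_typ (n : ℕ) : Measurable fun x : MassPartition k => x.typ n :=
  (measurable_pi_apply n).comp (measurable_snd.comp measurable_coord)

theorem measurable_dust : Measurable fun x : MassPartition k => x.dust :=
  measurable_const.sub (Measurable.tsum fun n => measurable_mass n)

end MassPartition

end

/-! ### Typed partitions: measurability, frequencies and the ranking map -/

noncomputable section

namespace TypedPartition

variable {k : ℕ}

/-! ### Sets determined by a restriction -/

theorem restrict_eq_of {n : ℕ} {π π' : TypedPartition k ℕ}
    (h1 : ∀ a b, a < n → b < n → (π.rel a b ↔ π'.rel a b))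
    (h2 : ∀ a b, a < n → b < n → b ≠ a → π.rel a b → π.typ a = π'.typ a) :
    π.restrict n = π'.restrict n := by
  ext a b
  · exact h1 a b a.2 b.2
  · have key : (∀ c : Fin n, π.rel a c → c = a) ↔ ∀ c : Fin n, π'.rel a c → c = a :=
      forall_congr' fun c => by rw [h1 a c a.2 c.2]
    by_cases h : ∀ c : Fin n, π'.rel a c → c = a
    · rw [restrict_typ_of_forall h, restrict_typ_of_forall (key.2 h)]
    · rw [restrict_typ_of_not_forall h, restrict_typ_of_not_forall (mt key.1 h)]
      have h' := mt key.1 h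
      push Not at h'
      obtain ⟨c, hc, hca⟩ := h'
      rw [h2 a c a.2 c.2 (fun e => hca (Fin.ext e)) hc]

theorem rel_iff_of_restrict_eq {n : ℕ} {π π' : TypedPartition k ℕ}
    (h : π.restrict n = π'.restrict n) {a b : ℕ} (ha : a < n) (hb : b < n) :
    π.rel a b ↔ π'.rel a b := by
  have := congrArg (fun p : TypedPartition k (Fin n) => p.rel ⟨a, ha⟩ ⟨b, hb⟩) h
  exact iff_of_eq this

theorem typ_eq_of_restrict_eq {n : ℕ} {π π' : TypedPartition k ℕ}
    (h : π.restrict n = π'.restrict n) {a b : ℕ} (ha : a < n) (hb : b < n) (hab : b ≠ a)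
    (hr : π.rel a b) : π.typ a = π'.typ a := by
  have ht := congrArg (fun p : TypedPartition k (Fin n) => p.typ ⟨a, ha⟩) h
  rwa [restrict_typ_of_not_forall fun H => hab (by simpa using H ⟨b, hb⟩ hr),
    restrict_typ_of_not_forall fun H =>
      hab (by simpa using H ⟨b, hb⟩ ((rel_iff_of_restrict_eq h ha hb).1 hr))] at ht

/-- The set `A` only depends on the restriction to the first `n` integers. -/
def Determined (n : ℕ) (A : Set (TypedPartition k ℕ)) : Prop :=
  ∀ π π' : TypedPartition k ℕ, π.restrict n = π'.restrict n → π ∈ A → π' ∈ A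

theorem Determined.mono {m n : ℕ} {A : Set (TypedPartition k ℕ)} (h : Determined m A)
    (hmn : m ≤ n) : Determined n A :=
  fun π π' e => h π π' (restrict_eq_of_le hmn e)

theorem Determined.compl {n : ℕ} {A : Set (TypedPartition k ℕ)} (h : Determined n A) :
    Determined n Aᶜ :=
  fun π π' e hπ hπ' => hπ (h π' π e.symm hπ')

theorem Determined.inter {n : ℕ} {A B : Set (TypedPartition k ℕ)} (hA : Determined n A)
    (hB : Determined n B) : Determined n (A ∩ B) :=
  fun π π' e h => ⟨hA π π' e h.1, hB π π' e h.2⟩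

theorem Determined.isOpen {n : ℕ} {A : Set (TypedPartition k ℕ)} (h : Determined n A) :
    IsOpen A := by
  rw [Metric.isOpen_iff]
  intro π hπ
  refine ⟨1 / (n + 1), by positivity, fun π' hd => ?_⟩
  rw [Metric.mem_ball, dist_comm] at hd
  by_cases e : π = π'
  · exact e ▸ hπ
  refine h π π' (restrict_eq_of_le ?_ (sSup_agree_mem e)) hπ
  have hd' : distance π π' < 1 / (n + 1) := hd
  rw [distance, if_neg e] at hd'
  have h1 : (0 : ℝ) < (sSup {n : ℕ | π.restrict n = π'.restrict n} : ℕ) := by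
    exact_mod_cast one_le_sSup_agree e
  rw [one_div_lt_one_div h1 (by positivity)] at hd'
  have : n + 1 < sSup {n : ℕ | π.restrict n = π'.restrict n} := by exact_mod_cast hd'
  omega

theorem Determined.measurableSet {n : ℕ} {A : Set (TypedPartition k ℕ)} (h : Determined n A) :
    MeasurableSet A := h.isOpen.measurableSet

/-- An open `U` is the countable union over `n` of the sets of partitions whose whole class of
agreement on the first `n` integers lies in `U`, and each of these is determined. -/
theorem generateFrom_determined :
    borel (TypedPartition k ℕ) =
      MeasurableSpace.generateFrom {A | ∃ n, Determined n A} := by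
  refine le_antisymm ?_ (MeasurableSpace.generateFrom_le ?_)
  · refine MeasurableSpace.generateFrom_le fun U (hU : IsOpen U) => ?_
    have hU' : U = ⋃ n, {π | ∀ π', π.restrict n = π'.restrict n → π' ∈ U} := by
      ext π
      simp only [Set.mem_iUnion, Set.mem_ofPred_eq]
      constructor
      · intro hπ
        obtain ⟨ε, hε, hb⟩ := Metric.isOpen_iff.1 hU π hπ
        obtain ⟨n, hn⟩ := exists_nat_one_div_lt hε
        refine ⟨n + 1, fun π' e => hb ?_⟩
        rw [Metric.mem_ball, dist_comm]
        refine lt_of_le_of_lt ?_ hn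
        change distance π π' ≤ _
        by_cases e' : π = π'
        · rw [distance, if_pos e']; positivity
        · rw [distance, if_neg e']
          refine one_div_le_one_div_of_le (by positivity) ?_
          have : n + 1 ≤ sSup {n : ℕ | π.restrict n = π'.restrict n} :=
            le_csSup (bddAbove_agree e') e
          exact_mod_cast this
      · rintro ⟨n, hn⟩
        exact hn π rfl
    rw [hU']
    refine MeasurableSet.iUnion fun n => MeasurableSpace.measurableSet_generateFrom ⟨n, ?_⟩
    exact fun π π' e h π'' e' => h π'' (e.trans e')
  · rintro A ⟨n, hA⟩
    exact hA.measurableSet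

theorem isPiSystem_determined :
    IsPiSystem {A : Set (TypedPartition k ℕ) | ∃ n, Determined n A} := by
  rintro A ⟨m, hA⟩ B ⟨n, hB⟩ -
  exact ⟨max m n, (hA.mono (le_max_left _ _)).inter (hB.mono (le_max_right _ _))⟩

theorem measurable_of_rel_typ {Ω : Type*} [MeasurableSpace Ω] {f : Ω → TypedPartition k ℕ}
    (hr : ∀ a b, MeasurableSet {ω | (f ω).rel a b})
    (ht : ∀ a j, MeasurableSet {ω | (f ω).typ a = j}) : Measurable f := by
  change @Measurable _ _ _ (borel _) f
  rw [generateFrom_determined]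
  refine measurable_generateFrom ?_
  rintro A ⟨n, hA⟩
  -- The relations and types of the first `n` integers take values in a finite space, where every
  -- subset is measurable.
  let c : Ω → (Fin n → Fin n → Prop) × (Fin n → Fin (k + 1)) :=
    fun ω => (fun a b => (f ω).rel a b, fun a => (f ω).typ a)
  have hc : Measurable c := by
    refine Measurable.prodMk ?_ ?_
    · refine measurable_pi_lambda _ fun a => measurable_pi_lambda _ fun b => ?_
      exact measurableSet_setOfPred.1 (hr a b)
    · refine measurable_pi_lambda _ fun a => measurable_to_countable' fun j => ht a j
  have : f ⁻¹' A = c ⁻¹' (c '' (f ⁻¹' A)) := by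
    refine (Set.subset_preimage_image _ _).antisymm ?_
    rintro ω ⟨ω', hω', e⟩
    refine hA _ _ (restrict_eq_of ?_ ?_) hω'
    · intro a b ha hb
      exact iff_of_eq (congrFun (congrFun (congrArg Prod.fst e) ⟨a, ha⟩) ⟨b, hb⟩)
    · intro a b ha _ _ _
      exact congrFun (congrArg Prod.snd e) ⟨a, ha⟩
  rw [this]
  exact hc (Set.toFinite _).measurableSet

theorem measurableSet_rel (a b : ℕ) :
    MeasurableSet {π : TypedPartition k ℕ | π.rel a b} := by
  have : Determined (max a b + 1) {π : TypedPartition k ℕ | π.rel a b} := fun π π' e h =>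
    (rel_iff_of_restrict_eq e (by omega) (by omega)).1 h
  exact this.measurableSet

theorem measurableSet_rel_and_typ {a b : ℕ} (hab : b ≠ a) (j : Fin (k + 1)) :
    MeasurableSet {π : TypedPartition k ℕ | π.rel a b ∧ π.typ a = j} := by
  have : Determined (max a b + 1) {π : TypedPartition k ℕ | π.rel a b ∧ π.typ a = j} :=
    fun π π' e h => ⟨(rel_iff_of_restrict_eq e (by omega) (by omega)).1 h.1,
      (typ_eq_of_restrict_eq e (by omega) (by omega) hab h.1) ▸ h.2⟩
  exact this.measurableSet

/-- The type of `a` is not visible in any fixed restriction, where `a` may appear as a singleton.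
Type `0` is a countable intersection over possible partners `b`, and a nonzero type is a countable
union over actual ones. -/
theorem measurable_typ (a : ℕ) : Measurable fun π : TypedPartition k ℕ => π.typ a := by
  refine measurable_to_countable' fun j => ?_
  by_cases hj : j = 0
  · have : (fun π : TypedPartition k ℕ => π.typ a) ⁻¹' {j} =
        ⋂ b, {π | π.rel a b → b = a} := by
      ext π
      simp [hj, typ_eq_zero_iff]
    rw [this]
    exact MeasurableSet.iInter fun b => (measurableSet_rel a b).imp (.const _)
  · have : (fun π : TypedPartition k ℕ => π.typ a) ⁻¹' {j} =
        ⋃ b, ⋃ _ : b ≠ a, {π | π.rel a b ∧ π.typ a = j} := by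
      ext π
      simp only [Set.mem_preimage, Set.mem_singleton_iff, Set.mem_iUnion, Set.mem_ofPred_eq,
        exists_prop]
      constructor
      · intro h
        have h0 : ¬ ∀ b, π.rel a b → b = a := fun H => hj (h ▸ (π.typ_eq_zero_iff a).2 H)
        push Not at h0
        obtain ⟨b, hb, hba⟩ := h0
        exact ⟨b, hba, hb, h⟩
      · rintro ⟨b, -, -, h⟩; exact h
    rw [this]
    exact MeasurableSet.iUnion fun b => MeasurableSet.iUnion fun hb =>
      measurableSet_rel_and_typ hb j

theorem measurable_permute (σ : Equiv.Perm ℕ) : Measurable (permute (k := k) σ) := by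
  refine measurable_of_rel_typ (fun a b => measurableSet_rel _ _) fun a j => ?_
  simp only [permute_typ]
  exact measurable_typ (σ a) (measurableSet_singleton j)

theorem permute_rel (σ : Equiv.Perm ℕ) (π : TypedPartition k ℕ) (a b : ℕ) :
    (π.permute σ).rel a b ↔ π.rel (σ a) (σ b) := Iff.rfl

theorem permute_permute (σ τ : Equiv.Perm ℕ) (π : TypedPartition k ℕ) :
    (π.permute σ).permute τ = π.permute (σ * τ) := by
  ext a b
  · simp [permute_rel]
  · simp [permute_typ]

theorem permute_one (π : TypedPartition k ℕ) : π.permute 1 = π := by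
  ext a b
  · simp [permute_rel]
  · simp [permute_typ]

/-! ### Asymptotic frequencies -/

/-- The number of elements of `B` smaller than `n`. -/
def cnt (B : Set ℕ) (n : ℕ) : ℕ := (B ∩ Set.Iio n).ncard

theorem cnt_le (B : Set ℕ) (n : ℕ) : cnt B n ≤ n := by
  have := Set.ncard_le_ncard (Set.inter_subset_right (s := B) (t := Set.Iio n)) (Set.finite_Iio n)
  simpa [cnt] using this

open Classical in
theorem cnt_eq_sum (B : Set ℕ) (n : ℕ) :
    cnt B n = ∑ m ∈ Finset.range n, if m ∈ B then 1 else 0 := by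
  have : B ∩ Set.Iio n = ((Finset.range n).filter (· ∈ B) : Finset ℕ) := by
    ext m; simp [and_comm]
  rw [cnt, this, Set.ncard_coe_finset, Finset.card_filter]

theorem cnt_monotone (B : Set ℕ) : Monotone (cnt B) := fun _ n h =>
  Set.ncard_le_ncard (Set.inter_subset_inter_right _ (Set.Iio_subset_Iio h))
    ((Set.finite_Iio n).inter_of_right _)

theorem cnt_union_of_disjoint {B B' : Set ℕ} (h : Disjoint B B') (n : ℕ) :
    cnt (B ∪ B') n = cnt B n + cnt B' n := by
  rw [cnt, Set.union_inter_distrib_right, Set.ncard_union_eq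
    (h.mono Set.inter_subset_left Set.inter_subset_left)
    ((Set.finite_Iio n).inter_of_right _) ((Set.finite_Iio n).inter_of_right _)]
  rfl

theorem HasFrequency.unique {B : Set ℕ} {y y' : ℝ} (h : HasFrequency B y)
    (h' : HasFrequency B y') : y = y' := tendsto_nhds_unique h h'

theorem HasFrequency.nonneg {B : Set ℕ} {y : ℝ} (h : HasFrequency B y) : 0 ≤ y :=
  ge_of_tendsto' h fun n => by positivity

theorem HasFrequency.le_one {B : Set ℕ} {y : ℝ} (h : HasFrequency B y) : y ≤ 1 :=
  le_of_tendsto' h fun n => div_le_one_of_le₀ (by exact_mod_cast cnt_le B n) (by positivity)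

theorem HasFrequency.union {B B' : Set ℕ} {y y' : ℝ} (h : HasFrequency B y)
    (h' : HasFrequency B' y') (hB : Disjoint B B') : HasFrequency (B ∪ B') (y + y') := by
  refine (Tendsto.add h h').congr fun n => ?_
  rw [← add_div]
  congr 1
  exact_mod_cast (cnt_union_of_disjoint hB n).symm

theorem HasFrequency.compl {B : Set ℕ} {y : ℝ} (h : HasFrequency B y) :
    HasFrequency Bᶜ (1 - y) := by
  refine ((tendsto_const_nhds (x := (1 : ℝ))).sub h).congr' ?_
  filter_upwards [eventually_gt_atTop 0] with n hn
  have h1 := cnt_union_of_disjoint (disjoint_compl_right (a := B)) n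
  have h2 : cnt (B ∪ Bᶜ) n = n := by simp [cnt]
  rw [h2] at h1
  have h3 : (n : ℝ) = cnt B n + cnt Bᶜ n := by exact_mod_cast h1
  have hn' : (n : ℝ) ≠ 0 := by positivity
  rw [one_sub_div hn']
  congr 1
  exact sub_eq_of_eq_add' h3

theorem hasFrequency_of_finite {B : Set ℕ} (h : B.Finite) : HasFrequency B 0 := by
  refine squeeze_zero (fun n => by positivity) (fun n => ?_)
    (tendsto_const_div_atTop_nhds_zero_nat (B.ncard : ℝ))
  refine div_le_div_of_nonneg_right ?_ (by positivity)
  exact_mod_cast Set.ncard_le_ncard Set.inter_subset_left h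

theorem HasFrequency.biUnion {ι : Type*} {s : Finset ι} {B : ι → Set ℕ} {y : ι → ℝ}
    (h : ∀ i ∈ s, HasFrequency (B i) (y i)) (hd : (s : Set ι).PairwiseDisjoint B) :
    HasFrequency (⋃ i ∈ s, B i) (∑ i ∈ s, y i) := by
  classical
  induction s using Finset.induction_on with
  | empty => simpa using hasFrequency_of_finite Set.finite_empty
  | insert a s ha ih =>
    rw [Finset.set_biUnion_insert, Finset.sum_insert ha]
    refine HasFrequency.union (h a (Finset.mem_insert_self _ _))
      (ih (fun i hi => h i (Finset.mem_insert_of_mem hi))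
        (hd.subset (by simp))) ?_
    rw [Set.disjoint_iUnion₂_right]
    intro i hi
    exact hd (by simp) (by simp [hi]) (fun e => ha (e ▸ hi))

/-- A permutation with finite support maps every long enough initial segment onto itself, so the
counts agree eventually. -/
theorem HasFrequency.preimage {B : Set ℕ} {y : ℝ} (h : HasFrequency B y) {σ : Equiv.Perm ℕ}
    (hσ : {n | σ n ≠ n}.Finite) : HasFrequency (σ ⁻¹' B) y := by
  obtain ⟨N, hN⟩ := hσ.bddAbove
  refine Tendsto.congr' ?_ h
  filter_upwards [eventually_gt_atTop N] with n hn
  congr 2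
  have hfix : ∀ m, n ≤ m → σ m = m := fun m hm => by
    by_contra hne
    have := hN hne
    omega
  have himg : B ∩ Set.Iio n = σ '' (σ ⁻¹' B ∩ Set.Iio n) := by
    ext m
    constructor
    · rintro ⟨h1, h2⟩
      refine ⟨σ.symm m, ⟨by simpa using h1, ?_⟩, by simp⟩
      by_contra h3
      have := hfix _ (not_lt.1 h3)
      rw [Equiv.apply_symm_apply] at this
      rw [← this] at h3
      exact h3 h2
    · rintro ⟨m, ⟨h1, h2⟩, rfl⟩
      refine ⟨h1, ?_⟩
      by_contra h3
      have := σ.injective (hfix _ (not_lt.1 h3))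
      rw [this] at h3
      exact h3 h2
  rw [himg, Set.ncard_image_of_injective _ σ.injective]

/-- The frequency, with a default value for sets without one. -/
def freq (B : Set ℕ) : ℝ := limsup (fun n : ℕ => (cnt B n : ℝ) / n) atTop

theorem HasFrequency.freq_eq {B : Set ℕ} {y : ℝ} (h : HasFrequency B y) : freq B = y :=
  Tendsto.limsup_eq h

/-- The number of elements of `B` in the window `[C + l n, C + (l + 1) n)`, divided by `n`. -/
theorem HasFrequency.window {B : Set ℕ} {y : ℝ} (h : HasFrequency B y) (C l : ℕ) :
    Tendsto (fun n : ℕ => ((cnt B (C + (l + 1) * n) : ℝ) - cnt B (C + l * n)) / n) atTop (𝓝 y) := by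
  have key : ∀ l : ℕ, Tendsto (fun n : ℕ => (cnt B (C + l * n) : ℝ) / n) atTop (𝓝 (l * y)) := by
    intro l
    rcases Nat.eq_zero_or_pos l with rfl | hl
    · simpa using tendsto_const_div_atTop_nhds_zero_nat (cnt B C : ℝ)
    have h1 : Tendsto (fun n : ℕ => C + l * n) atTop atTop :=
      tendsto_atTop_mono (fun n => (Nat.le_mul_of_pos_left n hl).trans (Nat.le_add_left _ _)) tendsto_id
    have h2 : Tendsto (fun n : ℕ => ((C + l * n : ℕ) : ℝ) / n) atTop (𝓝 l) := by
      have := (tendsto_const_div_atTop_nhds_zero_nat (C : ℝ)).add_const (l : ℝ)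
      rw [zero_add] at this
      refine this.congr' ?_
      filter_upwards [eventually_gt_atTop 0] with n hn
      have hn' : (n : ℝ) ≠ 0 := by positivity
      push_cast
      field_simp
    have h3 := (h2.mul (h.comp h1))
    refine h3.congr' ?_
    filter_upwards [eventually_gt_atTop 0] with n hn
    have hn' : ((C + l * n : ℕ) : ℝ) ≠ 0 := by
      have : 0 < C + l * n := by positivity
      exact_mod_cast this.ne'
    simp only [Function.comp, cnt]
    field_simp
  have := (key (l + 1)).sub (key l)
  push_cast at this
  rw [add_mul, one_mul, add_sub_cancel_left] at this
  exact this.congr fun n => (sub_div _ _ _).symm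

/-! ### Blocks -/

/-- The block of `a`. -/
def block (π : TypedPartition k ℕ) (a : ℕ) : Set ℕ := {b | π.rel b a}

theorem mem_block {π : TypedPartition k ℕ} {a b : ℕ} : b ∈ π.block a ↔ π.rel b a := Iff.rfl

theorem self_mem_block (π : TypedPartition k ℕ) (a : ℕ) : a ∈ π.block a := π.rel.refl a

theorem block_eq_iff {π : TypedPartition k ℕ} {a b : ℕ} : π.block a = π.block b ↔ π.rel a b := by
  constructor
  · intro h
    have := self_mem_block π a
    rwa [h] at this
  · intro h
    ext c
    exact ⟨fun h' => π.rel.trans h' h, fun h' => π.rel.trans h' (π.rel.symm h)⟩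

theorem block_disjoint {π : TypedPartition k ℕ} {a b : ℕ} (h : ¬ π.rel a b) :
    Disjoint (π.block a) (π.block b) := by
  rw [Set.disjoint_left]
  exact fun c hc hc' => h (π.rel.trans (π.rel.symm hc) hc')

theorem hasFrequencies_iff {π : TypedPartition k ℕ} :
    π.HasFrequencies ↔ ∀ a, ∃ y, HasFrequency (π.block a) y := by
  constructor
  · exact fun h a => h _ ⟨a, rfl⟩
  · rintro h B ⟨a, rfl⟩
    exact h a

theorem HasFrequencies.hasFrequency {π : TypedPartition k ℕ} (h : π.HasFrequencies) (a : ℕ) :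
    HasFrequency (π.block a) (freq (π.block a)) := by
  obtain ⟨y, hy⟩ := hasFrequencies_iff.1 h a
  rwa [hy.freq_eq]

theorem block_permute (σ : Equiv.Perm ℕ) (π : TypedPartition k ℕ) (a : ℕ) :
    (π.permute σ).block a = σ ⁻¹' π.block (σ a) := rfl

theorem measurable_cnt_block (a n : ℕ) :
    Measurable fun π : TypedPartition k ℕ => (cnt (π.block a) n : ℝ) := by
  classical
  simp only [cnt_eq_sum]
  push_cast
  refine Finset.measurable_sum _ fun m _ => ?_
  refine Measurable.ite (measurableSet_rel m a) measurable_const measurable_const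

theorem measurable_freq_block (a : ℕ) :
    Measurable fun π : TypedPartition k ℕ => freq (π.block a) :=
  Measurable.limsup fun n => (measurable_cnt_block a n).div_const _

theorem measurableSet_hasFrequencies :
    MeasurableSet {π : TypedPartition k ℕ | π.HasFrequencies} := by
  simp only [hasFrequencies_iff, Set.ofPred_forall]
  exact MeasurableSet.iInter fun a =>
    measurableSet_exists_tendsto fun n => (measurable_cnt_block a n).div_const _

theorem hasFrequencies_permute {π : TypedPartition k ℕ} (h : π.HasFrequencies)
    {σ : Equiv.Perm ℕ} (hσ : {n | σ n ≠ n}.Finite) : (π.permute σ).HasFrequencies := by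
  rw [hasFrequencies_iff]
  exact fun a => ⟨_, (h.hasFrequency (σ a)).preimage hσ⟩

theorem typ_ne_zero_of_freq_pos {π : TypedPartition k ℕ} {a : ℕ} (h : 0 < freq (π.block a)) :
    π.typ a ≠ 0 := by
  intro h0
  have hs : π.block a ⊆ {a} := fun b hb => (π.typ_eq_zero_iff a).1 h0 b (π.rel.symm hb)
  exact h.ne' (hasFrequency_of_finite ((Set.finite_singleton a).subset hs)).freq_eq

/-! ### Ranking the blocks -/

open Classical in
/-- The frequency of the block of `m`, if `m` is the smallest element of its block. -/
def weight (π : TypedPartition k ℕ) (m : ℕ) : ℝ :=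
  if ∀ b < m, ¬ π.rel b m then freq (π.block m) else 0

/-- The smallest element of the block of `a`. -/
def minRep (π : TypedPartition k ℕ) (a : ℕ) : ℕ := sInf (π.block a)

theorem minRep_rel (π : TypedPartition k ℕ) (a : ℕ) : π.rel (π.minRep a) a :=
  Nat.sInf_mem ⟨a, π.self_mem_block a⟩

theorem minRep_eq_iff {π : TypedPartition k ℕ} {a b : ℕ} :
    π.minRep a = π.minRep b ↔ π.rel a b := by
  constructor
  · intro h
    exact π.rel.trans (π.rel.symm (π.minRep_rel a)) (h ▸ π.minRep_rel b)
  · intro h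
    rw [minRep, minRep, block_eq_iff.2 h]

theorem weight_minRep (π : TypedPartition k ℕ) (a : ℕ) :
    π.weight (π.minRep a) = freq (π.block a) := by
  rw [weight, if_pos, block_eq_iff.2 (π.minRep_rel a)]
  intro b hb h
  have hmem : b ∈ π.block a := π.rel.trans h (π.minRep_rel a)
  exact (Nat.sInf_le hmem).not_gt hb

theorem minRep_eq_self {π : TypedPartition k ℕ} {m : ℕ} (h : 0 < π.weight m) :
    π.minRep m = m := by
  rw [weight] at h
  split_ifs at h with h'
  · by_contra hne
    exact h' _ (lt_of_le_of_ne (Nat.sInf_le (π.self_mem_block m)) hne) (π.minRep_rel m)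
  · exact absurd h (lt_irrefl _)

theorem weight_of_pos {π : TypedPartition k ℕ} {m : ℕ} (h : 0 < π.weight m) :
    π.weight m = freq (π.block m) := by
  rw [weight] at *
  split_ifs at h with h'
  · rw [if_pos h']
  · exact absurd h (lt_irrefl _)

theorem HasFrequencies.weight_nonneg {π : TypedPartition k ℕ} (h : π.HasFrequencies) (m : ℕ) :
    0 ≤ π.weight m := by
  rw [weight]
  split_ifs
  · exact (h.hasFrequency m).nonneg
  · exact le_rfl

/-- Positive weights belong to distinct, hence disjoint, blocks. Frequency is finitely additive and
at most one. -/
theorem HasFrequencies.sum_weight_le {π : TypedPartition k ℕ} (h : π.HasFrequencies)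
    (s : Finset ℕ) : ∑ m ∈ s, π.weight m ≤ 1 := by
  classical
  have h1 : ∑ m ∈ s, π.weight m = ∑ m ∈ s with 0 < π.weight m, π.weight m := by
    rw [Finset.sum_filter]
    refine Finset.sum_congr rfl fun m _ => ?_
    split_ifs with hm
    · rfl
    · exact le_antisymm (not_lt.1 hm) (h.weight_nonneg m)
  rw [h1]
  refine HasFrequency.le_one (HasFrequency.biUnion (B := π.block) (fun m hm => ?_) ?_)
  · rw [weight_of_pos (Finset.mem_filter.1 hm).2]
    exact h.hasFrequency m
  · intro a ha b hb hab
    refine block_disjoint fun hr => hab ?_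
    simp only [Finset.coe_filter, Set.mem_ofPred_eq] at ha hb
    rw [← minRep_eq_self ha.2, ← minRep_eq_self hb.2, minRep_eq_iff.2 hr]

theorem HasFrequencies.summable_weight {π : TypedPartition k ℕ} (h : π.HasFrequencies) :
    Summable π.weight :=
  summable_of_sum_le h.weight_nonneg h.sum_weight_le

/-- The rank of the block of `a`. -/
def label (π : TypedPartition k ℕ) (a : ℕ) : ℕ :=
  MassPartition.rankIndex π.weight π.typ (π.minRep a)

theorem label_eq_of_rel {π : TypedPartition k ℕ} {a b : ℕ} (h : π.rel a b) :
    π.label a = π.label b := by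
  rw [label, label, minRep_eq_iff.2 h]

theorem HasFrequencies.label_eq_iff {π : TypedPartition k ℕ} (h : π.HasFrequencies) {a b : ℕ}
    (ha : 0 < freq (π.block a)) (hb : 0 < freq (π.block b)) :
    π.label a = π.label b ↔ π.rel a b := by
  refine ⟨fun e => minRep_eq_iff.1 ?_, label_eq_of_rel⟩
  refine MassPartition.rankIndex_injOn h.summable_weight ?_ ?_ e
  · rw [Set.mem_ofPred_eq, weight_minRep]; exact ha
  · rw [Set.mem_ofPred_eq, weight_minRep]; exact hb

theorem IsRanking.eq {π : TypedPartition k ℕ} {x y : MassPartition k} (hx : π.IsRanking x)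
    (hy : π.IsRanking y) : x = y :=
  MassPartition.ext_of_encard fun v hv j => (hx v hv j).trans (hy v hv j).symm

theorem IsRanking.rank_eq {π : TypedPartition k ℕ} {x : MassPartition k} (hx : π.IsRanking x)
    (h : π.HasFrequencies) : π.rank = x := by
  have h' : π.HasFrequencies ∧ ∃ x, π.IsRanking x := ⟨h, x, hx⟩
  rw [rank, dif_pos h']
  exact h'.2.choose_spec.eq hx

theorem HasFrequencies.exists_ranking {π : TypedPartition k ℕ} (h : π.HasFrequencies) :
    ∃ x : MassPartition k, π.IsRanking x ∧ (∀ a, 0 < freq (π.block a) →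
      x.mass (π.label a) = freq (π.block a) ∧ x.typ (π.label a) = π.typ a) ∧
      ∀ n, 0 < x.mass n → ∃ a, 0 < freq (π.block a) ∧ π.label a = n := by
  obtain ⟨x, hx1, hx2⟩ := MassPartition.exists_sort (t := π.typ) h.weight_nonneg h.summable_weight
    (h.summable_weight.tsum_le_of_sum_le h.sum_weight_le)
    fun m hm => typ_ne_zero_of_freq_pos (weight_of_pos hm ▸ hm)
  have H1 : ∀ a, 0 < freq (π.block a) →
      x.mass (π.label a) = freq (π.block a) ∧ x.typ (π.label a) = π.typ a := fun a ha => by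
    have := hx1 (π.minRep a) (by rwa [weight_minRep])
    rwa [weight_minRep, π.typ_congr _ _ (π.minRep_rel a)] at this
  have H2 : ∀ n, 0 < x.mass n → ∃ a, 0 < freq (π.block a) ∧ π.label a = n := fun n hn => by
    obtain ⟨m, hm, e⟩ := hx2 n hn
    exact ⟨m, weight_of_pos hm ▸ hm, by rw [label, minRep_eq_self hm, e]⟩
  refine ⟨x, fun y hy j => ?_, H1, H2⟩
  -- `R` collects the least elements of the blocks of frequency `y` and type `j`. Both sides of the
  -- count are injective images of `R`, by `label` and by `block`.
  set R := {m | π.weight m = y ∧ π.typ m = j} with hR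
  have hpos : ∀ m ∈ R, 0 < π.weight m := fun m hm => hm.1 ▸ hy
  have e1 : {n | x.mass n = y ∧ x.typ n = j} = π.label '' R := by
    ext n
    constructor
    · rintro ⟨hn1, hn2⟩
      obtain ⟨a, ha, rfl⟩ := H2 n (hn1 ▸ hy)
      obtain ⟨h1, h2⟩ := H1 a ha
      refine ⟨π.minRep a, ⟨?_, ?_⟩, label_eq_of_rel (π.minRep_rel a)⟩
      · rw [weight_minRep, ← h1, hn1]
      · rw [π.typ_congr _ _ (π.minRep_rel a), ← h2, hn2]
    · rintro ⟨m, hm, rfl⟩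
      have hm' := weight_of_pos (hpos m hm)
      obtain ⟨h1, h2⟩ := H1 m (hm' ▸ hpos m hm)
      exact ⟨by rw [h1, ← hm', hm.1], by rw [h2, hm.2]⟩
  have e2 : {B | B ∈ π.rel.classes ∧ HasFrequency B y ∧ ∀ a ∈ B, π.typ a = j} =
      π.block '' R := by
    ext B
    constructor
    · rintro ⟨⟨a, rfl⟩, h2, h3⟩
      have hb : π.block (π.minRep a) = π.block a := block_eq_iff.2 (π.minRep_rel a)
      refine ⟨π.minRep a, ⟨?_, ?_⟩, hb⟩
      · rw [weight_minRep]; exact HasFrequency.freq_eq h2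
      · exact h3 _ (π.minRep_rel a)
    · rintro ⟨m, hm, rfl⟩
      refine ⟨⟨m, rfl⟩, ?_, fun a ha => ?_⟩
      · rw [← hm.1, weight_of_pos (hpos m hm)]; exact h.hasFrequency m
      · rw [π.typ_congr _ _ ha, hm.2]
  have inj : ∀ m ∈ R, ∀ m' ∈ R, π.rel m m' → m = m' := fun m hm m' hm' hr => by
    rw [← minRep_eq_self (hpos m hm), ← minRep_eq_self (hpos m' hm'), minRep_eq_iff.2 hr]
  rw [e1, e2, Set.InjOn.encard_image, Set.InjOn.encard_image]
  · exact fun m hm m' hm' e => inj m hm m' hm' (block_eq_iff.1 e)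
  · refine fun m hm m' hm' e => inj m hm m' hm' ((h.label_eq_iff ?_ ?_).1 e)
    · rw [← weight_of_pos (hpos m hm)]; exact hpos m hm
    · rw [← weight_of_pos (hpos m' hm')]; exact hpos m' hm'

theorem HasFrequencies.isRanking_rank {π : TypedPartition k ℕ} (h : π.HasFrequencies) :
    π.IsRanking π.rank := by
  obtain ⟨x, hx, -⟩ := h.exists_ranking
  rwa [hx.rank_eq h]

theorem HasFrequencies.rank_label {π : TypedPartition k ℕ} (h : π.HasFrequencies) {a : ℕ}
    (ha : 0 < freq (π.block a)) :
    π.rank.mass (π.label a) = freq (π.block a) ∧ π.rank.typ (π.label a) = π.typ a := by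
  obtain ⟨x, hx, hx1, -⟩ := h.exists_ranking
  rw [hx.rank_eq h]
  exact hx1 a ha

theorem HasFrequencies.exists_label_eq {π : TypedPartition k ℕ} (h : π.HasFrequencies) {n : ℕ}
    (hn : 0 < π.rank.mass n) : ∃ a, 0 < freq (π.block a) ∧ π.label a = n := by
  obtain ⟨x, hx, -, hx2⟩ := h.exists_ranking
  rw [hx.rank_eq h] at hn
  exact hx2 n hn

theorem rank_of_not_hasFrequencies {π : TypedPartition k ℕ} (h : ¬ π.HasFrequencies) :
    π.rank = MassPartition.pureDust k := by
  rw [rank, dif_neg fun h' => h h'.1]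

theorem isRanking_permute {π : TypedPartition k ℕ} {x : MassPartition k} (h : π.IsRanking x)
    {σ : Equiv.Perm ℕ} (hσ : {n | σ n ≠ n}.Finite) : (π.permute σ).IsRanking x := by
  intro y hy j
  rw [h y hy j]
  have hσ' : {n | σ.symm n ≠ n}.Finite := by
    refine hσ.subset fun n hn hn' => hn ?_
    rw [Equiv.symm_apply_eq, hn']
  have : {B | B ∈ (π.permute σ).rel.classes ∧ HasFrequency B y ∧
      ∀ a ∈ B, (π.permute σ).typ a = j} = (fun B => σ ⁻¹' B) ''
      {B | B ∈ π.rel.classes ∧ HasFrequency B y ∧ ∀ a ∈ B, π.typ a = j} := by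
    ext B
    constructor
    · rintro ⟨⟨a, rfl⟩, h2, h3⟩
      refine ⟨π.block (σ a), ⟨⟨_, rfl⟩, ?_, fun b hb => ?_⟩, rfl⟩
      · have : HasFrequency (σ.symm ⁻¹' (σ ⁻¹' π.block (σ a))) y := HasFrequency.preimage h2 hσ'
        rwa [← Set.preimage_comp, Equiv.self_comp_symm, Set.preimage_id] at this
      · have := h3 (σ.symm b) (by
          change (π.permute σ).rel _ _
          rw [permute_rel, Equiv.apply_symm_apply]; exact hb)
        rwa [permute_typ, Equiv.apply_symm_apply] at this
    · rintro ⟨_, ⟨⟨a, rfl⟩, h2, h3⟩, rfl⟩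
      refine ⟨⟨σ.symm a, ?_⟩, h2.preimage hσ, fun b hb => ?_⟩
      · ext b
        change π.rel (σ b) a ↔ π.rel (σ b) (σ (σ.symm a))
        rw [Equiv.apply_symm_apply]
      · rw [permute_typ]
        exact h3 _ hb
  rw [this, Set.InjOn.encard_image]
  exact (Set.preimage_injective.2 σ.surjective).injOn

/-- This is invariance everywhere, not only almost everywhere: having frequencies is itself
invariant, as the inverse permutation shows, and the default value is constant. -/
theorem rank_permute (π : TypedPartition k ℕ) {σ : Equiv.Perm ℕ}
    (hσ : {n | σ n ≠ n}.Finite) : (π.permute σ).rank = π.rank := by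
  by_cases h : π.HasFrequencies
  · exact (isRanking_permute h.isRanking_rank hσ).rank_eq (hasFrequencies_permute h hσ)
  · rw [rank_of_not_hasFrequencies h, rank_of_not_hasFrequencies]
    intro h'
    have hσ' : {n | σ⁻¹ n ≠ n}.Finite := by
      refine hσ.subset fun n hn hn' => hn ?_
      rw [Equiv.Perm.inv_eq_iff_eq, hn']
    have := hasFrequencies_permute h' hσ'
    rw [permute_permute, mul_inv_cancel, permute_one] at this
    exact h this

/-! ### Measurability of the ranking -/

theorem measurable_weight (m : ℕ) : Measurable fun π : TypedPartition k ℕ => π.weight m := by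
  refine Measurable.ite ?_ (measurable_freq_block m) measurable_const
  simp only [Set.ofPred_forall]
  exact MeasurableSet.iInter fun b => MeasurableSet.iInter fun _ => (measurableSet_rel b m).compl

theorem measurableSet_rankIndex_eq (m n : ℕ) : MeasurableSet
    {π : TypedPartition k ℕ | MassPartition.rankIndex π.weight π.typ m = n} := by
  classical
  have hset : ∀ m', MeasurableSet
      {π : TypedPartition k ℕ | MassPartition.Precedes π.weight π.typ m' m} := fun m' => by
    have hw := measurable_weight (k := k)
    have ht := measurable_typ (k := k)
    exact (measurableSet_lt (hw m) (hw m')).union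
      ((measurableSet_eq_fun (hw m) (hw m')).inter ((measurableSet_lt (ht m) (ht m')).union
        ((measurableSet_eq_fun (ht m) (ht m')).inter (.const _))))
  have hm : Measurable fun π : TypedPartition k ℕ =>
      ∑' m', if MassPartition.Precedes π.weight π.typ m' m then (1 : ℝ≥0∞) else 0 :=
    Measurable.tsum fun m' => Measurable.ite (hset m') measurable_const measurable_const
  have e : ∀ π : TypedPartition k ℕ, (MassPartition.rankIndex π.weight π.typ m : ℝ) =
      (∑' m', if MassPartition.Precedes π.weight π.typ m' m then (1 : ℝ≥0∞) else 0).toReal := by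
    intro π
    have : (∑' m', if MassPartition.Precedes π.weight π.typ m' m then (1 : ℝ≥0∞) else 0) =
        ({m' | MassPartition.Precedes π.weight π.typ m' m}.encard : ℝ≥0∞) := by
      rw [← Measure.count_apply .of_discrete, ← lintegral_indicator_one .of_discrete,
        lintegral_count]
      rfl
    -- An infinite set has `ncard` zero and `⊤.toReal` is zero, so the identity needs no finiteness.
    rw [this, MassPartition.rankIndex, Set.ncard]
    cases {m' | MassPartition.Precedes π.weight π.typ m' m}.encard <;> simp
  have : {π : TypedPartition k ℕ | MassPartition.rankIndex π.weight π.typ m = n} =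
      {π | (∑' m', if MassPartition.Precedes π.weight π.typ m' m
        then (1 : ℝ≥0∞) else 0).toReal = n} := by
    ext π
    rw [Set.mem_ofPred_eq, Set.mem_ofPred_eq, ← e]
    exact Nat.cast_inj.symm
  rw [this]
  exact measurableSet_eq_fun hm.ennreal_toReal measurable_const

theorem HasFrequencies.exists_rankIndex_eq {π : TypedPartition k ℕ} (h : π.HasFrequencies) {n : ℕ}
    (hn : 0 < π.rank.mass n) :
    ∃ m, 0 < π.weight m ∧ MassPartition.rankIndex π.weight π.typ m = n := by
  obtain ⟨a, ha, e⟩ := h.exists_label_eq hn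
  exact ⟨π.minRep a, by rwa [weight_minRep], e⟩

theorem HasFrequencies.rank_rankIndex {π : TypedPartition k ℕ} (h : π.HasFrequencies) {m : ℕ}
    (hm : 0 < π.weight m) :
    π.rank.mass (MassPartition.rankIndex π.weight π.typ m) = π.weight m ∧
      π.rank.typ (MassPartition.rankIndex π.weight π.typ m) = π.typ m := by
  have := h.rank_label (weight_of_pos hm ▸ hm)
  rwa [label, minRep_eq_self hm, ← weight_of_pos hm] at this

theorem measurable_rank : Measurable (rank (k := k)) := by
  classical
  -- `G n m` says that `m` is the least element of the block of rank `n`. For given `n` at most one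
  -- `m` qualifies, so the mass of rank `n` is a sum with at most one nonzero term.
  let G : ℕ → ℕ → Set (TypedPartition k ℕ) := fun n m =>
    {π | π.HasFrequencies} ∩ ({π | 0 < π.weight m} ∩
      {π | MassPartition.rankIndex π.weight π.typ m = n})
  have hG : ∀ n m, MeasurableSet (G n m) := fun n m =>
    measurableSet_hasFrequencies.inter ((measurableSet_lt measurable_const
      (measurable_weight m)).inter (measurableSet_rankIndex_eq m n))
  have hmass : ∀ n, Measurable fun π : TypedPartition k ℕ => π.rank.mass n := fun n => by
    have : (fun π : TypedPartition k ℕ => π.rank.mass n) =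
        fun π => ∑' m, (G n m).indicator (fun π => π.weight m) π := by
      ext π
      by_cases hex : ∃ m, π ∈ G n m
      · obtain ⟨m, hm⟩ := hex
        rw [tsum_eq_single m, Set.indicator_of_mem hm, ← (hm.1.rank_rankIndex hm.2.1).1, hm.2.2]
        intro m' hm'
        rw [Set.indicator_of_notMem]
        intro h'
        exact hm' (MassPartition.rankIndex_injOn hm.1.summable_weight h'.2.1 hm.2.1
          (h'.2.2.trans hm.2.2.symm))
      · push Not at hex
        have h0 : ∀ m, (G n m).indicator (fun π : TypedPartition k ℕ => π.weight m) π = 0 :=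
          fun m => Set.indicator_of_notMem (hex m) _
        simp only [h0, tsum_zero]
        by_cases h : π.HasFrequencies
        · by_contra hne
          obtain ⟨m, hm, e⟩ := h.exists_rankIndex_eq
            (lt_of_le_of_ne (π.rank.nonneg n) (Ne.symm hne))
          exact hex m ⟨h, hm, e⟩
        · rw [rank_of_not_hasFrequencies h]; rfl
    rw [this]
    exact Measurable.tsum fun m => (measurable_weight m).indicator (hG n m)
  refine MassPartition.measurable_of_coord hmass fun n => measurable_to_countable' fun j => ?_
  by_cases hj : j = 0
  · have : (fun π : TypedPartition k ℕ => π.rank.typ n) ⁻¹' {j} = {π | π.rank.mass n = 0} := by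
      ext π
      rw [Set.mem_preimage, Set.mem_singleton_iff, hj, ← π.rank.mass_eq_zero_iff]; rfl
    rw [this]
    exact measurableSet_eq_fun (hmass n) measurable_const
  · have : (fun π : TypedPartition k ℕ => π.rank.typ n) ⁻¹' {j} =
        ⋃ m, G n m ∩ {π | π.typ m = j} := by
      ext π
      simp only [Set.mem_preimage, Set.mem_singleton_iff, Set.mem_iUnion]
      constructor
      · intro hπ
        have hpos : 0 < π.rank.mass n := lt_of_le_of_ne (π.rank.nonneg n) fun e =>
          hj (hπ ▸ (π.rank.mass_eq_zero_iff n).1 e.symm)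
        have h : π.HasFrequencies := by
          by_contra h
          rw [rank_of_not_hasFrequencies h] at hpos
          exact lt_irrefl _ hpos
        obtain ⟨m, hm, rfl⟩ := h.exists_rankIndex_eq hpos
        exact ⟨m, ⟨h, hm, rfl⟩, (h.rank_rankIndex hm).2.symm.trans hπ⟩
      · rintro ⟨m, ⟨h, hm, rfl⟩, ht⟩
        rw [(h.rank_rankIndex hm).2]; exact ht
    rw [this]
    exact MeasurableSet.iUnion fun m => (hG n m).inter (measurable_typ m (measurableSet_singleton j))

end TypedPartition

end

/-! ### Paintboxes -/

noncomputable section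

variable {k : ℕ}

/-! ### Laws of colours -/

theorem colourLaw_apply (x : MassPartition k) (s : Set (ℕ × Fin (k + 1))) :
    colourLaw x s = ENNReal.ofReal x.dust * s.indicator 1 (0, 0) +
      ∑' n, ENNReal.ofReal (x.mass n) * s.indicator 1 (n + 1, x.typ n) :=
  x.scatter_apply _ _ .of_discrete

theorem colourLaw_dust (x : MassPartition k) :
    colourLaw x {(0, 0)} = ENNReal.ofReal x.dust := by
  rw [colourLaw_apply]
  simp

theorem colourLaw_succ (x : MassPartition k) (n : ℕ) (j : Fin (k + 1)) :
    colourLaw x {(n + 1, j)} = if x.typ n = j then ENNReal.ofReal (x.mass n) else 0 := by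
  rw [colourLaw_apply, tsum_eq_single n]
  · simp only [Set.indicator_apply, Set.mem_singleton_iff, Prod.mk.injEq, Pi.one_apply]
    split_ifs <;> simp_all
  · intro m hm
    rw [Set.indicator_of_notMem, mul_zero]
    simpa using fun h => absurd h hm

theorem colourLaw_zero (x : MassPartition k) {j : Fin (k + 1)} (hj : j ≠ 0) :
    colourLaw x {(0, j)} = 0 := by
  rw [colourLaw_apply]
  simp [hj.symm]

theorem colourLaw_ne_zero {x : MassPartition k} {c : ℕ × Fin (k + 1)}
    (h : colourLaw x {c} ≠ 0) :
    c = (0, 0) ∨ ∃ n, 0 < x.mass n ∧ c = (n + 1, x.typ n) := by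
  obtain ⟨_ | n, j⟩ := c
  · left
    by_contra hne
    exact h (colourLaw_zero x fun e => hne (by rw [e]))
  · right
    rw [colourLaw_succ] at h
    split_ifs at h with e
    · exact ⟨n, by simpa using h, by rw [e]⟩
    · exact absurd rfl h

theorem measurable_colourLaw (s : Set (ℕ × Fin (k + 1))) :
    Measurable fun x : MassPartition k => colourLaw x s := by
  simp only [colourLaw_apply]
  refine (MassPartition.measurable_dust.ennreal_ofReal.mul_const _).add
    (Measurable.tsum fun n => (MassPartition.measurable_mass n).ennreal_ofReal.mul ?_)
  exact (measurable_of_countable fun j : Fin (k + 1) =>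
    s.indicator (1 : ℕ × Fin (k + 1) → ℝ≥0∞) (n + 1, j)).comp (MassPartition.measurable_typ n)

namespace TypedPartition

/-! ### Painting -/

theorem paint_rel (p : ℕ → ℕ × Fin (k + 1)) (a b : ℕ) :
    (paint p).rel a b ↔ a = b ∨ (p a = p b ∧ (p a).2 ≠ 0) := Iff.rfl

open Classical in
theorem paint_typ (p : ℕ → ℕ × Fin (k + 1)) (a : ℕ) :
    (paint p).typ a = if ∃ b, b ≠ a ∧ p b = p a then (p a).2 else 0 := by
  simp only [paint]

theorem measurable_paint : Measurable (paint (k := k)) := by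
  classical
  have he : ∀ a, Measurable fun p : ℕ → ℕ × Fin (k + 1) => p a := fun a => measurable_pi_apply a
  refine measurable_of_rel_typ (fun a b => ?_) fun a j => ?_
  · simp only [paint_rel]
    exact (MeasurableSet.const _).union ((measurableSet_eq_fun (he a) (he b)).inter
      (measurableSet_eq_fun (he a).snd measurable_const).compl)
  · simp only [paint_typ]
    refine Measurable.ite ?_ (he a).snd measurable_const (measurableSet_singleton j)
    simp only [Set.ofPred_exists, Set.ofPred_and]
    exact MeasurableSet.iUnion fun b => (MeasurableSet.const _).inter
      (measurableSet_eq_fun (he b) (he a))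

/-- The type given by `paint` looks at all integers, but a restriction only retains the type of an
element that has a partner below `n`, and such a partner shares its colour under both `p` and `q`.
-/
theorem restrict_paint_congr {n : ℕ} {p q : ℕ → ℕ × Fin (k + 1)} (h : ∀ l < n, p l = q l) :
    (paint p).restrict n = (paint q).restrict n := by
  refine restrict_eq_of (fun a b ha hb => ?_) fun a b ha hb hab hr => ?_
  · rw [paint_rel, paint_rel, h a ha, h b hb]
  · rcases hr with rfl | ⟨hr, -⟩
    · exact absurd rfl hab
    · rw [paint_typ, paint_typ, if_pos ⟨b, hab, hr.symm⟩,
        if_pos ⟨b, hab, by rw [← h a ha, ← h b hb, hr]⟩, h a ha]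

theorem permute_paint (σ : Equiv.Perm ℕ) (p : ℕ → ℕ × Fin (k + 1)) :
    (paint p).permute σ = paint fun n => p (σ n) := by
  ext a b
  · rw [permute_rel, paint_rel, paint_rel, σ.injective.eq_iff]
  · rw [permute_typ, paint_typ, paint_typ]
    have : (∃ b, b ≠ σ a ∧ p b = p (σ a)) ↔ ∃ b, b ≠ a ∧ p (σ b) = p (σ a) := by
      constructor
      · rintro ⟨b, h1, h2⟩
        exact ⟨σ.symm b, fun e => h1 (by rw [← e, σ.apply_symm_apply]), by
          rwa [σ.apply_symm_apply]⟩
      · rintro ⟨b, h1, h2⟩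
        exact ⟨σ b, σ.injective.ne h1, h2⟩
    by_cases h : ∃ b, b ≠ σ a ∧ p b = p (σ a)
    · rw [if_pos h, if_pos (this.1 h)]
    · rw [if_neg h, if_neg (mt this.2 h)]

/-- Extend finitely many colours to a sequence of colours. -/
def extendColours {n : ℕ} (c : Fin n → ℕ × Fin (k + 1)) (l : ℕ) : ℕ × Fin (k + 1) :=
  if h : l < n then c ⟨l, h⟩ else (0, 0)

theorem extendColours_of_lt {n : ℕ} (c : Fin n → ℕ × Fin (k + 1)) {l : ℕ} (h : l < n) :
    extendColours c l = c ⟨l, h⟩ := dif_pos h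

end TypedPartition

open TypedPartition

theorem map_eval_fin (x : MassPartition k) (n : ℕ) (c : Fin n → ℕ × Fin (k + 1)) :
    (Measure.infinitePi fun _ : ℕ => colourLaw x).map (fun p (l : Fin n) => p l) {c} =
      ∏ l, colourLaw x {c l} := by
  rw [Measure.map_infinitePi_infinitePi_of_inj (P := fun _ : ℕ => colourLaw x)
    (f := fun l : Fin n => (l : ℕ)) Fin.val_injective,
    Measure.infinitePi_singleton_of_fintype (fun _ : Fin n => colourLaw x)]

instance (x : MassPartition k) : IsProbabilityMeasure (paintbox x) :=
  Measure.isProbabilityMeasure_map measurable_paint.aemeasurable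

/-- Only the first `n` colours matter, and they range over a countable set. The formula exhibits the
probability as a countable sum of products of colour masses, which makes its dependence on `x`
measurable. -/
theorem paintbox_apply_of_determined (x : MassPartition k) {n : ℕ} {A : Set (TypedPartition k ℕ)}
    (hA : Determined n A) :
    paintbox x A = ∑' c : Fin n → ℕ × Fin (k + 1),
      {c | paint (extendColours c) ∈ A}.indicator (fun c => ∏ l, colourLaw x {c l}) c := by
  set G : Set (Fin n → ℕ × Fin (k + 1)) := {c | paint (extendColours c) ∈ A}
  have hρ : Measurable fun (p : ℕ → ℕ × Fin (k + 1)) (l : Fin n) => p l := by fun_prop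
  have hG : paint ⁻¹' A = (fun (p : ℕ → ℕ × Fin (k + 1)) (l : Fin n) => p l) ⁻¹' G := by
    ext p
    have e : (paint p).restrict n = (paint (extendColours fun l : Fin n => p l)).restrict n :=
      restrict_paint_congr fun l hl => (extendColours_of_lt (fun l : Fin n => p l) hl).symm
    exact ⟨hA _ _ e, hA _ _ e.symm⟩
  rw [paintbox, Measure.map_apply measurable_paint hA.measurableSet, hG,
    ← Measure.map_apply hρ (Set.to_countable G).measurableSet,
    ← Measure.tsum_indicator_apply_singleton _ G (Set.to_countable G).measurableSet]
  refine tsum_congr fun c => ?_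
  simp only [map_eval_fin]

theorem measurable_paintbox : Measurable (paintbox (k := k)) := by
  refine Measurable.measure_of_isPiSystem_of_isProbabilityMeasure generateFrom_determined
    isPiSystem_determined ?_
  rintro A ⟨n, hA⟩
  simp only [paintbox_apply_of_determined _ hA]
  refine Measurable.tsum fun c => ?_
  by_cases hc : c ∈ {c : Fin n → ℕ × Fin (k + 1) | paint (extendColours c) ∈ A}
  · simp only [Set.indicator_of_mem hc]
    exact Finset.measurable_prod _ fun l _ => measurable_colourLaw _
  · simp only [Set.indicator_of_notMem hc]
    exact measurable_const

theorem paintbox_map_permute (x : MassPartition k) (σ : Equiv.Perm ℕ) :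
    (paintbox x).map (permute σ) = paintbox x := by
  have h1 : Measurable fun (p : ℕ → ℕ × Fin (k + 1)) (n : ℕ) => p (σ n) := by fun_prop
  rw [paintbox, Measure.map_map (measurable_permute σ) measurable_paint]
  have : permute σ ∘ paint = paint ∘ fun (p : ℕ → ℕ × Fin (k + 1)) (n : ℕ) => p (σ n) :=
    funext fun p => permute_paint σ p
  rw [this, ← Measure.map_map measurable_paint h1,
    Measure.map_infinitePi_infinitePi_of_inj (P := fun _ : ℕ => colourLaw x) σ.injective]

/-! ### Almost sure properties of the paintbox -/

/-- The strong law of large numbers applied to the indicator of each of the countably many colours.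
-/
theorem ae_hasFrequency_colour (x : MassPartition k) :
    ∀ᵐ p ∂(Measure.infinitePi fun _ : ℕ => colourLaw x), ∀ c,
      HasFrequency {m | p m = c} (colourLaw x {c}).toReal := by
  classical
  rw [ae_all_iff]
  intro c
  set P := Measure.infinitePi fun _ : ℕ => colourLaw x
  let g : ℕ × Fin (k + 1) → ℝ := ({c} : Set (ℕ × Fin (k + 1))).indicator 1
  have hg : Measurable g := measurable_of_countable _
  have hgb : ∀ u, ‖g u‖ ≤ 1 := fun u => by
    simp only [g, Set.indicator_apply]
    split_ifs <;> simp
  have hX : ∀ m : ℕ, Measurable fun p : ℕ → ℕ × Fin (k + 1) => g (p m) := fun m =>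
    hg.comp (measurable_pi_apply m)
  have hmap : ∀ m : ℕ, P.map (fun p : ℕ → ℕ × Fin (k + 1) => p m) = colourLaw x := fun m =>
    Measure.infinitePi_map_eval _ m
  have hslln := ProbabilityTheory.strong_law_ae_real (μ := P)
    (fun (m : ℕ) (p : ℕ → ℕ × Fin (k + 1)) => g (p m))
    (Integrable.of_bound (hX 0).aestronglyMeasurable 1 (ae_of_all _ fun p => hgb _))
    (fun i j hij => (ProbabilityTheory.iIndepFun_infinitePi
      (P := fun _ : ℕ => colourLaw x) (X := fun _ => g) fun _ => hg).indepFun hij)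
    (fun i => by
      refine ⟨(hX i).aemeasurable, (hX 0).aemeasurable, ?_⟩
      change P.map (g ∘ fun p => p i) = P.map (g ∘ fun p => p 0)
      rw [← Measure.map_map hg (measurable_pi_apply i), ← Measure.map_map hg (measurable_pi_apply 0),
        hmap, hmap])
  have hint : ∫ p, g (p 0) ∂P = (colourLaw x {c}).toReal := by
    rw [← integral_map (φ := fun p : ℕ → ℕ × Fin (k + 1) => p 0) (f := g)
      (measurable_pi_apply 0).aemeasurable hg.aestronglyMeasurable, hmap]
    rw [integral_indicator_one (measurableSet_singleton c)]
    rfl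
  filter_upwards [hslln] with p hp
  rw [hint] at hp
  refine hp.congr fun n => ?_
  congr 1
  change _ = (cnt {m | p m = c} n : ℝ)
  rw [cnt_eq_sum]
  push_cast
  refine Finset.sum_congr rfl fun m _ => ?_
  simp only [g, Set.indicator_apply, Set.mem_singleton_iff, Set.mem_ofPred_eq, Pi.one_apply]

theorem ae_colourLaw_ne_zero (x : MassPartition k) :
    ∀ᵐ p ∂(Measure.infinitePi fun _ : ℕ => colourLaw x), ∀ m, colourLaw x {p m} ≠ 0 := by
  rw [ae_all_iff]
  intro m
  have hs : MeasurableSet {c : ℕ × Fin (k + 1) | colourLaw x {c} ≠ 0} := .of_discrete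
  have he : Measurable fun p : ℕ → ℕ × Fin (k + 1) => p m := measurable_pi_apply m
  refine (ae_map_iff he.aemeasurable hs).1 ?_
  rw [Measure.infinitePi_map_eval (fun _ : ℕ => colourLaw x) m, ae_iff, ← Measure.tsum_indicator_apply_singleton _ _ .of_discrete]
  refine ENNReal.tsum_eq_zero.2 fun c => ?_
  rw [Set.indicator_apply]
  split_ifs with h
  · simpa using h
  · rfl

namespace TypedPartition

theorem block_paint_of_ne {p : ℕ → ℕ × Fin (k + 1)} {a : ℕ} (h : (p a).2 ≠ 0) :
    (paint p).block a = {m | p m = p a} := by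
  ext b
  rw [mem_block, paint_rel]
  constructor
  · rintro (rfl | h')
    · rfl
    · exact h'.1
  · exact fun h' => Or.inr ⟨h', by rw [show p b = p a from h']; exact h⟩

theorem block_paint_of_eq {p : ℕ → ℕ × Fin (k + 1)} {a : ℕ} (h : (p a).2 = 0) :
    (paint p).block a = {a} := by
  ext b
  rw [mem_block, paint_rel]
  constructor
  · rintro (rfl | h')
    · rfl
    · exact absurd (h'.1 ▸ h) h'.2
  · exact fun h' => Or.inl h'

theorem paint_typ_of_freq_pos {p : ℕ → ℕ × Fin (k + 1)} {a : ℕ} {y : ℝ}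
    (h : HasFrequency {m | p m = p a} y) (hy : 0 < y) : (paint p).typ a = (p a).2 := by
  rw [paint_typ, if_pos]
  by_contra hne
  push Not at hne
  have : {m | p m = p a} ⊆ {a} := fun m hm => by
    by_contra hma
    exact hne m hma hm
  exact hy.ne' (h.unique (hasFrequency_of_finite ((Set.finite_singleton a).subset this)))

/-- The deterministic part of the law of large numbers: once the colours have the right frequencies
and only charged colours occur, the blocks of positive frequency are exactly the colour classes of
the terms of positive mass. -/
theorem paint_ranking {x : MassPartition k} {p : ℕ → ℕ × Fin (k + 1)}
    (h1 : ∀ c, HasFrequency {m | p m = c} (colourLaw x {c}).toReal)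
    (h2 : ∀ m, colourLaw x {p m} ≠ 0) :
    (paint p).HasFrequencies ∧ (paint p).rank = x := by
  have hF : (paint p).HasFrequencies := by
    rw [hasFrequencies_iff]
    intro a
    by_cases ha : (p a).2 = 0
    · rw [block_paint_of_eq ha]
      exact ⟨0, hasFrequency_of_finite (Set.finite_singleton a)⟩
    · rw [block_paint_of_ne ha]
      exact ⟨_, h1 _⟩
  have hfreq : ∀ n, HasFrequency {m | p m = (n + 1, x.typ n)} (x.mass n) := fun n => by
    have := h1 (n + 1, x.typ n)
    rwa [colourLaw_succ, if_pos rfl, ENNReal.toReal_ofReal (x.nonneg n)] at this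
  have hne : ∀ n, 0 < x.mass n → ∃ a, p a = (n + 1, x.typ n) := fun n hn => by
    by_contra h
    push Not at h
    have : {m | p m = (n + 1, x.typ n)} = ∅ := Set.eq_empty_iff_forall_notMem.2 h
    have h' := hfreq n
    rw [this] at h'
    exact hn.ne' (h'.unique (hasFrequency_of_finite Set.finite_empty))
  refine ⟨hF, IsRanking.rank_eq (fun y hy j => ?_) hF⟩
  have himg : {B | B ∈ (paint p).rel.classes ∧ HasFrequency B y ∧ ∀ a ∈ B, (paint p).typ a = j} =
      (fun n => {m | p m = (n + 1, x.typ n)}) '' {n | x.mass n = y ∧ x.typ n = j} := by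
    ext B
    constructor
    · rintro ⟨⟨a, rfl⟩, hB, hj⟩
      change HasFrequency ((paint p).block a) y at hB
      have ha : (p a).2 ≠ 0 := fun h0 => by
        rw [block_paint_of_eq h0] at hB
        exact hy.ne' (hB.unique (hasFrequency_of_finite (Set.finite_singleton a)))
      rw [block_paint_of_ne ha] at hB
      rcases colourLaw_ne_zero (h2 a) with e | ⟨n, hn, e⟩
      · exact absurd (by rw [e]) ha
      · refine ⟨n, ⟨?_, ?_⟩, ?_⟩
        · exact (hfreq n).unique (e ▸ hB)
        · rw [← hj a (self_mem_block _ a), paint_typ_of_freq_pos hB hy, e]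
        · change _ = (paint p).block a
          rw [block_paint_of_ne ha, e]
    · rintro ⟨n, ⟨rfl, rfl⟩, rfl⟩
      obtain ⟨a, ha⟩ := hne n hy
      have ha2 : (p a).2 ≠ 0 := by rw [ha]; exact x.typ_ne_zero hy
      refine ⟨⟨a, ?_⟩, hfreq n, fun b hb => ?_⟩
      · change _ = (paint p).block a
        rw [block_paint_of_ne ha2, ha]
      · have hb' : p b = (n + 1, x.typ n) := hb
        rw [paint_typ_of_freq_pos (y := x.mass n) (by rw [hb']; exact hfreq n) hy, hb']
  rw [himg, Set.InjOn.encard_image]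
  rintro n ⟨rfl, -⟩ m - e
  obtain ⟨a, ha⟩ := hne n hy
  have : a ∈ {l | p l = (m + 1, x.typ m)} := by
    rw [← show {l | p l = (n + 1, x.typ n)} = {l | p l = (m + 1, x.typ m)} from e]
    exact ha
  have ha' : p a = (m + 1, x.typ m) := this
  rw [ha, Prod.mk.injEq] at ha'
  exact Nat.succ_injective ha'.1

end TypedPartition

theorem paintbox_ae_rank (x : MassPartition k) :
    ∀ᵐ π ∂(paintbox x), π.HasFrequencies ∧ π.rank = x := by
  refine (ae_map_iff measurable_paint.aemeasurable (measurableSet_hasFrequencies.inter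
    (measurable_rank (measurableSet_singleton x)))).2 ?_
  filter_upwards [ae_hasFrequency_colour x, ae_colourLaw_ne_zero x] with p h1 h2
  exact paint_ranking h1 h2

theorem paintbox_map_rank (x : MassPartition k) :
    (paintbox x).map rank = Measure.dirac x := by
  rw [Measure.map_congr (g := fun _ => x) ((paintbox_ae_rank x).mono fun π h => h.2)]
  simp

/-! ### Partitions with a cofinite block -/

namespace TypedPartition

variable {i : Fin (k + 1)}

theorem rank_of_cofinite (hi : i ≠ 0) {π : TypedPartition k ℕ} {a : ℕ} (h : (π.block a)ᶜ.Finite)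
    (ht : π.typ a = i) : π.HasFrequencies ∧ π.rank = MassPartition.one i hi := by
  have h1 : HasFrequency (π.block a) 1 := by
    simpa using (hasFrequency_of_finite h).compl
  have hF : π.HasFrequencies := by
    rw [hasFrequencies_iff]
    intro b
    by_cases hb : π.rel b a
    · rw [block_eq_iff.2 hb]; exact ⟨1, h1⟩
    · exact ⟨0, hasFrequency_of_finite (h.subset (block_disjoint hb).subset_compl_right)⟩
  refine ⟨hF, ?_⟩
  have hpos : 0 < freq (π.block a) := by rw [h1.freq_eq]; exact one_pos
  obtain ⟨e1, e2⟩ := hF.rank_label hpos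
  rw [h1.freq_eq] at e1
  -- Otherwise the term of rank `0` would also have mass at least one, and the total mass would be
  -- at least two.
  have hl : π.label a = 0 := by
    by_contra hne
    have h2 := π.rank.sum_le_one {0, π.label a}
    rw [Finset.sum_pair (Ne.symm hne), e1] at h2
    have h3 := π.rank.antitone (Nat.zero_le (π.label a))
    rw [e1] at h3
    linarith
  rw [hl] at e1 e2
  exact MassPartition.eq_one_of_mass_eq_one hi e1 (e2.trans ht)

theorem rank_single (hi : i ≠ 0) : (single ℕ i hi).rank = MassPartition.one i hi := by
  refine (rank_of_cofinite (a := 0) hi ?_ rfl).2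
  have : (single ℕ i hi).block 0 = Set.univ := Set.eq_univ_of_forall fun _ => trivial
  rw [this, Set.compl_univ]
  exact Set.finite_empty

theorem rank_erode (hi : i ≠ 0) (n : ℕ) :
    (erode n i hi).HasFrequencies ∧ (erode n i hi).rank = MassPartition.one i hi := by
  refine rank_of_cofinite (a := n + 1) hi ?_ ?_
  · refine (Set.finite_singleton n).subset fun b hb => ?_
    by_contra hbn
    exact hb (show (b = n ↔ n + 1 = n) from iff_of_false hbn (by omega))
  · simp [erode]

/-- The partitions such that `a` and `b` are not in a common block of type `i`. -/
def splitSet (i : Fin (k + 1)) (a b : ℕ) : Set (TypedPartition k ℕ) :=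
  {π | ¬ (π.rel a b ∧ π.typ a = i)}

theorem mem_splitSet {a b : ℕ} {π : TypedPartition k ℕ} :
    π ∈ splitSet i a b ↔ ¬ (π.rel a b ∧ π.typ a = i) := Iff.rfl

theorem measurableSet_splitSet (i : Fin (k + 1)) (a b : ℕ) :
    MeasurableSet (splitSet i a b) :=
  ((measurableSet_rel a b).inter (measurable_typ a (measurableSet_singleton i))).compl

/-- This rewrites the finiteness hypothesis in a form that permutations carry from the pair `0, 1`
to any other pair. -/
theorem splitSet_eq (hi : i ≠ 0) :
    {π : TypedPartition k ℕ | π.restrict 2 ≠ single (Fin 2) i hi} = splitSet i 0 1 := by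
  ext π
  rw [mem_splitSet, Set.mem_ofPred_eq, not_iff_not]
  have e : single (Fin 2) i hi = (single ℕ i hi).restrict 2 := by
    ext a b
    · exact Iff.rfl
    · rw [restrict_typ_of_not_forall]
      · rfl
      · intro H
        have h0 := H 0 trivial
        have h1 := H 1 trivial
        exact absurd (h0.trans h1.symm) (by decide)
  rw [e]
  constructor
  · intro h
    refine ⟨(rel_iff_of_restrict_eq h (by norm_num) (by norm_num)).2 trivial, ?_⟩
    exact typ_eq_of_restrict_eq h (a := 0) (b := 1) (by norm_num) (by norm_num) (by norm_num)
      ((rel_iff_of_restrict_eq h (by norm_num) (by norm_num)).2 trivial)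
  · rintro ⟨hr, ht⟩
    have hall : ∀ a b, a < 2 → b < 2 → π.rel a b := fun a b ha hb => by
      interval_cases a <;> interval_cases b
      · exact π.rel.refl _
      · exact hr
      · exact π.rel.symm hr
      · exact π.rel.refl _
    refine restrict_eq_of (fun a b ha hb => iff_of_true (hall a b ha hb) trivial)
      fun a b ha hb _ _ => ?_
    rw [π.typ_congr a 0 (hall a 0 ha (by norm_num)), ht]
    rfl

theorem permute_mem_splitSet {σ : Equiv.Perm ℕ} {a b : ℕ} {π : TypedPartition k ℕ} :
    π.permute σ ∈ splitSet i a b ↔ π ∈ splitSet i (σ a) (σ b) := by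
  rw [mem_splitSet, mem_splitSet, permute_rel, permute_typ]

end TypedPartition

theorem paintbox_single {i : Fin (k + 1)} (hi : i ≠ 0) {x : MassPartition k}
    (hx : x ≠ MassPartition.one i hi) : paintbox x {single ℕ i hi} = 0 := by
  refine measure_mono_null ?_ (paintbox_ae_rank x)
  intro π hπ h
  rw [Set.mem_singleton_iff] at hπ
  subst hπ
  exact hx (h.2.symm.trans (rank_single hi))

/-- The integrand `1 - x_1 1_{i_1 = i}`. -/
def defect (i : Fin (k + 1)) (x : MassPartition k) : ℝ≥0∞ :=
  ENNReal.ofReal (1 - x.mass 0 * (if x.typ 0 = i then 1 else 0))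

theorem measurable_defect (i : Fin (k + 1)) : Measurable (defect (k := k) i) := by
  refine (measurable_const.sub ((MassPartition.measurable_mass 0).mul ?_)).ennreal_ofReal
  exact Measurable.ite (MassPartition.measurable_typ 0 (measurableSet_singleton i))
    measurable_const measurable_const

/-- If the largest mass has type `i`, splitting `0` and `1` forces one of the two colours to differ
from `(1, i)`, and a union bound applies. Otherwise the defect is one and any probability is below
the bound. -/
theorem paintbox_splitSet_le {i : Fin (k + 1)} (hi : i ≠ 0) (x : MassPartition k) :
    paintbox x (splitSet i 0 1) ≤ 2 * defect i x := by
  rw [defect]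
  split_ifs with h0
  · rw [mul_one, paintbox, Measure.map_apply measurable_paint (measurableSet_splitSet i 0 1)]
    set P := Measure.infinitePi fun _ : ℕ => colourLaw x
    have hm : ∀ m : ℕ, P {p | p m ≠ (1, i)} = ENNReal.ofReal (1 - x.mass 0) := fun m => by
      have h1 : P ((fun p : ℕ → ℕ × Fin (k + 1) => p m) ⁻¹' {(1, i)}ᶜ) =
          colourLaw x {(1, i)}ᶜ := by
        rw [← Measure.map_apply (measurable_pi_apply m) .of_discrete]
        exact congrArg (fun μ : Measure (ℕ × Fin (k + 1)) => μ {(1, i)}ᶜ)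
          (Measure.infinitePi_map_eval (fun _ : ℕ => colourLaw x) m)
      rw [prob_compl_eq_one_sub (measurableSet_singleton _)] at h1
      have h2 := colourLaw_succ x 0 i
      rw [if_pos h0, zero_add] at h2
      rw [h2, ← ENNReal.ofReal_one, ← ENNReal.ofReal_sub _ (x.nonneg 0)] at h1
      exact h1
    calc P (paint ⁻¹' splitSet i 0 1) ≤ P ({p | p 0 ≠ (1, i)} ∪ {p | p 1 ≠ (1, i)}) := by
          refine measure_mono fun p hp => ?_
          by_contra hnot
          simp only [Set.mem_union, Set.mem_ofPred_eq, not_or, not_not] at hnot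
          refine hp ⟨Or.inr ⟨hnot.1.trans hnot.2.symm, by rw [hnot.1]; exact hi⟩, ?_⟩
          rw [paint_typ, if_pos ⟨1, by norm_num, hnot.2.trans hnot.1.symm⟩, hnot.1]
      _ ≤ _ := measure_union_le _ _
      _ = 2 * ENNReal.ofReal (1 - x.mass 0) := by rw [hm, hm, two_mul]
  · rw [mul_zero, sub_zero, ENNReal.ofReal_one, mul_one]
    exact prob_le_one.trans one_le_two

/-- The probability that `0` and `1` share a block of type `i` is the sum of the squared masses of
type `i`, hence at most any bound `M` on these masses. One takes `M` to be the largest mass if its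
type is `i`. Otherwise masses of type `i` come second at best and are at most `1 / 2`, which is
where the factor `2` comes from. -/
theorem defect_le {i : Fin (k + 1)} (hi : i ≠ 0) (x : MassPartition k) :
    defect i x ≤ 2 * paintbox x (splitSet i 0 1) := by
  set M : ℝ := if x.typ 0 = i then x.mass 0 else 1 / 2 with hM
  have hM0 : 0 ≤ M := by
    rw [hM]; split_ifs
    · exact x.nonneg 0
    · norm_num
  have hlaw : ∀ c : ℕ × Fin (k + 1), c.2 = i → colourLaw x {c} ≤ ENNReal.ofReal M := by
    rintro ⟨_ | n, j⟩ rfl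
    · rw [colourLaw_zero x hi]; exact zero_le
    · rw [colourLaw_succ]
      split_ifs with hj
      · refine ENNReal.ofReal_le_ofReal ?_
        rw [hM]
        split_ifs with h0
        · exact x.antitone (Nat.zero_le n)
        · rcases n with _ | n
          · exact absurd hj h0
          · refine (x.mass_le _).trans (one_div_le_one_div_of_le (by norm_num) ?_)
            push_cast
            linarith [(Nat.cast_nonneg n : (0 : ℝ) ≤ n)]
      · exact zero_le
  have hcompl : paintbox x (splitSet i 0 1)ᶜ ≤ ENNReal.ofReal M := by
    rw [paintbox, Measure.map_apply measurable_paint (measurableSet_splitSet i 0 1).compl]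
    set P := Measure.infinitePi fun _ : ℕ => colourLaw x
    have hpair : ∀ c : ℕ × Fin (k + 1), P {p | p 0 = c ∧ p 1 = c} =
        colourLaw x {c} * colourLaw x {c} := fun c => by
      have h1 := map_eval_fin x 2 fun _ => c
      rw [Measure.map_apply (by fun_prop) (measurableSet_singleton _), Fin.prod_univ_two] at h1
      rw [← h1]
      congr 1
      ext p
      simp [funext_iff, Fin.forall_fin_two]
    calc P (paint ⁻¹' (splitSet i 0 1)ᶜ) ≤
          P (⋃ c : ℕ × Fin (k + 1), if c.2 = i then {p | p 0 = c ∧ p 1 = c} else ∅) := by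
          refine measure_mono fun p hp => ?_
          simp only [Set.mem_preimage, Set.mem_compl_iff, mem_splitSet, not_not] at hp
          obtain ⟨hr, ht⟩ := hp
          rcases hr with h | ⟨hr, -⟩
          · norm_num at h
          rw [paint_typ, if_pos ⟨1, by norm_num, hr.symm⟩] at ht
          refine Set.mem_iUnion.2 ⟨p 0, ?_⟩
          rw [if_pos ht]
          exact ⟨rfl, hr.symm⟩
      _ ≤ ∑' c : ℕ × Fin (k + 1), P (if c.2 = i then {p | p 0 = c ∧ p 1 = c} else ∅) :=
          measure_iUnion_le _
      _ ≤ ∑' c : ℕ × Fin (k + 1), colourLaw x {c} * ENNReal.ofReal M := by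
          refine ENNReal.tsum_le_tsum fun c => ?_
          split_ifs with hc
          · rw [hpair]
            exact mul_le_mul_right (hlaw c hc) _
          · simp
      _ = ENNReal.ofReal M := by
          rw [ENNReal.tsum_mul_right]
          have := Measure.tsum_indicator_apply_singleton (colourLaw x) Set.univ .univ
          simp only [Set.indicator_univ, measure_univ] at this
          rw [this, one_mul]
  have hlow : 1 - ENNReal.ofReal M ≤ paintbox x (splitSet i 0 1) := by
    rw [tsub_le_iff_right]
    calc (1 : ℝ≥0∞) = paintbox x (splitSet i 0 1) + paintbox x (splitSet i 0 1)ᶜ := by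
          rw [measure_add_measure_compl (measurableSet_splitSet i 0 1), measure_univ]
      _ ≤ _ := by gcongr
  rw [← ENNReal.ofReal_one, ← ENNReal.ofReal_sub _ hM0] at hlow
  calc defect i x ≤ 2 * ENNReal.ofReal (1 - M) := by
        rw [← ENNReal.ofReal_ofNat 2, ← ENNReal.ofReal_mul (by norm_num), defect]
        refine ENNReal.ofReal_le_ofReal ?_
        rw [hM]
        split_ifs
        · linarith [x.mass_le_one 0]
        · norm_num
    _ ≤ _ := by gcongr

end

/-! ### A law of large numbers from second moments -/

noncomputable section

/-! ### Averages of exchangeable events -/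

section Averages

variable {Ω : Type*} {X : ℕ → Set Ω}

/-- The number of the first `n` events that occur. -/
def occurrences (X : ℕ → Set Ω) (n : ℕ) (ω : Ω) : ℝ :=
  ∑ m ∈ Finset.range n, (X m).indicator 1 ω

theorem occurrences_nonneg (n : ℕ) (ω : Ω) : 0 ≤ occurrences X n ω :=
  Finset.sum_nonneg fun _ _ => Set.indicator_nonneg (fun _ _ => zero_le_one) _

theorem occurrences_le (n : ℕ) (ω : Ω) : occurrences X n ω ≤ n := by
  calc occurrences X n ω ≤ ∑ _m ∈ Finset.range n, (1 : ℝ) :=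
        Finset.sum_le_sum fun m _ => Set.indicator_le_self' (fun _ _ => zero_le_one) ω
    _ = n := by simp

theorem occurrences_mono (ω : Ω) : Monotone fun n => occurrences X n ω := by
  refine monotone_nat_of_le_succ fun n => ?_
  rw [occurrences, occurrences, Finset.sum_range_succ]
  exact le_add_of_nonneg_right (Set.indicator_nonneg (fun _ _ => zero_le_one) _)

variable [MeasurableSpace Ω]

theorem measurable_occurrences (hX : ∀ m, MeasurableSet (X m)) (n : ℕ) :
    Measurable (occurrences X n) :=
  Finset.measurable_sum _ fun m _ => measurable_one.indicator (hX m)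

variable {μ : Measure Ω} [IsFiniteMeasure μ]

theorem integral_occurrences_mul (hX : ∀ m, MeasurableSet (X m)) {p q : ℝ}
    (hp : ∀ m, μ.real (X m) = p) (hq : ∀ m n, m ≠ n → μ.real (X m ∩ X n) = q) {n m : ℕ}
    (hnm : n ≤ m) :
    ∫ ω, occurrences X n ω * occurrences X m ω ∂μ = n * m * q + n * (p - q) := by
  have hprod : ∀ i j, (fun ω => (X i).indicator (1 : Ω → ℝ) ω * (X j).indicator 1 ω) =
      (X i ∩ X j).indicator 1 := fun i j => by
    ext ω
    rw [Set.inter_indicator_one]; rfl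
  have hint : ∀ i j, Integrable
      (fun ω => (X i).indicator (1 : Ω → ℝ) ω * (X j).indicator 1 ω) μ := fun i j => by
    rw [hprod]
    exact (integrable_const (1 : ℝ)).indicator ((hX i).inter (hX j))
  simp only [occurrences, Finset.sum_mul_sum]
  rw [integral_finsetSum _ fun i _ => integrable_finsetSum _ fun j _ => hint i j]
  have hterm : ∀ i ∈ Finset.range n,
      ∫ ω, ∑ j ∈ Finset.range m, (X i).indicator (1 : Ω → ℝ) ω * (X j).indicator 1 ω ∂μ =
        m * q + (p - q) := fun i hi => by
    rw [integral_finsetSum _ fun j _ => hint i j]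
    have : ∀ j ∈ Finset.range m,
        ∫ ω, (X i).indicator (1 : Ω → ℝ) ω * (X j).indicator 1 ω ∂μ =
          q + if i = j then p - q else 0 := fun j _ => by
      rw [hprod, integral_indicator_one ((hX i).inter (hX j))]
      split_ifs with h
      · rw [h, Set.inter_self, hp]; ring
      · rw [hq i j h, add_zero]
    rw [Finset.sum_congr rfl this, Finset.sum_add_distrib, Finset.sum_ite_eq, if_pos]
    · simp
    · simp only [Finset.mem_range] at *; omega
  rw [Finset.sum_congr rfl hterm]
  simp
  ring

/-- Among the `n * m` pairs of indices exactly `n` are diagonal, so second moments depend only on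
`p` and `q`. The `q`-terms independent of `n` and `m` cancel in the square, which leaves a Cauchy
estimate. -/
theorem integral_sq_sub_average (hX : ∀ m, MeasurableSet (X m)) {p q : ℝ}
    (hp : ∀ m, μ.real (X m) = p) (hq : ∀ m n, m ≠ n → μ.real (X m ∩ X n) = q) {n m : ℕ}
    (hn : 0 < n) (hnm : n ≤ m) :
    ∫ ω, (occurrences X n ω / n - occurrences X m ω / m) ^ 2 ∂μ = (p - q) * (1 / n - 1 / m) := by
  have hint : ∀ a b, Integrable (fun ω => occurrences X a ω * occurrences X b ω) μ := fun a b => by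
    refine Integrable.of_bound ((measurable_occurrences hX a).mul
      (measurable_occurrences hX b)).aestronglyMeasurable (a * b : ℝ) (ae_of_all _ fun ω => ?_)
    rw [Real.norm_of_nonneg (mul_nonneg (occurrences_nonneg _ _) (occurrences_nonneg _ _))]
    exact mul_le_mul (occurrences_le _ _) (occurrences_le _ _) (occurrences_nonneg _ _)
      (Nat.cast_nonneg _)
  have h1 : (n : ℝ) ≠ 0 := by positivity
  have h2 : (m : ℝ) ≠ 0 := by
    have : 0 < m := by omega
    positivity
  have e : (fun ω => (occurrences X n ω / n - occurrences X m ω / m) ^ 2) = fun ω =>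
      (1 / n ^ 2 : ℝ) * (occurrences X n ω * occurrences X n ω) +
        (1 / m ^ 2 : ℝ) * (occurrences X m ω * occurrences X m ω) -
        (2 / (n * m) : ℝ) * (occurrences X n ω * occurrences X m ω) := by
    ext ω
    field_simp
    ring
  have hadd : Integrable (fun ω => (1 / n ^ 2 : ℝ) * (occurrences X n ω * occurrences X n ω) +
      (1 / m ^ 2 : ℝ) * (occurrences X m ω * occurrences X m ω)) μ :=
    ((hint n n).const_mul _).add ((hint m m).const_mul _)
  rw [e, integral_sub hadd ((hint n m).const_mul _), integral_add ((hint n n).const_mul _) ((hint m m).const_mul _),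
    integral_const_mul, integral_const_mul, integral_const_mul,
    integral_occurrences_mul hX hp hq le_rfl, integral_occurrences_mul hX hp hq le_rfl,
    integral_occurrences_mul hX hp hq hnm]
  field_simp
  ring

/-- The frequency of occurrence of exchangeable events exists almost surely. -/
theorem ae_exists_tendsto_occurrences (hX : ∀ m, MeasurableSet (X m)) {p q : ℝ}
    (hp : ∀ m, μ.real (X m) = p) (hq : ∀ m n, m ≠ n → μ.real (X m ∩ X n) = q) :
    ∀ᵐ ω ∂μ, ∃ y, Tendsto (fun n : ℕ => occurrences X n ω / n) atTop (𝓝 y) := by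
  -- The fourth power is sparse enough for the variances of the increments, weighted by `(j + 1) ^
  -- 2`, to be summable, and dense enough for consecutive ratios to tend to one.
  set c : ℕ → ℕ := fun j => (j + 1) ^ 4 with hc
  have hcpos : ∀ j, 0 < c j := fun j => by positivity
  have hcmono : Monotone c := fun a b h => Nat.pow_le_pow_left (by omega) 4
  set Δ : ℕ → Ω → ℝ := fun j ω =>
    occurrences X (c j) ω / c j - occurrences X (c (j + 1)) ω / c (j + 1) with hΔ
  have hΔm : ∀ j, Measurable (Δ j) := fun j =>
    ((measurable_occurrences hX _).div_const _).sub ((measurable_occurrences hX _).div_const _)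
  have hv : 0 ≤ p - q := by
    rw [← hp 0, ← hq 0 1 (by norm_num), sub_nonneg]
    exact measureReal_mono Set.inter_subset_left
  have hbound : ∀ j : ℕ, ∫ ω, ((j : ℝ) + 1) ^ 2 * Δ j ω ^ 2 ∂μ ≤ (p - q) * (1 / ((j : ℝ) + 1) ^ 2) := by
    intro j
    rw [integral_const_mul, integral_sq_sub_average hX hp hq (hcpos j) (hcmono j.le_succ)]
    have h3 : (0 : ℝ) ≤ 1 / (c (j + 1) : ℝ) := by positivity
    calc ((j : ℝ) + 1) ^ 2 * ((p - q) * (1 / (c j : ℝ) - 1 / (c (j + 1) : ℝ)))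
        ≤ ((j : ℝ) + 1) ^ 2 * ((p - q) * (1 / (c j : ℝ))) := by
          gcongr; linarith
      _ = (p - q) * (1 / ((j : ℝ) + 1) ^ 2) := by
          simp only [hc]; push_cast; field_simp
  have hΔb : ∀ j ω, |Δ j ω| ≤ 1 := fun j ω => by
    have h : ∀ n, occurrences X (c n) ω / c n ∈ Set.Icc (0 : ℝ) 1 := fun n =>
      ⟨div_nonneg (occurrences_nonneg _ _) (by positivity),
        div_le_one_of_le₀ (occurrences_le _ _) (by positivity)⟩
    rw [abs_le]
    constructor <;> linarith [(h j).1, (h j).2, (h (j + 1)).1, (h (j + 1)).2]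
  have hint : ∀ j : ℕ, Integrable (fun ω => ((j : ℝ) + 1) ^ 2 * Δ j ω ^ 2) μ := fun j => by
    refine (Integrable.of_bound ((hΔm j).pow_const 2).aestronglyMeasurable 1
      (ae_of_all _ fun ω => ?_)).const_mul _
    rw [norm_pow, Real.norm_eq_abs]
    exact pow_le_one₀ (abs_nonneg _) (hΔb j ω)
  have hsum1 : Summable fun j : ℕ => 1 / ((j : ℝ) + 1) ^ 2 := by
    have := (summable_nat_add_iff 1).2 (Real.summable_one_div_nat_pow.2 (one_lt_two))
    simpa using this
  have hlint : ∫⁻ ω, ∑' j : ℕ, ENNReal.ofReal (((j : ℝ) + 1) ^ 2 * Δ j ω ^ 2) ∂μ ≠ ∞ := by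
    rw [lintegral_tsum fun j =>
      (((hΔm j).pow_const 2).const_mul _).ennreal_ofReal.aemeasurable]
    have : ∀ j : ℕ, ∫⁻ ω, ENNReal.ofReal (((j : ℝ) + 1) ^ 2 * Δ j ω ^ 2) ∂μ ≤
        ENNReal.ofReal ((p - q) * (1 / ((j : ℝ) + 1) ^ 2)) := fun j => by
      rw [← ofReal_integral_eq_lintegral_ofReal (hint j) (ae_of_all _ fun ω => by positivity)]
      exact ENNReal.ofReal_le_ofReal (hbound j)
    refine ne_top_of_le_ne_top ?_ (ENNReal.tsum_le_tsum this)
    rw [← ENNReal.ofReal_tsum_of_nonneg (fun j => mul_nonneg hv (by positivity))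
      (hsum1.mul_left _)]
    exact ENNReal.ofReal_ne_top
  have hmeas : Measurable fun ω => ∑' j : ℕ, ENNReal.ofReal (((j : ℝ) + 1) ^ 2 * Δ j ω ^ 2) :=
    Measurable.tsum fun j => (((hΔm j).pow_const 2).const_mul _).ennreal_ofReal
  filter_upwards [ae_lt_top hmeas hlint] with ω hω
  have hs : Summable fun j : ℕ => ((j : ℝ) + 1) ^ 2 * Δ j ω ^ 2 := by
    refine (ENNReal.summable_toReal hω.ne).congr fun j => ?_
    exact ENNReal.toReal_ofReal (by positivity)
  have hcauchy : CauchySeq fun j => occurrences X (c j) ω / c j := by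
    refine cauchySeq_of_summable_dist (Summable.of_nonneg_of_le (fun _ => dist_nonneg)
      (fun j => ?_) (hsum1.add hs))
    rw [Real.dist_eq]
    change |Δ j ω| ≤ _
    have hj : (0 : ℝ) < (j : ℝ) + 1 := by positivity
    -- The inequality of arithmetic and geometric means bounds `2 |Δ|` by two summable terms.
    have h4 := sq_nonneg (1 / ((j : ℝ) + 1) - ((j : ℝ) + 1) * |Δ j ω|)
    have h5 : (1 / ((j : ℝ) + 1) - ((j : ℝ) + 1) * |Δ j ω|) ^ 2 =
        1 / ((j : ℝ) + 1) ^ 2 + ((j : ℝ) + 1) ^ 2 * Δ j ω ^ 2 - 2 * |Δ j ω| := by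
      rw [sub_sq, mul_pow, sq_abs]
      field_simp
      ring
    have := abs_nonneg (Δ j ω)
    linarith
  obtain ⟨y, hy⟩ := cauchySeq_tendsto_of_complete hcauchy
  -- The counts are monotone, so convergence along a sequence whose consecutive ratios tend to one
  -- implies convergence.
  refine ⟨y, tendsto_div_of_monotone_of_exists_subseq_tendsto_div _ _ (occurrences_mono ω)
    fun a ha => ⟨c, ?_, ?_, hy⟩⟩
  · have hlim : Tendsto (fun n : ℕ => (1 + 1 / ((n : ℝ) + 1)) ^ 4) atTop (𝓝 1) := by
      have := ((tendsto_one_div_add_atTop_nhds_zero_nat (𝕜 := ℝ)).const_add 1).pow 4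
      simpa using this
    filter_upwards [hlim.eventually (gt_mem_nhds ha)] with n hn
    have e : (c (n + 1) : ℝ) = (1 + 1 / ((n : ℝ) + 1)) ^ 4 * c n := by
      simp only [hc]; push_cast
      have : (n : ℝ) + 1 ≠ 0 := by positivity
      field_simp
    rw [e]
    gcongr
  · exact tendsto_atTop_mono (fun j => (Nat.le_succ j).trans (Nat.le_self_pow (by norm_num) _))
      tendsto_id

/-- If the frequency of occurrence of equally likely events exists, its mean is their common
measure. -/
theorem integral_eq_of_tendsto_occurrences (hX : ∀ m, MeasurableSet (X m)) {p : ℝ}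
    (hp : ∀ m, μ.real (X m) = p) {L : Ω → ℝ}
    (hL : ∀ᵐ ω ∂μ, Tendsto (fun n : ℕ => occurrences X n ω / n) atTop (𝓝 (L ω))) :
    ∫ ω, L ω ∂μ = p := by
  refine tendsto_nhds_unique (tendsto_integral_of_dominated_convergence (fun _ => (1 : ℝ))
    (fun n => ((measurable_occurrences hX n).div_const _).aestronglyMeasurable)
    (integrable_const 1) (fun n => ae_of_all _ fun ω => ?_) hL) ?_
  · rw [Real.norm_of_nonneg (div_nonneg (occurrences_nonneg _ _) (by positivity))]
    exact div_le_one_of_le₀ (occurrences_le _ _) (by positivity)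
  · refine Tendsto.congr' ?_ tendsto_const_nhds
    filter_upwards [eventually_gt_atTop 0] with n hn
    rw [integral_div]
    simp only [occurrences]
    have hint : ∀ m, Integrable ((X m).indicator (1 : Ω → ℝ)) μ := fun m =>
      (integrable_const (1 : ℝ)).indicator (hX m)
    rw [integral_finsetSum _ fun m _ => hint m]
    simp only [integral_indicator_one (hX _), hp]
    rw [Finset.sum_const, Finset.card_range, nsmul_eq_mul]
    field_simp

theorem integrable_of_tendsto_occurrences (hX : ∀ m, MeasurableSet (X m)) {L : Ω → ℝ}
    (hL : ∀ᵐ ω ∂μ, Tendsto (fun n : ℕ => occurrences X n ω / n) atTop (𝓝 (L ω))) :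
    Integrable L μ := by
  refine Integrable.of_bound (aestronglyMeasurable_of_tendsto_ae _
    (fun n => ((measurable_occurrences hX n).div_const _).aestronglyMeasurable) hL) 1 ?_
  filter_upwards [hL] with ω hω
  refine le_of_tendsto' hω.norm fun n => ?_
  rw [Real.norm_of_nonneg (div_nonneg (occurrences_nonneg _ _) (by positivity))]
  exact div_le_one_of_le₀ (occurrences_le _ _) (by positivity)

end Averages

namespace TypedPartition

theorem sum_window (B : Set ℕ) (C n : ℕ) :
    ∑ m ∈ Finset.range n, B.indicator (1 : ℕ → ℝ) (C + m) = cnt B (C + n) - cnt B C := by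
  classical
  rw [cnt_eq_sum, cnt_eq_sum, Finset.sum_range_add]
  push_cast
  rw [add_sub_cancel_left]
  exact Finset.sum_congr rfl fun m _ => by simp [Set.indicator_apply]

/-- Allows the finitely many integers below `C` to be ignored, among which lie the exceptional ones
where exchangeability fails. -/
theorem hasFrequency_of_shift {B : Set ℕ} {y : ℝ} (C : ℕ)
    (h : Tendsto (fun n : ℕ => ((cnt B (C + n) : ℝ) - cnt B C) / n) atTop (𝓝 y)) :
    HasFrequency B y := by
  change Tendsto (fun n : ℕ => (cnt B n : ℝ) / n) atTop (𝓝 y)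
  rw [← tendsto_add_atTop_iff_nat C]
  have h1 := (h.add (tendsto_const_div_atTop_nhds_zero_nat (cnt B C : ℝ))).mul
    (tendsto_natCast_div_add_atTop (C : ℝ))
  rw [add_zero, mul_one] at h1
  refine h1.congr' ?_
  filter_upwards [eventually_gt_atTop 0] with n hn
  have h2 : (n : ℝ) ≠ 0 := by positivity
  have h3 : (n : ℝ) + C ≠ 0 := by positivity
  rw [add_comm C n]
  push_cast
  field_simp
  ring

theorem HasFrequency.shift {B : Set ℕ} {y : ℝ} (h : HasFrequency B y) (C : ℕ) :
    Tendsto (fun n : ℕ => ((cnt B (C + n) : ℝ) - cnt B C) / n) atTop (𝓝 y) := by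
  simpa using h.window C 0

end TypedPartition

end

/-! ### Generic partitions and their sampling by permutations -/

noncomputable section

variable {k : ℕ}

/-- Invariance under the permutations that move finitely many integers, none of them in `F`. -/
def ExchangeableOff (F : Finset ℕ) (μ : Measure (TypedPartition k ℕ)) : Prop :=
  ∀ σ : Equiv.Perm ℕ, {n | σ n ≠ n}.Finite → (∀ a ∈ F, σ a = a) →
    MeasurePreserving (TypedPartition.permute σ) μ μ

/-- Induction on `n`: compose with the transposition that corrects the image of `f n`. Injectivity
and avoidance of `F` ensure that it moves neither the earlier values nor `F`. -/
theorem exists_perm_extending (F : Finset ℕ) (n : ℕ) {f g : ℕ → ℕ}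
    (hf : Set.InjOn f (Set.Iio n)) (hg : Set.InjOn g (Set.Iio n)) (hfF : ∀ a < n, f a ∉ F)
    (hgF : ∀ a < n, g a ∉ F) :
    ∃ σ : Equiv.Perm ℕ, {m | σ m ≠ m}.Finite ∧ (∀ a ∈ F, σ a = a) ∧ ∀ a < n, σ (f a) = g a := by
  induction n with
  | zero => exact ⟨1, by simp, by simp, by simp⟩
  | succ n ih =>
    obtain ⟨σ, h1, h2, h3⟩ := ih (hf.mono (Set.Iio_subset_Iio n.le_succ))
      (hg.mono (Set.Iio_subset_Iio n.le_succ)) (fun a ha => hfF a (by omega))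
      (fun a ha => hgF a (by omega))
    refine ⟨Equiv.swap (σ (f n)) (g n) * σ, ?_, fun a ha => ?_, fun a ha => ?_⟩
    · refine ((h1.union (Set.toFinite {σ (f n), g n}))).subset fun m hm => ?_
      by_contra hnot
      simp only [Set.mem_union, Set.mem_ofPred_eq, Set.mem_insert_iff, Set.mem_singleton_iff,
        not_or, not_not] at hnot
      apply hm
      rw [Equiv.Perm.mul_apply, hnot.1, Equiv.swap_apply_of_ne_of_ne hnot.2.1 hnot.2.2]
    · rw [Equiv.Perm.mul_apply, h2 a ha, Equiv.swap_apply_of_ne_of_ne]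
      · intro e
        have : σ a = σ (f n) := (h2 a ha).trans e
        exact hfF n (by omega) (σ.injective this ▸ ha)
      · exact fun e => hgF n (by omega) (e ▸ ha)
    · rw [Equiv.Perm.mul_apply]
      rcases Nat.lt_succ_iff_lt_or_eq.1 ha with h | rfl
      · rw [h3 a h, Equiv.swap_apply_of_ne_of_ne]
        · intro e
          have : σ (f a) = σ (f n) := (h3 a h).trans e
          have := hf (Set.mem_Iio.2 ha) (Set.mem_Iio.2 n.lt_succ_self) (σ.injective this)
          omega
        · intro e
          have := hg (Set.mem_Iio.2 ha) (Set.mem_Iio.2 n.lt_succ_self) e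
          omega
      · exact Equiv.swap_apply_left _ _

namespace TypedPartition

theorem hasFrequencies_permute_iff {π : TypedPartition k ℕ} {σ : Equiv.Perm ℕ}
    (hσ : {n | σ n ≠ n}.Finite) : (π.permute σ).HasFrequencies ↔ π.HasFrequencies := by
  refine ⟨fun h => ?_, fun h => hasFrequencies_permute h hσ⟩
  have hσ' : {n | σ⁻¹ n ≠ n}.Finite := by
    refine hσ.subset fun n hn hn' => hn ?_
    rw [Equiv.Perm.inv_eq_iff_eq, hn']
  have := hasFrequencies_permute h hσ'
  rwa [permute_permute, mul_inv_cancel, permute_one] at this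

theorem HasFrequencies.freq_block_permute {π : TypedPartition k ℕ} (h : π.HasFrequencies)
    {σ : Equiv.Perm ℕ} (hσ : {n | σ n ≠ n}.Finite) (a : ℕ) :
    freq ((π.permute σ).block a) = freq (π.block (σ a)) := by
  rw [block_permute]
  exact ((h.hasFrequency (σ a)).preimage hσ).freq_eq

/-- The elements of the `n`-th largest block. -/
def labelSet (π : TypedPartition k ℕ) (n : ℕ) : Set ℕ :=
  {a | 0 < freq (π.block a) ∧ π.label a = n}

theorem HasFrequencies.hasFrequency_labelSet {π : TypedPartition k ℕ} (h : π.HasFrequencies)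
    (n : ℕ) : HasFrequency (π.labelSet n) (π.rank.mass n) := by
  rcases (π.rank.nonneg n).eq_or_lt with h0 | h0
  · have : π.labelSet n = ∅ := by
      refine Set.eq_empty_iff_forall_notMem.2 fun a ha => ?_
      have := (h.rank_label ha.1).1
      rw [ha.2, ← h0] at this
      exact ha.1.ne this
    rw [this, ← h0]
    exact hasFrequency_of_finite Set.finite_empty
  · obtain ⟨a, ha, rfl⟩ := h.exists_label_eq h0
    have : π.labelSet (π.label a) = π.block a := by
      ext b
      constructor
      · exact fun hb => (h.label_eq_iff hb.1 ha).1 hb.2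
      · intro hb
        have hr : π.rel b a := hb
        exact ⟨by rw [block_eq_iff.2 hr]; exact ha, label_eq_of_rel hr⟩
    rw [this, (h.rank_label ha).1]
    exact h.hasFrequency a

theorem labelSet_pairwiseDisjoint (π : TypedPartition k ℕ) (s : Set ℕ) :
    s.PairwiseDisjoint π.labelSet := by
  intro m _ n _ hmn
  rw [Function.onFun, Set.disjoint_left]
  exact fun a ha ha' => hmn (ha.2.symm.trans ha'.2)

/-- The singletons are disjoint from any finite union of blocks of positive frequency, and the
frequencies of both add up to at most one. -/
theorem HasFrequencies.le_dust {π : TypedPartition k ℕ} (h : π.HasFrequencies) {y : ℝ}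
    (hy : HasFrequency {a | π.typ a = 0} y) : y ≤ π.rank.dust := by
  rw [MassPartition.dust, le_sub_comm]
  refine π.rank.summable.tsum_le_of_sum_le fun s => ?_
  have h1 := HasFrequency.biUnion (s := s) (fun n _ => h.hasFrequency_labelSet n)
    (π.labelSet_pairwiseDisjoint s)
  have h2 : Disjoint (⋃ n ∈ s, π.labelSet n) {a | π.typ a = 0} := by
    rw [Set.disjoint_left]
    intro a ha ha'
    simp only [Set.mem_iUnion] at ha
    obtain ⟨n, -, hn⟩ := ha
    exact typ_ne_zero_of_freq_pos hn.1 ha'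
  linarith [(h1.union hy h2).le_one]

open Classical in
/-- The colour of `a`: the rank and the type of its block, if that block has a positive
frequency. -/
def colour (π : TypedPartition k ℕ) (a : ℕ) : ℕ × Fin (k + 1) :=
  if 0 < freq (π.block a) then (π.label a + 1, π.typ a) else (0, 0)

theorem colour_of_pos {π : TypedPartition k ℕ} {a : ℕ} (h : 0 < freq (π.block a)) :
    π.colour a = (π.label a + 1, π.typ a) := if_pos h

theorem colour_of_not_pos {π : TypedPartition k ℕ} {a : ℕ} (h : ¬ 0 < freq (π.block a)) :
    π.colour a = (0, 0) := if_neg h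

theorem freq_pos_of_colour_ne {π : TypedPartition k ℕ} {a : ℕ} (h : (π.colour a).2 ≠ 0) :
    0 < freq (π.block a) := by
  by_contra hn
  rw [colour_of_not_pos hn] at h
  exact h rfl

/-- The properties of a generic partition with types: the blocks have frequencies, every element
outside `F` is a singleton or in a block of positive frequency, and the frequency of the
singletons is the mass of the dust. -/
structure IsGeneric (F : Finset ℕ) (π : TypedPartition k ℕ) : Prop where
  hasFrequencies : π.HasFrequencies
  freq_pos : ∀ b ∉ F, π.typ b ≠ 0 → 0 < freq (π.block b)
  hasFrequency_dust : HasFrequency {a | π.typ a = 0} π.rank.dust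

/-- A subset of the colour class suffices, since only lower bounds are needed. For the colour `(0,
0)` the singletons are used, because the full class may also contain elements of `F` in blocks of
zero frequency. -/
theorem IsGeneric.exists_hasFrequency {F : Finset ℕ} {π : TypedPartition k ℕ}
    (h : π.IsGeneric F) (c : ℕ × Fin (k + 1)) :
    ∃ T : Set ℕ, HasFrequency T (colourLaw π.rank {c}).toReal ∧ ∀ a ∈ T, π.colour a = c := by
  have hF := h.hasFrequencies
  obtain ⟨_ | n, j⟩ := c
  · by_cases hj : j = 0
    · subst hj
      refine ⟨{a | π.typ a = 0}, ?_, fun a ha => ?_⟩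
      · rw [colourLaw_dust, ENNReal.toReal_ofReal π.rank.dust_nonneg]
        exact h.hasFrequency_dust
      · exact colour_of_not_pos fun hp => typ_ne_zero_of_freq_pos hp ha
    · refine ⟨∅, ?_, fun a ha => absurd ha (Set.notMem_empty a)⟩
      rw [colourLaw_zero _ hj]
      exact hasFrequency_of_finite Set.finite_empty
  · rw [colourLaw_succ]
    split_ifs with hj
    · refine ⟨π.labelSet n, ?_, fun a ha => ?_⟩
      · rw [ENNReal.toReal_ofReal (π.rank.nonneg n)]
        exact hF.hasFrequency_labelSet n
      · have := (hF.rank_label ha.1).2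
        rw [ha.2] at this
        rw [colour_of_pos ha.1, ha.2, ← hj, this]
    · exact ⟨∅, hasFrequency_of_finite Set.finite_empty,
        fun a ha => absurd ha (Set.notMem_empty a)⟩

/-- Off `F`, an integer related to another one lies in a block of positive frequency, and such a
block is identified by its label. So the colours of the sampled integers determine the sampled
partition. -/
theorem IsGeneric.restrict_permute {F : Finset ℕ} {π : TypedPartition k ℕ} (h : π.IsGeneric F)
    {n : ℕ} {σ : Equiv.Perm ℕ} (hσ : ∀ l < n, σ l ∉ F) :
    (π.permute σ).restrict n = (paint fun l => π.colour (σ l)).restrict n := by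
  have hpos : ∀ a b, a < n → b ≠ a → π.rel (σ a) (σ b) → 0 < freq (π.block (σ a)) :=
    fun a b ha hab hr => h.freq_pos _ (hσ a ha) fun h0 =>
      hab (σ.injective ((π.typ_eq_zero_iff _).1 h0 _ hr))
  have hcol : ∀ a b, a < n → b < n → b ≠ a → π.rel (σ a) (σ b) →
      π.colour (σ a) = π.colour (σ b) := fun a b ha hb hab hr => by
    rw [colour_of_pos (hpos a b ha hab hr), colour_of_pos (hpos b a hb hab.symm (π.rel.symm hr)),
      label_eq_of_rel hr, π.typ_congr _ _ hr]
  refine restrict_eq_of (fun a b ha hb => ?_) fun a b ha hb hab hr => ?_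
  · rw [permute_rel, paint_rel]
    constructor
    · intro hr
      by_cases hab : b = a
      · exact Or.inl hab.symm
      · refine Or.inr ⟨hcol a b ha hb hab hr, ?_⟩
        have hp := hpos a b ha hab hr
        rw [colour_of_pos hp]
        exact typ_ne_zero_of_freq_pos hp
    · rintro (rfl | ⟨h1, h2⟩)
      · exact π.rel.refl _
      · have hp1 := freq_pos_of_colour_ne h2
        have hp2 := freq_pos_of_colour_ne (h1 ▸ h2)
        rw [colour_of_pos hp1, colour_of_pos hp2, Prod.mk.injEq] at h1
        exact (h.hasFrequencies.label_eq_iff hp1 hp2).1 (Nat.succ_injective h1.1)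
  · rw [permute_typ, paint_typ, if_pos ⟨b, hab, (hcol a b ha hb hab hr).symm⟩,
      colour_of_pos (hpos a b ha hab hr)]

/-! ### Empirical laws of the colours -/

theorem sum_indicator_window (B : Set ℕ) (C N : ℕ) :
    ∑ j : Fin N, B.indicator (1 : ℕ → ℝ≥0∞) (C + j) =
      ENNReal.ofReal ((cnt B (C + N) : ℝ) - cnt B C) := by
  classical
  rw [← sum_window, Fin.sum_univ_eq_sum_range (fun j => B.indicator (1 : ℕ → ℝ≥0∞) (C + j)),
    ENNReal.ofReal_sum_of_nonneg (f := fun m => B.indicator (1 : ℕ → ℝ) (C + m))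
      fun m _ => Set.indicator_nonneg (fun _ _ => zero_le_one) _]
  refine Finset.sum_congr rfl fun m _ => ?_
  simp only [Set.indicator_apply, Pi.one_apply]
  split_ifs <;> simp

theorem _root_.tsum_liminf_le {ι : Type*} [Countable ι] (g : ℕ → ι → ℝ≥0∞) :
    ∑' c, liminf (fun N => g N c) atTop ≤ liminf (fun N => ∑' c, g N c) atTop := by
  let _ : MeasurableSpace ι := ⊤
  have := lintegral_liminf_le (μ := (Measure.count : Measure ι)) (u := atTop) (f := g)
    fun N => measurable_of_countable _
  rw [lintegral_count] at this
  simpa only [lintegral_count] using this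

/-- The permutations place `l < n` anywhere in the `l`-th window of length `N` after `C`. The
proportion of samples with colours `c` is at least a product of window frequencies, which converges
to the product of the masses of the colours. There are infinitely many colours, so Fatou's lemma
gives an inequality only. -/
theorem IsGeneric.paintbox_le_liminf {F : Finset ℕ} {π : TypedPartition k ℕ} (h : π.IsGeneric F)
    {A : Set (TypedPartition k ℕ)} {n : ℕ} (hA : Determined n A) (C : ℕ)
    {σ : ∀ N : ℕ, (Fin n → Fin N) → Equiv.Perm ℕ} (hσ : ∀ N m, ∀ l < n, σ N m l ∉ F)
    (hσ' : ∀ N m (l : Fin n), σ N m l = C + l * N + m l) :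
    paintbox π.rank A ≤ liminf (fun N : ℕ =>
      (∑ m : Fin n → Fin N, A.indicator (1 : TypedPartition k ℕ → ℝ≥0∞) (π.permute (σ N m))) /
        (N : ℝ≥0∞) ^ n) atTop := by
  classical
  set G : Set (Fin n → ℕ × Fin (k + 1)) := {c | paint (extendColours c) ∈ A}
  choose T hT hTc using h.exists_hasFrequency
  -- the indicator of `A` in terms of colours
  have hind : ∀ N (m : Fin n → Fin N),
      A.indicator (1 : TypedPartition k ℕ → ℝ≥0∞) (π.permute (σ N m)) =
        G.indicator 1 fun l : Fin n => π.colour (C + l * N + m l) := fun N m => by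
    have e : (π.permute (σ N m)).restrict n =
        (paint (extendColours fun l : Fin n => π.colour (C + l * N + m l))).restrict n := by
      rw [h.restrict_permute (hσ N m)]
      refine restrict_paint_congr fun l hl => ?_
      rw [extendColours_of_lt _ hl, ← hσ' N m ⟨l, hl⟩]
    have : π.permute (σ N m) ∈ A ↔ (fun l : Fin n => π.colour (C + l * N + m l)) ∈ G :=
      ⟨hA _ _ e, hA _ _ e.symm⟩
    simp only [Set.indicator_apply, this, Pi.one_apply]
  have hsum : ∀ N : ℕ, ∑' c : Fin n → ℕ × Fin (k + 1), G.indicator (fun c => ENNReal.ofReal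
      (∏ l : Fin n, (((cnt (T (c l)) (C + (l + 1) * N) : ℝ) - cnt (T (c l)) (C + l * N)) / N))) c ≤
      (∑ m : Fin n → Fin N, A.indicator (1 : TypedPartition k ℕ → ℝ≥0∞) (π.permute (σ N m))) /
        (N : ℝ≥0∞) ^ n := by
    intro N
    -- Empty windows divide by zero: for `n > 0` the left side is then zero, and for `n = 0` both
    -- sides are the same single indicator.
    rcases Nat.eq_zero_or_pos N with rfl | hN
    · rcases Nat.eq_zero_or_pos n with rfl | hn
      · simp only [Finset.univ_unique, Finset.sum_singleton, pow_zero, div_one, hind]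
        rw [tsum_eq_single (default : Fin 0 → ℕ × Fin (k + 1))
          fun c hc => absurd (Subsingleton.elim _ _) hc]
        simp only [Finset.univ_eq_empty, Finset.prod_empty, ENNReal.ofReal_one]
        rw [Subsingleton.elim (fun l : Fin 0 => π.colour
          (C + l * 0 + (default : Fin 0 → Fin 0) l)) default]
        rfl
      · have : (∑' c : Fin n → ℕ × Fin (k + 1), G.indicator (fun c => ENNReal.ofReal
            (∏ l : Fin n, (((cnt (T (c l)) (C + (l + 1) * 0) : ℝ) -
              cnt (T (c l)) (C + l * 0)) / (0 : ℕ)))) c) = 0 := by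
          refine ENNReal.tsum_eq_zero.2 fun c => ?_
          rw [Set.indicator_apply]
          split_ifs
          · simp [hn.ne']
          · rfl
        rw [this]
        exact zero_le
    have hN0 : (N : ℝ≥0∞) ≠ 0 := by exact_mod_cast hN.ne'
    -- Each window count is at most the number of integers of colour `c l` in that window. The
    -- product of these numbers expands into a sum over samples `m`, and for each sample exactly one
    -- `c` contributes.
    calc ∑' c : Fin n → ℕ × Fin (k + 1), G.indicator (fun c => ENNReal.ofReal
          (∏ l : Fin n, (((cnt (T (c l)) (C + (l + 1) * N) : ℝ) -
            cnt (T (c l)) (C + l * N)) / N))) c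
        ≤ ∑' c : Fin n → ℕ × Fin (k + 1),
          (∑ m : Fin n → Fin N, G.indicator 1 c *
            ∏ l : Fin n, ({c l} : Set _).indicator (1 : ℕ × Fin (k + 1) → ℝ≥0∞)
              (π.colour (C + l * N + m l))) / (N : ℝ≥0∞) ^ n := by
          refine ENNReal.tsum_le_tsum fun c => ?_
          rw [← Finset.mul_sum]
          by_cases hc : c ∈ G
          swap
          · rw [Set.indicator_of_notMem hc]; exact zero_le
          rw [Set.indicator_of_mem hc, Set.indicator_of_mem hc, Pi.one_apply, one_mul,
            ← Fintype.prod_sum fun (l : Fin n) (j : Fin N) =>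
              ({c l} : Set (ℕ × Fin (k + 1))).indicator (1 : ℕ × Fin (k + 1) → ℝ≥0∞) (π.colour (C + l * N + j))]
          have hnn : ∀ l : Fin n, 0 ≤ (cnt (T (c l)) (C + (l + 1) * N) : ℝ) -
              cnt (T (c l)) (C + l * N) := fun l => by
            rw [sub_nonneg]
            exact_mod_cast cnt_monotone _ (by gcongr; omega)
          rw [Finset.prod_div_distrib, ENNReal.ofReal_div_of_pos (by simp; positivity),
            ENNReal.ofReal_prod_of_nonneg fun l _ => hnn l]
          simp only [Finset.prod_const, Finset.card_univ, Fintype.card_fin]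
          rw [ENNReal.ofReal_pow (by positivity), ENNReal.ofReal_natCast]
          refine ENNReal.div_le_div_right (Finset.prod_le_prod' fun l _ => ?_) _
          have e := sum_indicator_window (T (c l)) (C + l * N) N
          rw [show C + l * N + N = C + (l + 1) * N by ring] at e
          rw [← e]
          refine Finset.sum_le_sum fun j _ => ?_
          by_cases hj : C + l * N + j ∈ T (c l)
          · rw [Set.indicator_of_mem hj, Set.indicator_of_mem (by simpa using hTc _ _ hj)]
            rfl
          · rw [Set.indicator_of_notMem hj]; exact zero_le
      _ = (∑ m : Fin n → Fin N, ∑' c : Fin n → ℕ × Fin (k + 1), G.indicator 1 c *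
            ∏ l : Fin n, ({c l} : Set _).indicator (1 : ℕ × Fin (k + 1) → ℝ≥0∞)
              (π.colour (C + l * N + m l))) / (N : ℝ≥0∞) ^ n := by
          simp only [div_eq_mul_inv]
          rw [ENNReal.tsum_mul_right, Summable.tsum_finsetSum fun _ _ => ENNReal.summable]
      _ = _ := by
          congr 1
          refine Finset.sum_congr rfl fun m _ => ?_
          rw [hind, tsum_eq_single fun l : Fin n => π.colour (C + l * N + m l)]
          · simp
          · intro c hc
            obtain ⟨l, hl⟩ := Function.ne_iff.1 hc
            rw [Finset.prod_eq_zero (Finset.mem_univ l), mul_zero]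
            exact Set.indicator_of_notMem (by simpa using fun e => hl e.symm) _
  rw [paintbox_apply_of_determined _ hA]
  have hlim : ∀ c : Fin n → ℕ × Fin (k + 1), Tendsto (fun N : ℕ => G.indicator (fun c =>
      ENNReal.ofReal (∏ l : Fin n, (((cnt (T (c l)) (C + (l + 1) * N) : ℝ) -
        cnt (T (c l)) (C + l * N)) / N))) c) atTop
      (𝓝 (G.indicator (fun c => ∏ l, colourLaw π.rank {c l}) c)) := by
    intro c
    by_cases hc : c ∈ G
    · simp only [Set.indicator_of_mem hc]
      have : ∏ l, colourLaw π.rank {c l} =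
          ENNReal.ofReal (∏ l, (colourLaw π.rank {c l}).toReal) := by
        rw [ENNReal.ofReal_prod_of_nonneg fun l _ => ENNReal.toReal_nonneg]
        exact Finset.prod_congr rfl fun l _ => (ENNReal.ofReal_toReal (measure_ne_top _ _)).symm
      rw [this]
      exact ENNReal.tendsto_ofReal (tendsto_finsetProd _ fun l _ => (hT (c l)).window C l)
    · simp only [Set.indicator_of_notMem hc]
      exact tendsto_const_nhds
  calc _ = ∑' c : Fin n → ℕ × Fin (k + 1), liminf (fun N : ℕ => G.indicator (fun c =>
        ENNReal.ofReal (∏ l : Fin n, (((cnt (T (c l)) (C + (l + 1) * N) : ℝ) -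
          cnt (T (c l)) (C + l * N)) / N))) c) atTop :=
        tsum_congr fun c => (hlim c).liminf_eq.symm
    _ ≤ liminf (fun N : ℕ => ∑' c : Fin n → ℕ × Fin (k + 1), G.indicator (fun c =>
        ENNReal.ofReal (∏ l : Fin n, (((cnt (T (c l)) (C + (l + 1) * N) : ℝ) -
          cnt (T (c l)) (C + l * N)) / N))) c) atTop := tsum_liminf_le _
    _ ≤ _ := liminf_le_liminf (Eventually.of_forall hsum)

end TypedPartition

end

/-! ### Finite measures exchangeable off a finite set -/

noncomputable section

variable {k : ℕ} {F : Finset ℕ} {μ : Measure (TypedPartition k ℕ)}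

namespace ExchangeableOff

open TypedPartition

theorem mono (hμ : ExchangeableOff F μ) {F' : Finset ℕ} (h : F ⊆ F') : ExchangeableOff F' μ :=
  fun σ hσ hF => hμ σ hσ fun a ha => hF a (h ha)

/-- The events `P b` are permuted by the permutations fixing `F`. -/
def Equivariant (F : Finset ℕ) (P : ℕ → Set (TypedPartition k ℕ)) : Prop :=
  (∀ b, MeasurableSet (P b)) ∧ ∀ σ : Equiv.Perm ℕ, {n | σ n ≠ n}.Finite → (∀ a ∈ F, σ a = a) →
    ∀ b, permute σ ⁻¹' P b = P (σ b)

variable {P : ℕ → Set (TypedPartition k ℕ)}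

theorem measure_eq (hμ : ExchangeableOff F μ) (hP : Equivariant F P) {b c : ℕ} (hb : b ∉ F)
    (hc : c ∉ F) : μ (P b) = μ (P c) := by
  obtain ⟨σ, h1, h2, h3⟩ := exists_perm_extending F 1 (f := fun _ => b) (g := fun _ => c)
    (fun _ h _ h' _ => by simp at h h'; omega) (fun _ h _ h' _ => by simp at h h'; omega)
    (fun _ _ => hb) (fun _ _ => hc)
  rw [← (hμ σ h1 h2).measure_preimage (hP.1 b).nullMeasurableSet, hP.2 σ h1 h2, h3 0 one_pos]

theorem measure_inter_eq (hμ : ExchangeableOff F μ) (hP : Equivariant F P) {b c b' c' : ℕ}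
    (hb : b ∉ F) (hc : c ∉ F) (hb' : b' ∉ F) (hc' : c' ∉ F) (hbc : b ≠ c) (hbc' : b' ≠ c') :
    μ (P b ∩ P c) = μ (P b' ∩ P c') := by
  have hinj : ∀ u v : ℕ, u ≠ v → Set.InjOn (fun l => if l = 0 then u else v) (Set.Iio 2) := by
    intro u v huv l hl l' hl' e
    simp only [Set.mem_Iio] at hl hl'
    interval_cases l <;> interval_cases l' <;> simp_all
  have hmem : ∀ u v : ℕ, u ∉ F → v ∉ F → ∀ l < 2, (if l = 0 then u else v) ∉ F := by
    intro u v hu hv l _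
    split_ifs <;> assumption
  obtain ⟨σ, h1, h2, h3⟩ := exists_perm_extending F 2 (hinj b c hbc) (hinj b' c' hbc')
    (hmem b c hb hc) (hmem b' c' hb' hc')
  have e0 : σ b = b' := h3 0 two_pos
  have e1 : σ c = c' := h3 1 one_lt_two
  rw [← (hμ σ h1 h2).measure_preimage ((hP.1 b).inter (hP.1 c)).nullMeasurableSet,
    Set.preimage_inter, hP.2 σ h1 h2, hP.2 σ h1 h2, e0, e1]

/-- A bound for the elements of `F`. -/
theorem exists_forall_notMem (F : Finset ℕ) : ∃ C, ∀ m, C ≤ m → m ∉ F :=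
  ⟨F.sup id + 1, fun m hm h => by
    have := Finset.le_sup (f := id) h
    simp only [id] at this
    omega⟩

theorem occurrences_shift (C n : ℕ) (π : TypedPartition k ℕ) :
    occurrences (fun m => P (C + m)) n π =
      cnt {b | π ∈ P b} (C + n) - cnt {b | π ∈ P b} C := by
  rw [← sum_window]
  rfl

variable [IsFiniteMeasure μ]

theorem ae_exists_hasFrequency (hμ : ExchangeableOff F μ) (hP : Equivariant F P) :
    ∀ᵐ π ∂μ, ∃ y, HasFrequency {b | π ∈ P b} y := by
  obtain ⟨C, hC⟩ := exists_forall_notMem F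
  have hC' : ∀ m, C + m ∉ F := fun m => hC _ (by omega)
  filter_upwards [ae_exists_tendsto_occurrences (μ := μ) (X := fun m => P (C + m))
    (fun m => hP.1 _) (p := μ.real (P (C + 0))) (q := μ.real (P (C + 0) ∩ P (C + 1)))
    (fun m => congrArg ENNReal.toReal (hμ.measure_eq hP (hC' _) (hC' _)))
    (fun m n hmn => congrArg ENNReal.toReal (hμ.measure_inter_eq hP (hC' _) (hC' _) (hC' _)
      (hC' _) (by omega) (by omega)))] with π hπ
  obtain ⟨y, hy⟩ := hπ
  refine ⟨y, hasFrequency_of_shift C ?_⟩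
  simpa only [occurrences_shift] using hy

/-- Mostly used in the degenerate case: if the frequency of the events vanishes almost everywhere,
then each event indexed off `F` is null. -/
theorem integral_frequency (hμ : ExchangeableOff F μ) (hP : Equivariant F P)
    {L : TypedPartition k ℕ → ℝ} (hL : ∀ᵐ π ∂μ, HasFrequency {b | π ∈ P b} (L π)) {b : ℕ}
    (hb : b ∉ F) : Integrable L μ ∧ ∫ π, L π ∂μ = μ.real (P b) := by
  obtain ⟨C, hC⟩ := exists_forall_notMem F
  have hC' : ∀ m, C + m ∉ F := fun m => hC _ (by omega)
  have hL' : ∀ᵐ π ∂μ, Tendsto (fun n : ℕ => occurrences (fun m => P (C + m)) n π / n) atTop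
      (𝓝 (L π)) := by
    filter_upwards [hL] with π hπ
    simpa only [occurrences_shift] using hπ.shift C
  exact ⟨integrable_of_tendsto_occurrences (fun m => hP.1 _) hL',
    integral_eq_of_tendsto_occurrences (fun m => hP.1 _)
      (fun m => congrArg ENNReal.toReal (hμ.measure_eq hP (hC' m) hb)) hL'⟩

theorem equivariant_rel (F : Finset ℕ) (a : ℕ) :
    Equivariant (insert a F) fun b => {π : TypedPartition k ℕ | π.rel b a} := by
  refine ⟨fun b => measurableSet_rel b a, fun σ _ hF b => ?_⟩
  ext π
  rw [Set.mem_preimage, Set.mem_ofPred_eq, Set.mem_ofPred_eq, permute_rel,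
    hF a (Finset.mem_insert_self _ _)]

/-- For a fixed `a`, the events `b ∼ a` are permuted by the permutations that also fix `a`, so the
law of large numbers applies off `insert a F`. -/
theorem ae_hasFrequencies (hμ : ExchangeableOff F μ) : ∀ᵐ π ∂μ, π.HasFrequencies := by
  simp only [hasFrequencies_iff, ae_all_iff]
  exact fun a => (hμ.mono (Finset.subset_insert a F)).ae_exists_hasFrequency (equivariant_rel F a)

/-- The events "`b ∼ a` and the block of `a` has frequency zero" occur with frequency zero, so each
of them is null. Having frequencies is included in the event because the invariance of `freq` is
established for such partitions. -/
theorem ae_freq_pos_of_rel (hμ : ExchangeableOff F μ) {a b : ℕ} (hb : b ∉ F) (hab : a ≠ b) :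
    ∀ᵐ π ∂μ, π.rel b a → 0 < freq (π.block b) := by
  set P : ℕ → Set (TypedPartition k ℕ) := fun b =>
    {π | π.rel b a} ∩ ({π | π.HasFrequencies} ∩ {π | freq (π.block a) = 0})
  have hP : Equivariant (insert a F) P := by
    refine ⟨fun b => (measurableSet_rel b a).inter (measurableSet_hasFrequencies.inter
      (measurableSet_eq_fun (measurable_freq_block a) measurable_const)), fun σ hσ hF b => ?_⟩
    have hr := (equivariant_rel (k := k) F a).2 σ hσ hF b
    have hfix := hF a (Finset.mem_insert_self _ _)
    ext π
    constructor
    · rintro ⟨h1, h2, h3⟩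
      have h2' := (hasFrequencies_permute_iff hσ).1 h2
      refine ⟨hr.subset h1, h2', ?_⟩
      rwa [Set.mem_ofPred_eq, h2'.freq_block_permute hσ, hfix] at h3
    · rintro ⟨h1, h2, h3⟩
      refine ⟨hr.superset h1, (hasFrequencies_permute_iff hσ).2 h2, ?_⟩
      rwa [Set.mem_ofPred_eq, h2.freq_block_permute hσ, hfix]
  have hb' : b ∉ insert a F := by simp [hb, hab.symm]
  have h0 := ((hμ.mono (Finset.subset_insert a F)).integral_frequency hP (L := fun _ => 0)
    (ae_of_all _ fun π => ?_) hb').2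
  · rw [integral_zero] at h0
    have h0' : μ (P b) = 0 := (measureReal_eq_zero_iff).1 h0.symm
    filter_upwards [hμ.ae_hasFrequencies, measure_eq_zero_iff_ae_notMem.1 h0'] with π h1 h2 hr
    by_contra hn
    refine h2 ⟨hr, h1, ?_⟩
    rw [Set.mem_ofPred_eq, ← block_eq_iff.2 hr]
    exact le_antisymm (not_lt.1 hn) (h1.hasFrequency b).nonneg
  · by_cases h : π.HasFrequencies ∧ freq (π.block a) = 0
    · have : {b | π ∈ P b} = π.block a := by
        ext b
        exact ⟨fun hb => hb.1, fun hb => ⟨hb, h.1, h.2⟩⟩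
      rw [this, ← h.2]
      exact h.1.hasFrequency a
    · have : {b | π ∈ P b} = ∅ := Set.eq_empty_iff_forall_notMem.2 fun b hb => h hb.2
      rw [this]
      exact hasFrequency_of_finite Set.finite_empty

theorem ae_freq_pos (hμ : ExchangeableOff F μ) :
    ∀ᵐ π ∂μ, ∀ b ∉ F, π.typ b ≠ 0 → 0 < freq (π.block b) := by
  have : ∀ᵐ π ∂μ, ∀ b a, b ∉ F → a ≠ b → π.rel b a → 0 < freq (π.block b) := by
    simp only [ae_all_iff]
    exact fun b a hb hab => hμ.ae_freq_pos_of_rel hb hab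
  filter_upwards [this] with π h b hb ht
  have h' := mt (π.typ_eq_zero_iff b).2 ht
  push Not at h'
  obtain ⟨a, ha, hab⟩ := h'
  exact h b a hb hab ha

theorem equivariant_typ (F : Finset ℕ) :
    Equivariant F fun b => {π : TypedPartition k ℕ | π.typ b = 0} := by
  refine ⟨fun b => measurable_typ b (measurableSet_singleton 0), fun σ _ _ b => ?_⟩
  ext π
  rw [Set.mem_preimage, Set.mem_ofPred_eq, Set.mem_ofPred_eq, permute_typ]

theorem equivariant_le_freq (F : Finset ℕ) (ε : ℝ) : Equivariant F fun b =>
    {π : TypedPartition k ℕ | π.HasFrequencies} ∩ {π | ε ≤ freq (π.block b)} := by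
  refine ⟨fun b => measurableSet_hasFrequencies.inter
    (measurableSet_le measurable_const (measurable_freq_block b)), fun σ hσ _ b => ?_⟩
  ext π
  constructor
  · rintro ⟨h1, h2⟩
    have h1' := (hasFrequencies_permute_iff hσ).1 h1
    refine ⟨h1', ?_⟩
    rwa [Set.mem_ofPred_eq, h1'.freq_block_permute hσ] at h2
  · rintro ⟨h1, h2⟩
    refine ⟨(hasFrequencies_permute_iff hσ).2 h1, ?_⟩
    rwa [Set.mem_ofPred_eq, h1.freq_block_permute hσ]

/-- Frequency is only finitely additive. The threshold `ε` leaves finitely many blocks, so that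
their union has a frequency. -/
theorem _root_.TypedPartition.HasFrequencies.hasFrequency_le_freq {π : TypedPartition k ℕ}
    (h : π.HasFrequencies) {ε : ℝ} (hε : 0 < ε) : HasFrequency {b | ε ≤ freq (π.block b)}
      (∑ n ∈ (π.rank.finite_le_mass hε).toFinset, π.rank.mass n) := by
  have h1 := HasFrequency.biUnion (s := (π.rank.finite_le_mass hε).toFinset)
    (fun n _ => h.hasFrequency_labelSet n) (π.labelSet_pairwiseDisjoint _)
  convert h1 using 1
  ext b
  simp only [Set.mem_ofPred_eq, Set.mem_iUnion, Set.Finite.mem_toFinset, exists_prop]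
  constructor
  · intro hb
    have hpos := hε.trans_le hb
    exact ⟨π.label b, by rw [(h.rank_label hpos).1]; exact hb, hpos, rfl⟩
  · rintro ⟨_, h2, hpos, rfl⟩
    rwa [(h.rank_label hpos).1] at h2

theorem integrable_dust (μ : Measure (TypedPartition k ℕ)) [IsFiniteMeasure μ] :
    Integrable (fun π => π.rank.dust) μ := by
  refine Integrable.of_bound
    (MassPartition.measurable_dust.comp measurable_rank).aestronglyMeasurable 1
    (ae_of_all _ fun π => ?_)
  rw [Real.norm_of_nonneg π.rank.dust_nonneg, MassPartition.dust, sub_le_self_iff]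
  exact tsum_nonneg π.rank.nonneg

/-- The mean of the frequency of the blocks above a threshold is at most the mean of `1 - dust`. The
threshold `1 / (r + 1)` then decreases to zero. -/
theorem measure_freq_pos_le (hμ : ExchangeableOff F μ) {b : ℕ} (hb : b ∉ F) :
    μ.real ({π | π.HasFrequencies} ∩ {π | 0 < freq (π.block b)}) ≤
      ∫ π, (1 - π.rank.dust) ∂μ := by
  have hε : ∀ r : ℕ, (0 : ℝ) < 1 / ((r : ℝ) + 1) := fun r => by positivity
  have hle : ∀ r : ℕ, μ.real ({π | π.HasFrequencies} ∩ {π | 1 / ((r : ℝ) + 1) ≤ freq (π.block b)}) ≤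
      ∫ π, (1 - π.rank.dust) ∂μ := by
    intro r
    obtain ⟨h1, h2⟩ := hμ.integral_frequency (equivariant_le_freq F (1 / ((r : ℝ) + 1)))
      (L := fun π => ∑ n ∈ (π.rank.finite_le_mass (hε r)).toFinset, π.rank.mass n) (by
        filter_upwards [hμ.ae_hasFrequencies] with π hπ
        convert hπ.hasFrequency_le_freq (hε r) using 1
        ext c
        exact ⟨fun h => h.2, fun h => ⟨hπ, h⟩⟩) hb
    rw [← h2]
    refine integral_mono h1 ((integrable_const 1).sub (integrable_dust μ)) fun π => ?_
    simp only [MassPartition.dust, sub_sub_cancel]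
    exact π.rank.summable.sum_le_tsum _ fun n _ => π.rank.nonneg n
  have hU : {π : TypedPartition k ℕ | π.HasFrequencies} ∩ {π | 0 < freq (π.block b)} =
      ⋃ r : ℕ, {π | π.HasFrequencies} ∩ {π | 1 / ((r : ℝ) + 1) ≤ freq (π.block b)} := by
    rw [← Set.inter_iUnion]
    congr 1
    ext π
    simp only [Set.mem_ofPred_eq, Set.mem_iUnion]
    exact ⟨fun h => (exists_nat_one_div_lt h).imp fun _ => le_of_lt,
      fun ⟨r, hr⟩ => (hε r).trans_le hr⟩
  have hmono : Monotone fun r : ℕ =>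
      {π : TypedPartition k ℕ | π.HasFrequencies} ∩ {π | 1 / ((r : ℝ) + 1) ≤ freq (π.block b)} := by
    intro r s hrs
    refine Set.inter_subset_inter_right _ fun π hπ => ?_
    refine le_trans ?_ (show 1 / ((r : ℝ) + 1) ≤ freq (π.block b) from hπ)
    exact one_div_le_one_div_of_le (by positivity) (by gcongr)
  have hlim := tendsto_measure_iUnion_atTop (μ := μ) hmono
  rw [← hU] at hlim
  exact le_of_tendsto' ((ENNReal.tendsto_toReal (measure_ne_top _ _)).comp hlim) hle

/-- For the dust: the singletons have frequency at most `dust`, so equality of means suffices. An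
integer `C` off `F` is almost surely a singleton, whose measure is the mean singleton frequency, or
in a block of positive frequency, whose measure is at most the mean of `1 - dust`. Together these
have full mass. -/
theorem ae_isGeneric (hμ : ExchangeableOff F μ) : ∀ᵐ π ∂μ, π.IsGeneric F := by
  obtain ⟨C, hC⟩ := exists_forall_notMem F
  have hCF : C ∉ F := hC C le_rfl
  have hS : ∀ᵐ π ∂μ, HasFrequency {a | π.typ a = 0} (freq {a | π.typ a = 0}) := by
    filter_upwards [hμ.ae_exists_hasFrequency (equivariant_typ F)] with π hπ
    obtain ⟨y, hy⟩ := hπ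
    have hy' : HasFrequency {a | π.typ a = 0} y := hy
    rwa [hy'.freq_eq]
  obtain ⟨hint, hval⟩ := hμ.integral_frequency (equivariant_typ F) hS hCF
  have hle : ∀ᵐ π ∂μ, 0 ≤ π.rank.dust - freq {a | π.typ a = 0} := by
    filter_upwards [hμ.ae_hasFrequencies, hS] with π h1 h2
    exact sub_nonneg.2 (h1.le_dust h2)
  have htot : μ.real Set.univ ≤ μ.real {π | π.typ C = 0} +
      μ.real ({π | π.HasFrequencies} ∩ {π | 0 < freq (π.block C)}) := by
    refine le_trans ?_ (measureReal_union_le _ _)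
    rw [measureReal_def, measureReal_def]
    refine ENNReal.toReal_mono (measure_ne_top _ _) (measure_mono_ae ?_)
    filter_upwards [hμ.ae_hasFrequencies, hμ.ae_freq_pos] with π h1 h2 _
    by_cases h : π.typ C = 0
    · exact Or.inl h
    · exact Or.inr ⟨h1, h2 C hCF h⟩
  have hzero : ∫ π, (π.rank.dust - freq {a | π.typ a = 0}) ∂μ = 0 := by
    refine le_antisymm ?_ (integral_nonneg_of_ae hle)
    have h1 := hμ.measure_freq_pos_le hCF
    rw [integral_sub (integrable_const 1) (integrable_dust μ)] at h1
    rw [integral_sub (integrable_dust μ) hint, hval]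
    simp only [integral_const, smul_eq_mul, mul_one] at h1
    linarith
  have hae := (integral_eq_zero_iff_of_nonneg_ae hle ((integrable_dust μ).sub hint)).1 hzero
  filter_upwards [hμ.ae_hasFrequencies, hμ.ae_freq_pos, hS, hae] with π h1 h2 h3 h4
  refine ⟨h1, h2, ?_⟩
  have : π.rank.dust - freq {a | π.typ a = 0} = 0 := h4
  rwa [sub_eq_zero.1 this]

/-- Outside `F`, the partition is distributed as a mixture of paintboxes. -/
theorem lintegral_paintbox_le (hμ : ExchangeableOff F μ) {n : ℕ} (hn : ∀ a ∈ F, n ≤ a)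
    {A : Set (TypedPartition k ℕ)} (hA : Determined n A) :
    ∫⁻ π, paintbox π.rank A ∂μ ≤ μ A := by
  obtain ⟨C, hC⟩ := exists_forall_notMem F
  -- Since `F` lies at or beyond `n` and below `C`, neither the first `n` integers nor the windows
  -- meet it. The windows are disjoint, which division by `N` detects.
  have hσ : ∀ (N : ℕ) (m : Fin n → Fin N), ∃ σ : Equiv.Perm ℕ, {m | σ m ≠ m}.Finite ∧
      (∀ a ∈ F, σ a = a) ∧ ∀ l : Fin n, σ l = C + l * N + m l := by
    intro N m
    obtain ⟨σ, h1, h2, h3⟩ := exists_perm_extending F n (f := id)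
      (g := fun l => if h : l < n then C + l * N + m ⟨l, h⟩ else 0) (Set.injOn_id _) (by
        intro l hl l' hl' e
        simp only [Set.mem_Iio] at hl hl'
        simp only [hl, hl', dif_pos] at e
        have b1 := (m ⟨l, hl⟩).2
        have b2 := (m ⟨l', hl'⟩).2
        have e' : N * l + m ⟨l, hl⟩ = N * l' + m ⟨l', hl'⟩ := by
          rw [mul_comm N l, mul_comm N l']; omega
        have e1 := congrArg (· / N) e'
        have hN : 0 < N := by omega
        simpa [Nat.mul_add_div hN, Nat.div_eq_of_lt b1, Nat.div_eq_of_lt b2] using e1)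
      (fun a ha h => by have := hn a h; omega) (fun l hl => by
        rw [dif_pos hl]
        exact hC _ (by rw [add_assoc]; exact Nat.le_add_right _ _))
    exact ⟨σ, h1, h2, fun l => by simpa using h3 l l.2⟩
  choose σ h1 h2 h3 using hσ
  have hmeas : ∀ N m, Measurable fun π : TypedPartition k ℕ =>
      A.indicator (1 : TypedPartition k ℕ → ℝ≥0∞) (π.permute (σ N m)) := fun N m =>
    (measurable_one.indicator hA.measurableSet).comp (measurable_permute _)
  calc ∫⁻ π, paintbox π.rank A ∂μ ≤ ∫⁻ π, liminf (fun N : ℕ => (∑ m : Fin n → Fin N,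
        A.indicator (1 : TypedPartition k ℕ → ℝ≥0∞) (π.permute (σ N m))) /
          (N : ℝ≥0∞) ^ n) atTop ∂μ := by
        refine lintegral_mono_ae ?_
        filter_upwards [hμ.ae_isGeneric] with π hπ
        refine hπ.paintbox_le_liminf hA C (fun N m l hl => ?_) h3
        rw [h3 N m ⟨l, hl⟩]
        exact hC _ (by rw [add_assoc]; exact Nat.le_add_right _ _)
    _ ≤ liminf (fun N : ℕ => ∫⁻ π, (∑ m : Fin n → Fin N,
        A.indicator (1 : TypedPartition k ℕ → ℝ≥0∞) (π.permute (σ N m))) /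
          (N : ℝ≥0∞) ^ n ∂μ) atTop :=
        lintegral_liminf_le fun N => (Finset.measurable_sum _ fun m _ => hmeas N m).div_const _
    -- Each of the `N ^ n` permutations preserves `μ`, so for `N > 0` the average equals `μ A`.
    _ = liminf (fun _ : ℕ => μ A) atTop := by
        refine liminf_congr ?_
        filter_upwards [eventually_gt_atTop 0] with N hN
        simp only [div_eq_mul_inv]
        rw [lintegral_mul_const _ (Finset.measurable_sum _ fun m _ => hmeas N m),
          lintegral_finsetSum _ fun m _ => hmeas N m]
        have : ∀ m, ∫⁻ π, A.indicator (1 : TypedPartition k ℕ → ℝ≥0∞) (π.permute (σ N m)) ∂μ =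
            μ A := fun m => by
          rw [(hμ (σ N m) (h1 N m) (h2 N m)).lintegral_comp
            (measurable_one.indicator hA.measurableSet), lintegral_indicator_one hA.measurableSet]
        simp only [this]
        rw [Finset.sum_const, Finset.card_univ, Fintype.card_fun, Fintype.card_fin,
          Fintype.card_fin, nsmul_eq_mul, mul_comm, ← mul_assoc]
        push_cast
        rw [ENNReal.inv_mul_cancel (by positivity) (by finiteness), one_mul]
    _ = μ A := liminf_const _

/-- The inequality holds for `A` and for its complement, and the two sides have the same finite
total. -/
theorem lintegral_paintbox_eq (hμ : ExchangeableOff F μ) {n : ℕ} (hn : ∀ a ∈ F, n ≤ a)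
    {A : Set (TypedPartition k ℕ)} (hA : Determined n A) :
    ∫⁻ π, paintbox π.rank A ∂μ = μ A := by
  have h1 := hμ.lintegral_paintbox_le hn hA
  have h2 := hμ.lintegral_paintbox_le hn hA.compl
  have hm : Measurable fun π : TypedPartition k ℕ => paintbox π.rank A :=
    (Measure.measurable_coe hA.measurableSet).comp (measurable_paintbox.comp measurable_rank)
  have h3 : ∫⁻ π, paintbox π.rank A ∂μ + ∫⁻ π, paintbox π.rank Aᶜ ∂μ = μ A + μ Aᶜ := by
    rw [← lintegral_add_left hm, measure_add_measure_compl hA.measurableSet]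
    simp only [measure_add_measure_compl hA.measurableSet, measure_univ, lintegral_one]
  refine le_antisymm h1 ?_
  have h4 : μ Aᶜ ≠ ∞ := measure_ne_top _ _
  refine (ENNReal.add_le_add_iff_right h4).1 ?_
  rw [← h3]
  gcongr

end ExchangeableOff

end

/-! ### The infinite measure: localisation, dislocation, erosion and the converse -/

noncomputable section

variable {k : ℕ} {i : Fin (k + 1)} {hi : i ≠ 0} {μ : Measure (TypedPartition k ℕ)}

open TypedPartition

/-! ### Splitting sets -/

namespace TypedPartition

theorem splitSet_determined {a b : ℕ} (hab : a ≠ b) :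
    Determined (k := k) (max a b + 1) (splitSet i a b) := by
  intro π π' e h
  rw [mem_splitSet] at *
  refine fun h' => h ⟨(rel_iff_of_restrict_eq e (by omega) (by omega)).2 h'.1, ?_⟩
  rw [← h'.2]
  exact typ_eq_of_restrict_eq e (a := a) (b := b) (by omega) (by omega) hab.symm
    ((rel_iff_of_restrict_eq e (by omega) (by omega)).2 h'.1)

theorem eq_single_of_forall {π : TypedPartition k ℕ}
    (h : ∀ a b, a ≠ b → π ∉ splitSet i a b) : π = single ℕ i hi := by
  have h' : ∀ a b, a ≠ b → π.rel a b ∧ π.typ a = i := fun a b hab => by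
    simpa [mem_splitSet] using h a b hab
  ext a b
  · refine iff_of_true ?_ trivial
    by_cases hab : a = b
    · rw [hab]
    · exact (h' a b hab).1
  · exact congrArg Fin.val (h' a (a + 1) (by omega)).2

theorem eq_erode_of_forall {π : TypedPartition k ℕ} {n : ℕ}
    (h1 : ∀ x y, x ≠ n → y ≠ n → π.rel x y ∧ π.typ x = i) (h2 : ∀ x, x ≠ n → ¬ π.rel n x) :
    π = erode n i hi := by
  have hrel : ∀ a b, π.rel a b ↔ (a = n ↔ b = n) := fun a b => by
    by_cases ha : a = n <;> by_cases hb : b = n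
    · rw [ha, hb]; exact iff_of_true (π.rel.refl n) Iff.rfl
    · exact iff_of_false (ha ▸ h2 b hb) fun h => hb (h.1 ha)
    · exact iff_of_false (fun h => h2 a ha (hb ▸ π.rel.symm h)) fun h => ha (h.2 hb)
    · exact iff_of_true (h1 a b ha hb).1 (iff_of_false ha hb)
  ext a b
  · exact hrel a b
  · refine congrArg Fin.val ?_
    change π.typ a = if a = n then 0 else i
    split_ifs with ha
    · rw [typ_eq_zero_iff]
      exact fun b hb => (((hrel a b).1 hb).1 ha).trans ha.symm
    · exact (h1 a a ha ha).2

theorem permute_erode (σ : Equiv.Perm ℕ) (n : ℕ) :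
    (erode n i hi).permute σ = erode (σ.symm n) i hi := by
  have h : ∀ a, σ a = n ↔ a = σ.symm n := fun a => σ.eq_symm_apply.symm
  ext a b
  · change (σ a = n ↔ σ b = n) ↔ (a = σ.symm n ↔ b = σ.symm n)
    rw [h, h]
  · rw [permute_typ]
    change ((if σ a = n then 0 else i : Fin (k + 1)) : ℕ) = (if a = σ.symm n then 0 else i : _)
    simp only [h]

theorem erode_injective : Function.Injective fun n => erode n i hi := by
  intro m n h
  have := congrArg (fun π : TypedPartition k ℕ => π.typ m) h
  have h' : (if m = m then 0 else i) = if m = n then 0 else i := this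
  rw [if_pos rfl] at h'
  by_contra hne
  rw [if_neg hne] at h'
  exact hi h'.symm

theorem erode_mem_splitSet (n : ℕ) : erode n i hi ∈ splitSet i n (n + 1) := by
  rw [mem_splitSet]
  rintro ⟨h, -⟩
  have h' : n = n ↔ n + 1 = n := h
  omega

theorem erode_notMem_splitSet {n a b : ℕ} (ha : a ≠ n) (hb : b ≠ n) :
    erode n i hi ∉ splitSet i a b := by
  rw [mem_splitSet, not_not]
  exact ⟨show (a = n ↔ b = n) from iff_of_false ha hb, if_neg ha⟩

end TypedPartition

namespace Exchangeable

/-- Localisation: a set described by the integers of `F` is preserved by the permutations fixing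
`F`. With `E` of finite measure, the results on finite measures apply. -/
theorem exchangeableOff_restrict (hμ : Exchangeable μ) {F : Finset ℕ}
    {E : Set (TypedPartition k ℕ)} (hE : MeasurableSet E)
    (h : ∀ σ : Equiv.Perm ℕ, {n | σ n ≠ n}.Finite → (∀ a ∈ F, σ a = a) →
      permute σ ⁻¹' E = E) : ExchangeableOff F (μ.restrict E) := fun σ hσ hF => by
  have := (hμ σ hσ).restrict_preimage hE
  rwa [h σ hσ hF] at this

/-- A family of measurable sets indexed by pairs of integers that are permuted with them has
constant measure. -/
theorem measure_eq_of_pair (hμ : Exchangeable μ) {P : ℕ → ℕ → Set (TypedPartition k ℕ)}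
    (hP : ∀ a b, MeasurableSet (P a b))
    (h : ∀ (σ : Equiv.Perm ℕ) (a b : ℕ), permute σ ⁻¹' P a b = P (σ a) (σ b)) {a b c d : ℕ}
    (hab : a ≠ b) (hcd : c ≠ d) : μ (P a b) = μ (P c d) := by
  have hinj : ∀ u v : ℕ, u ≠ v → Set.InjOn (fun l => if l = 0 then u else v) (Set.Iio 2) := by
    intro u v huv l hl l' hl' e
    simp only [Set.mem_Iio] at hl hl'
    interval_cases l <;> interval_cases l' <;> simp_all
  obtain ⟨σ, h1, -, h3⟩ := exists_perm_extending ∅ 2 (hinj a b hab) (hinj c d hcd)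
    (by simp) (by simp)
  have e0 : σ a = c := h3 0 two_pos
  have e1 : σ b = d := h3 1 one_lt_two
  rw [← (hμ σ h1).measure_preimage (hP a b).nullMeasurableSet, h, e0, e1]

theorem measure_splitSet_lt_top (hμ : Exchangeable μ) (hs : SplittingCondition i hi μ) {a b : ℕ}
    (hab : a ≠ b) : μ (splitSet i a b) < ∞ := by
  have := hs.2
  rw [splitSet_eq hi] at this
  rwa [hμ.measure_eq_of_pair (measurableSet_splitSet i)
    (fun σ a b => by ext π; exact permute_mem_splitSet) hab zero_ne_one]

/-- The sets `splitSet i a b` miss only the partition `single ℕ i hi`, which is null. -/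
theorem _root_.ae_of_ae_splitSet (hs : μ {single ℕ i hi} = 0) {p : TypedPartition k ℕ → Prop}
    (h : ∀ a b, a ≠ b → ∀ᵐ π ∂μ.restrict (splitSet i a b), p π) : ∀ᵐ π ∂μ, p π := by
  have h' : ∀ᵐ π ∂μ, ∀ a b, a ≠ b → π ∈ splitSet i a b → p π := by
    simp only [ae_all_iff]
    exact fun a b hab => (ae_restrict_iff' (measurableSet_splitSet i a b)).1 (h a b hab)
  filter_upwards [h', measure_eq_zero_iff_ae_notMem.1 hs] with π h1 h2
  by_contra hp
  exact h2 (eq_single_of_forall fun a b hab hm => hp (h1 a b hab hm))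

theorem ae_hasFrequencies (hμ : Exchangeable μ) (hs : SplittingCondition i hi μ) :
    ∀ᵐ π ∂μ, π.HasFrequencies := by
  refine ae_of_ae_splitSet hs.1 fun a b hab => ?_
  have : IsFiniteMeasure (μ.restrict (splitSet i a b)) :=
    ⟨by simpa using hμ.measure_splitSet_lt_top hs hab⟩
  refine ExchangeableOff.ae_hasFrequencies (F := {a, b})
    (hμ.exchangeableOff_restrict (measurableSet_splitSet i a b) fun σ _ hF => ?_)
  ext π
  rw [Set.mem_preimage, permute_mem_splitSet, hF a (by simp), hF b (by simp)]

/-! ### The dislocation measure -/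

theorem _root_.measurableSet_rank_ne (x : MassPartition k) :
    MeasurableSet {π : TypedPartition k ℕ | π.rank ≠ x} :=
  (measurable_rank (measurableSet_singleton x)).compl

theorem _root_.measurableSet_rank_eq (x : MassPartition k) :
    MeasurableSet {π : TypedPartition k ℕ | π.rank = x} :=
  measurable_rank (measurableSet_singleton x)

theorem _root_.lintegral_dislocationMeasure (hi : i ≠ 0) (μ : Measure (TypedPartition k ℕ))
    {g : MassPartition k → ℝ≥0∞} (hg : Measurable g) :
    ∫⁻ x, g x ∂(dislocationMeasure i hi μ) =
      ∫⁻ π in {π | π.rank ≠ MassPartition.one i hi}, g π.rank ∂μ := by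
  have hone : MeasurableSet {x | x ≠ MassPartition.one i hi} :=
    (measurableSet_singleton (MassPartition.one i hi)).compl
  rw [dislocationMeasure, Measure.restrict_map measurable_rank hone,
    lintegral_map hg measurable_rank]
  rfl

theorem _root_.bind_paintbox_apply (ν : Measure (MassPartition k)) {E : Set (TypedPartition k ℕ)}
    (hE : MeasurableSet E) : ν.bind paintbox E = ∫⁻ x, paintbox x E ∂ν :=
  Measure.bind_apply hE measurable_paintbox.aemeasurable

theorem _root_.measurable_paintbox_apply {E : Set (TypedPartition k ℕ)} (hE : MeasurableSet E) :
    Measurable fun x : MassPartition k => paintbox x E :=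
  (Measure.measurable_coe hE).comp measurable_paintbox

/-- The set `{rank ≠ one}` is exhausted by the events `D N` that two integers of `[n, n + N)` are
split: if no pair beyond `n` is split, the block of `n` is cofinite of type `i` and the rank is
`one`. The event `D N` has finite measure and only restricts permutations on `[n, n + N)`, so the
paintbox formula holds there for events determined by the first `n` integers. -/
theorem bind_dislocationMeasure_of_determined (hμ : Exchangeable μ)
    (hs : SplittingCondition i hi μ) {n : ℕ} {E : Set (TypedPartition k ℕ)}
    (hE : Determined n E) : (dislocationMeasure i hi μ).bind paintbox E =
      μ.restrict {π | π.rank ≠ MassPartition.one i hi} E := by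
  set A := {π : TypedPartition k ℕ | π.rank ≠ MassPartition.one i hi}
  have hA : MeasurableSet A := measurableSet_rank_ne _
  set f : TypedPartition k ℕ → ℝ≥0∞ := fun π => paintbox π.rank E
  have hEm := hE.measurableSet
  rw [bind_paintbox_apply _ hEm, lintegral_dislocationMeasure hi μ (measurable_paintbox_apply hEm),
    Measure.restrict_apply hEm]
  set D : ℕ → Set (TypedPartition k ℕ) := fun N =>
    ⋃ a ∈ Finset.Ico n (n + N), ⋃ b ∈ Finset.Ico n (n + N), ⋃ _ : a ≠ b, splitSet i a b
  have hmemD : ∀ N π, π ∈ D N ↔ ∃ a ∈ Finset.Ico n (n + N), ∃ b ∈ Finset.Ico n (n + N), a ≠ b ∧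
      π ∈ splitSet i a b := fun N π => by
    simp only [D, Set.mem_iUnion, exists_prop]
  have hDm : ∀ N, MeasurableSet (D N) := fun N =>
    Finset.measurableSet_biUnion _ fun a _ => Finset.measurableSet_biUnion _ fun b _ =>
      MeasurableSet.iUnion fun _ => measurableSet_splitSet i a b
  have hDfin : ∀ N, μ (D N) < ∞ := fun N =>
    measure_biUnion_lt_top (Finset.finite_toSet _) fun a _ =>
      measure_biUnion_lt_top (Finset.finite_toSet _) fun b _ => by
        by_cases hab : a ≠ b
        · simpa [hab] using hμ.measure_splitSet_lt_top hs hab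
        · simp [hab]
  have hDmono : Monotone D := fun M N hMN π hπ => by
    rw [hmemD] at *
    obtain ⟨a, ha, b, hb, h⟩ := hπ
    simp only [Finset.mem_Ico] at *
    exact ⟨a, by omega, b, by omega, h⟩
  have hDA : A ∩ ⋃ N, D N = A := by
    refine Set.inter_eq_left.2 fun π hπ => ?_
    by_contra hnot
    simp only [Set.mem_iUnion, hmemD, not_exists, not_and] at hnot
    have hall : ∀ a b, n ≤ a → n ≤ b → a ≠ b → π.rel a b ∧ π.typ a = i := fun a b ha hb hab => by
      have := hnot (max a b + 1) a (by simp; omega) b (by simp; omega) hab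
      simpa [mem_splitSet] using this
    refine hπ (rank_of_cofinite (a := n) hi ?_ (hall n (n + 1) le_rfl (by omega) (by omega)).2).2
    refine (Set.finite_Iio n).subset fun b hb => ?_
    by_contra hbn
    refine hb ?_
    by_cases hbn' : b = n
    · rw [hbn']; exact π.self_mem_block n
    · exact (hall b n (not_lt.1 hbn) le_rfl hbn').1
  have key : ∀ N, ∫⁻ π in A ∩ D N, f π ∂μ = μ (E ∩ (A ∩ D N)) := fun N => by
    have : IsFiniteMeasure (μ.restrict (A ∩ D N)) :=
      ⟨by simpa using (measure_mono Set.inter_subset_right).trans_lt (hDfin N)⟩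
    have hexch : ExchangeableOff (Finset.Ico n (n + N)) (μ.restrict (A ∩ D N)) := by
      refine hμ.exchangeableOff_restrict (hA.inter (hDm N)) fun σ hσ hF => ?_
      ext π
      refine and_congr ?_ ?_
      · change (π.permute σ).rank ≠ _ ↔ π.rank ≠ _
        rw [rank_permute π hσ]
      · rw [hmemD, hmemD]
        refine exists_congr fun a => and_congr_right fun ha => exists_congr fun b =>
          and_congr_right fun hb => and_congr_right fun _ => ?_
        rw [permute_mem_splitSet, hF a ha, hF b hb]
    rw [hexch.lintegral_paintbox_eq (fun a ha => (Finset.mem_Ico.1 ha).1) hE,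
      Measure.restrict_apply hEm]
  have hmonoA : Monotone fun N => A ∩ D N := fun M N h => Set.inter_subset_inter_right _ (hDmono h)
  -- The passage to the limit is continuity from below for the two measures `μ.withDensity f` and
  -- `μ.restrict E`.
  have hlim1 := tendsto_measure_iUnion_atTop (μ := μ.withDensity f) hmonoA
  have hlim2 := tendsto_measure_iUnion_atTop (μ := μ.restrict E) hmonoA
  rw [← Set.inter_iUnion, hDA] at hlim1 hlim2
  simp only [Function.comp_def, withDensity_apply _ (hA.inter (hDm _)),
    Measure.restrict_apply (hA.inter (hDm _)), withDensity_apply _ hA, Measure.restrict_apply hA,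
    key] at hlim1 hlim2
  rw [Set.inter_comm E A]
  refine tendsto_nhds_unique hlim1 (hlim2.congr fun N => ?_)
  rw [Set.inter_comm]

/-- Uniqueness on a π-system with a countable cover of finite measure: the sets `splitSet i a b`,
themselves determined, and the point `single ℕ i hi`. This point belongs to no other set of the
cover, and is null for both measures. -/
theorem restrict_eq_bind (hμ : Exchangeable μ) (hs : SplittingCondition i hi μ) :
    μ.restrict {π | π.rank ≠ MassPartition.one i hi} =
      (dislocationMeasure i hi μ).bind paintbox := by
  have hsingle : (dislocationMeasure i hi μ).bind paintbox {single ℕ i hi} = 0 := by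
    rw [bind_paintbox_apply _ (measurableSet_singleton _),
      lintegral_dislocationMeasure hi μ (measurable_paintbox_apply (measurableSet_singleton _)),
      setLIntegral_congr_fun (g := fun _ => 0) (measurableSet_rank_ne _)
        fun π hπ => paintbox_single hi hπ]
    simp
  have hsingle' : μ.restrict {π | π.rank ≠ MassPartition.one i hi} {single ℕ i hi} = 0 :=
    le_antisymm ((Measure.restrict_apply_le _ _).trans hs.1.le) zero_le
  have hdet : ∀ E ∈ {A : Set (TypedPartition k ℕ) | ∃ n, Determined n A},
      μ.restrict {π | π.rank ≠ MassPartition.one i hi} E =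
        (dislocationMeasure i hi μ).bind paintbox E := by
    rintro E ⟨n, hE⟩
    exact (hμ.bind_dislocationMeasure_of_determined hs hE).symm
  refine Measure.ext_of_generateFrom_of_cover
    (T := insert {single ℕ i hi} (Set.range fun p : {p : ℕ × ℕ // p.1 ≠ p.2} =>
      splitSet i p.1.1 p.1.2))
    generateFrom_determined ((Set.countable_range _).insert _) isPiSystem_determined ?_ ?_ ?_ ?_
  · refine Set.eq_univ_of_forall fun π => ?_
    by_cases h : ∀ a b, a ≠ b → π ∉ splitSet i a b
    · exact ⟨_, Set.mem_insert _ _, eq_single_of_forall h⟩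
    · push Not at h
      obtain ⟨a, b, hab, hm⟩ := h
      exact ⟨_, Set.mem_insert_of_mem _ ⟨⟨(a, b), hab⟩, rfl⟩, hm⟩
  · rintro t (rfl | ⟨⟨⟨a, b⟩, hab⟩, rfl⟩)
    · rw [hsingle']; exact ENNReal.zero_ne_top
    · exact ((Measure.restrict_apply_le _ _).trans_lt (hμ.measure_splitSet_lt_top hs hab)).ne
  · rintro t (rfl | ⟨⟨⟨a, b⟩, hab⟩, rfl⟩) E hE
    · rw [measure_mono_null Set.inter_subset_right hsingle,
        measure_mono_null Set.inter_subset_right hsingle']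
    · obtain ⟨n, hE⟩ := hE
      exact hdet _ ⟨max n (max a b + 1), (hE.mono (le_max_left _ _)).inter
        ((splitSet_determined hab).mono (le_max_right _ _))⟩
  · rintro t (rfl | ⟨⟨⟨a, b⟩, hab⟩, rfl⟩)
    · rw [hsingle, hsingle']
    · exact hdet _ ⟨_, splitSet_determined hab⟩

theorem dislocationCondition (hμ : Exchangeable μ) (hs : SplittingCondition i hi μ) :
    DislocationCondition i (dislocationMeasure i hi μ) := by
  have hm := measurableSet_splitSet (k := k) i 0 1
  calc ∫⁻ x, defect i x ∂(dislocationMeasure i hi μ)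
      ≤ ∫⁻ x, 2 * paintbox x (splitSet i 0 1) ∂(dislocationMeasure i hi μ) :=
        lintegral_mono fun x => defect_le hi x
    _ = 2 * μ.restrict {π | π.rank ≠ MassPartition.one i hi} (splitSet i 0 1) := by
        rw [lintegral_const_mul _ (measurable_paintbox_apply hm), ← bind_paintbox_apply _ hm,
          hμ.restrict_eq_bind hs]
    _ ≤ 2 * μ (splitSet i 0 1) := by
        gcongr
        exact Measure.restrict_le_self
    _ < ∞ := ENNReal.mul_lt_top ENNReal.ofNat_lt_top (hμ.measure_splitSet_lt_top hs zero_ne_one)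

/-! ### Erosion -/

/-- On this piece `μ` is finite and exchangeable off `{a, b}`. The rank has no dust and a single
positive mass, so every integer other than `a` and `b` lies in the one block of positive frequency,
which has type `i`. -/
theorem ae_cofinite_of_rank_eq (hμ : Exchangeable μ) (hs : SplittingCondition i hi μ) :
    ∀ᵐ π ∂μ, π.rank = MassPartition.one i hi → ∀ a b, a ≠ b → π ∈ splitSet i a b →
      ∀ c d, c ≠ a → c ≠ b → d ≠ a → d ≠ b → π.rel c d ∧ π.typ c = i := by
  have hB := measurableSet_rank_eq (MassPartition.one i hi)
  have key : ∀ a b, a ≠ b → ∀ᵐ π ∂μ.restrict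
      (splitSet i a b ∩ {π | π.rank = MassPartition.one i hi}),
      ∀ c d, c ≠ a → c ≠ b → d ≠ a → d ≠ b → π.rel c d ∧ π.typ c = i := by
    intro a b hab
    have hE := (measurableSet_splitSet i a b).inter hB
    set μ' := μ.restrict (splitSet i a b ∩ {π | π.rank = MassPartition.one i hi})
    have : IsFiniteMeasure μ' := by
      refine ⟨?_⟩
      rw [Measure.restrict_apply_univ]
      exact (measure_mono Set.inter_subset_left).trans_lt (hμ.measure_splitSet_lt_top hs hab)
    have hexch : ExchangeableOff {a, b} μ' := by
      refine hμ.exchangeableOff_restrict hE fun σ hσ hF => ?_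
      ext π
      refine and_congr ?_ ?_
      · rw [permute_mem_splitSet, hF a (by simp), hF b (by simp)]
      · change (π.permute σ).rank = _ ↔ π.rank = _
        rw [rank_permute π hσ]
    have hrank : ∀ᵐ π ∂μ', π.rank = MassPartition.one i hi := by
      filter_upwards [ae_restrict_mem hE] with π hπ using hπ.2
    have hdust : (MassPartition.one i hi).dust = 0 := by
      rw [MassPartition.dust, sub_eq_zero]
      exact (tsum_ite_eq 0 (fun _ => (1 : ℝ))).symm
    have hgen := hexch.ae_isGeneric
    -- The singletons have frequency zero, so the event that a given integer off `{a, b}` is one of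
    -- them is null.
    have htyp : ∀ᵐ π ∂μ', ∀ c, c ≠ a → c ≠ b → π.typ c ≠ 0 := by
      simp only [ae_all_iff]
      intro c hca hcb
      have h0 := (hexch.integral_frequency (ExchangeableOff.equivariant_typ {a, b})
        (L := fun _ => 0) (b := c) (by
          filter_upwards [hrank, hgen] with π h1 h2
          have := h2.hasFrequency_dust
          rwa [h1, hdust] at this) (by simp [hca, hcb])).2
      rw [integral_zero] at h0
      exact measure_eq_zero_iff_ae_notMem.1 ((measureReal_eq_zero_iff).1 h0.symm)
    filter_upwards [hrank, hgen, htyp] with π h1 h2 h3 c d hca hcb hda hdb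
    have hlab : ∀ c, c ≠ a → c ≠ b → 0 < freq (π.block c) ∧ π.label c = 0 ∧ π.typ c = i := by
      intro c hca hcb
      have hpos := h2.freq_pos c (by simp [hca, hcb]) (h3 c hca hcb)
      obtain ⟨e1, e2⟩ := h2.hasFrequencies.rank_label hpos
      rw [h1] at e1 e2
      have h0 : π.label c = 0 := by
        by_contra hne
        have : (MassPartition.one i hi).mass (π.label c) = 0 := if_neg hne
        rw [this] at e1
        exact hpos.ne e1
      refine ⟨hpos, h0, ?_⟩
      rw [← e2, h0]
      rfl
    obtain ⟨p1, l1, t1⟩ := hlab c hca hcb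
    obtain ⟨p2, l2, -⟩ := hlab d hda hdb
    exact ⟨(h2.hasFrequencies.label_eq_iff p1 p2).1 (l1.trans l2.symm), t1⟩
  have : ∀ᵐ π ∂μ, ∀ a b, a ≠ b → π ∈ splitSet i a b ∩ {π | π.rank = MassPartition.one i hi} →
      ∀ c d, c ≠ a → c ≠ b → d ≠ a → d ≠ b → π.rel c d ∧ π.typ c = i := by
    simp only [ae_all_iff (ι := ℕ), ae_all_iff (ι := _ ≠ _)]
    refine fun a b hab => (ae_restrict_iff' ((measurableSet_splitSet i a b).inter hB)).1 ?_
    exact key a b hab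
  filter_upwards [this] with π h hr a b hab hm
  exact h a b hab ⟨hm, hr⟩

/-- All the integers except `a` and `b` form a block of type `i`, possibly with one of `a`, `b`
related to the other, but with none of them in the big block. -/
def _root_.twoExceptions (i : Fin (k + 1)) (a b : ℕ) : Set (TypedPartition k ℕ) :=
  {π | ∀ c, c ≠ a → c ≠ b → (¬ π.rel a c ∧ ¬ π.rel b c) ∧
    ∀ d, d ≠ a → d ≠ b → π.rel c d ∧ π.typ c = i}

theorem _root_.measurableSet_twoExceptions (a b : ℕ) :
    MeasurableSet (twoExceptions i a b) := by
  simp only [twoExceptions, Set.ofPred_forall, Set.ofPred_and]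
  exact MeasurableSet.iInter fun c => MeasurableSet.iInter fun _ => MeasurableSet.iInter fun _ =>
    ((measurableSet_rel a c).compl.inter (measurableSet_rel b c).compl).inter
      (MeasurableSet.iInter fun d => MeasurableSet.iInter fun _ => MeasurableSet.iInter fun _ =>
        (measurableSet_rel c d).inter (measurable_typ c (measurableSet_singleton i)))

theorem _root_.permute_preimage_twoExceptions (σ : Equiv.Perm ℕ) (a b : ℕ) :
    permute σ ⁻¹' twoExceptions i a b = twoExceptions i (σ a) (σ b) := by
  ext π
  simp only [Set.mem_preimage, twoExceptions, Set.mem_ofPred_eq, permute_rel, permute_typ]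
  constructor
  · intro h c hca hcb
    have := h (σ.symm c) (fun e => hca (by rw [← e, σ.apply_symm_apply]))
      (fun e => hcb (by rw [← e, σ.apply_symm_apply]))
    rw [σ.apply_symm_apply] at this
    refine ⟨this.1, fun d hda hdb => ?_⟩
    have := this.2 (σ.symm d) (fun e => hda (by rw [← e, σ.apply_symm_apply]))
      (fun e => hdb (by rw [← e, σ.apply_symm_apply]))
    rwa [σ.apply_symm_apply] at this
  · intro h c hca hcb
    have := h (σ c) (σ.injective.ne hca) (σ.injective.ne hcb)
    exact ⟨this.1, fun d hda hdb => this.2 (σ d) (σ.injective.ne hda) (σ.injective.ne hdb)⟩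

/-- The events for the pairs `0, m + 2` are pairwise disjoint, equally likely, and contained in
`splitSet i 0 1`, which has finite measure. The shift by `2` keeps `1` in the big block, where it is
split from `0`. -/
theorem measure_twoExceptions (hμ : Exchangeable μ) (hs : SplittingCondition i hi μ) {a b : ℕ}
    (hab : a ≠ b) : μ (twoExceptions i a b) = 0 := by
  have hconst : ∀ {a b c d : ℕ}, a ≠ b → c ≠ d →
      μ (twoExceptions i a b) = μ (twoExceptions i c d) := fun hab hcd =>
    hμ.measure_eq_of_pair measurableSet_twoExceptions permute_preimage_twoExceptions hab hcd
  have hdisj : Pairwise (Function.onFun Disjoint fun m => twoExceptions i 0 (m + 2)) := by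
    intro m n hmn
    rw [Function.onFun, Set.disjoint_left]
    intro π h1 h2
    obtain ⟨c, hc0, hcm, hcn⟩ : ∃ c, c ≠ 0 ∧ c ≠ m + 2 ∧ c ≠ n + 2 :=
      ⟨m + n + 5, by omega, by omega, by omega⟩
    exact (h1 c hc0 hcm).1.2 ((h2 (m + 2) (by omega) (by omega)).2 c hc0 hcn).1
  have hsub : ⋃ m, twoExceptions (k := k) i 0 (m + 2) ⊆ splitSet i 0 1 := by
    refine Set.iUnion_subset fun m π h => ?_
    rw [mem_splitSet]
    exact fun h' => (h 1 (by omega) (by omega)).1.1 h'.1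
  have hfin := (measure_mono hsub).trans_lt (hμ.measure_splitSet_lt_top hs zero_ne_one)
  rw [measure_iUnion hdisj fun m => measurableSet_twoExceptions _ _] at hfin
  by_contra hne
  refine hfin.ne ?_
  have : ∀ m : ℕ, μ (twoExceptions i 0 (m + 2)) = μ (twoExceptions i a b) := fun m =>
    hconst (by omega) hab
  simp only [this]
  exact ENNReal.tsum_const_eq_top_of_ne_zero hne

/-- Some pair `a, b` is split and everything else is in one block. Almost surely not both of `a` and
`b` are outside that block, and not both are inside as they are split, so exactly one integer is
eroded. -/
theorem ae_erode_of_rank_eq (hμ : Exchangeable μ) (hs : SplittingCondition i hi μ) :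
    ∀ᵐ π ∂μ, π.rank = MassPartition.one i hi → ∃ n, erode n i hi = π := by
  have hR : ∀ᵐ π ∂μ, ∀ a b, a ≠ b → π ∉ twoExceptions i a b := by
    simp only [ae_all_iff]
    exact fun a b hab => measure_eq_zero_iff_ae_notMem.1 (hμ.measure_twoExceptions hs hab)
  filter_upwards [hμ.ae_cofinite_of_rank_eq hs, hR, measure_eq_zero_iff_ae_notMem.1 hs.1]
    with π h1 h2 h3 hr
  obtain ⟨a, b, hab, hm⟩ : ∃ a b, a ≠ b ∧ π ∈ splitSet i a b := by
    by_contra hnot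
    push Not at hnot
    exact h3 (eq_single_of_forall hnot)
  have hbig := h1 hr a b hab hm
  have hm' := mem_splitSet.1 hm
  have hnot := h2 a b hab
  simp only [twoExceptions, Set.mem_ofPred_eq, not_forall] at hnot
  obtain ⟨c, hca, hcb, hnot⟩ := hnot
  have hor : π.rel a c ∨ π.rel b c := by
    by_contra h
    push Not at h
    exact hnot ⟨h, fun d hda hdb => hbig c d hca hcb hda hdb⟩
  have hct : π.typ c = i := (hbig c c hca hcb hca hcb).2
  -- Stated for arbitrary `a`, `b` because it is applied with either of them as the integer attached
  -- to the big block.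
  have hfinish : ∀ a b, a ≠ b → c ≠ a → c ≠ b → ¬ (π.rel a b ∧ π.typ a = i) →
      (∀ c d, c ≠ a → c ≠ b → d ≠ a → d ≠ b → π.rel c d ∧ π.typ c = i) → π.rel a c →
      erode b i hi = π := by
    intro a b hab hca hcb hm' hbig hac
    have hall : ∀ x, x ≠ b → π.rel x c := fun x hx => by
      by_cases hxa : x = a
      · rw [hxa]; exact hac
      · exact (hbig x c hxa hx hca hcb).1
    refine (eq_erode_of_forall (fun x y hx hy =>
      ⟨π.rel.trans (hall x hx) (π.rel.symm (hall y hy)),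
        (π.typ_congr _ _ (hall x hx)).trans hct⟩) fun x hx hbx => hm' ⟨?_, ?_⟩).symm
    · exact π.rel.trans hac (π.rel.symm (π.rel.trans hbx (hall x hx)))
    · exact (π.typ_congr _ _ hac).trans hct
  rcases hor with h | h
  · exact ⟨b, hfinish a b hab hca hcb hm' hbig h⟩
  · refine ⟨a, hfinish b a hab.symm hcb hca (fun h' => hm' ⟨π.rel.symm h'.1, ?_⟩)
      (fun c d h1 h2 h3 h4 => hbig c d h2 h1 h4 h3) h⟩
    rw [π.typ_congr _ _ (π.rel.symm h'.1), h'.2]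

theorem _root_.erosion_apply {E : Set (TypedPartition k ℕ)} (hE : MeasurableSet E) :
    erosion i hi E = ∑' n, E.indicator 1 (erode n i hi) := by
  rw [erosion, Measure.sum_apply _ hE]
  exact tsum_congr fun n => Measure.dirac_apply' _ hE

theorem measure_erode (hμ : Exchangeable μ) (n : ℕ) :
    μ {erode n i hi} = μ {erode 0 i hi} := by
  have hfin : {m | Equiv.swap 0 n m ≠ m}.Finite := by
    refine (Set.toFinite {0, n}).subset fun m hm => ?_
    by_contra h
    simp only [Set.mem_insert_iff, Set.mem_singleton_iff, not_or] at h
    exact hm (Equiv.swap_apply_of_ne_of_ne h.1 h.2)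
  rw [← (hμ _ hfin).measure_preimage (measurableSet_singleton (erode 0 i hi)).nullMeasurableSet]
  congr 1
  ext π
  simp only [Set.mem_singleton_iff, Set.mem_preimage]
  constructor
  · rintro rfl
    rw [permute_erode, Equiv.symm_swap, Equiv.swap_apply_right]
  · intro h
    have h' := congrArg (permute (Equiv.swap 0 n)) h
    rwa [permute_permute, Equiv.swap_mul_self, permute_one, permute_erode, Equiv.symm_swap,
      Equiv.swap_apply_left] at h'

/-- The measure sits on countably many atoms, which transpositions exchange. The constant is the
mass of `erode 0 i hi`, finite because this partition splits `0` and `1`. -/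
theorem exists_restrict_eq_erosion (hμ : Exchangeable μ) (hs : SplittingCondition i hi μ) :
    ∃ c : ℝ≥0, μ.restrict {π | π.rank = MassPartition.one i hi} = c • erosion i hi := by
  have hlt : μ {erode 0 i hi} < ∞ :=
    (measure_mono (Set.singleton_subset_iff.2 (erode_mem_splitSet 0))).trans_lt
      (hμ.measure_splitSet_lt_top hs (by norm_num))
  refine ⟨(μ {erode 0 i hi}).toNNReal, ?_⟩
  ext E hE
  rw [Measure.restrict_apply hE, Measure.smul_apply, erosion_apply hE, ENNReal.smul_def,
    ENNReal.coe_toNNReal hlt.ne, smul_eq_mul, ← ENNReal.tsum_mul_left]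
  have h1 : μ (E ∩ {π | π.rank = MassPartition.one i hi}) =
      μ (⋃ n, E ∩ {erode n i hi}) := by
    refine measure_congr ?_
    filter_upwards [hμ.ae_erode_of_rank_eq hs] with π hπ
    refine propext ⟨fun h => ?_, fun h => ?_⟩
    · obtain ⟨n, hn⟩ := hπ h.2
      exact Set.mem_iUnion.2 ⟨n, h.1, hn.symm⟩
    · obtain ⟨n, hn, hn'⟩ := Set.mem_iUnion.1 h
      refine ⟨hn, ?_⟩
      rw [Set.mem_singleton_iff] at hn'
      rw [hn']
      exact (rank_erode hi n).2
  rw [h1, measure_iUnion]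
  · refine tsum_congr fun n => ?_
    by_cases h : erode n i hi ∈ E
    · rw [Set.indicator_of_mem h, Pi.one_apply, mul_one,
        Set.inter_eq_right.2 (Set.singleton_subset_iff.2 h), hμ.measure_erode n]
    · rw [Set.indicator_of_notMem h, mul_zero, Set.inter_singleton_eq_empty.2 h, measure_empty]
  · intro m n hmn
    refine Set.disjoint_left.2 fun π h1 h2 => hmn (erode_injective (hi := hi) ?_)
    exact h1.2.symm.trans h2.2
  · exact fun n => hE.inter (measurableSet_singleton _)

end Exchangeable

/-! ### The converse -/

section Converse

variable {c : ℝ≥0} {ν : Measure (MassPartition k)}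

theorem add_bind_apply {E : Set (TypedPartition k ℕ)} (hE : MeasurableSet E) :
    (c • erosion i hi + ν.bind paintbox) E =
      c * (∑' n, E.indicator 1 (erode n i hi)) + ∫⁻ x, paintbox x E ∂ν := by
  rw [Measure.add_apply, Measure.smul_apply, erosion_apply hE, bind_paintbox_apply _ hE,
    ENNReal.smul_def, smul_eq_mul]

theorem exchangeable_add_bind : Exchangeable (c • erosion i hi + ν.bind paintbox) := by
  intro σ _
  refine ⟨measurable_permute σ, ?_⟩
  ext E hE
  have hE' := measurable_permute σ hE
  rw [Measure.map_apply (measurable_permute σ) hE, add_bind_apply hE, add_bind_apply hE']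
  congr 2
  · rw [← σ.symm.tsum_eq fun n => E.indicator (1 : TypedPartition k ℕ → ℝ≥0∞) (erode n i hi)]
    refine tsum_congr fun n => ?_
    rw [← permute_erode]
    rfl
  · ext x
    rw [← Measure.map_apply (measurable_permute σ) hE, paintbox_map_permute]

/-- Among the eroded partitions only `erode 0` and `erode 1` can split `0` and `1`, so erosion
contributes at most `2 * c`. The paintbox part is controlled by `paintbox_splitSet_le`. -/
theorem splittingCondition_add_bind (hν : ν {MassPartition.one i hi} = 0)
    (h : DislocationCondition i ν) :
    SplittingCondition i hi (c • erosion i hi + ν.bind paintbox) := by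
  constructor
  · rw [add_bind_apply (measurableSet_singleton _)]
    have h1 : ∀ n, ({single ℕ i hi} : Set (TypedPartition k ℕ)).indicator (1 : TypedPartition k ℕ → ℝ≥0∞)
        (erode n i hi) = 0 := fun n => by
      refine Set.indicator_of_notMem (fun e => ?_) _
      have h2 := erode_mem_splitSet (i := i) (hi := hi) n
      rw [Set.mem_singleton_iff.1 e, mem_splitSet] at h2
      exact h2 ⟨trivial, rfl⟩
    rw [ENNReal.tsum_eq_zero.2 h1, mul_zero, zero_add,
      lintegral_eq_zero_iff (measurable_paintbox_apply (measurableSet_singleton _))]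
    filter_upwards [measure_eq_zero_iff_ae_notMem.1 hν] with x hx
    exact paintbox_single hi hx
  · have hm := measurableSet_splitSet (k := k) i 0 1
    rw [splitSet_eq hi, add_bind_apply hm]
    refine ENNReal.add_lt_top.2 ⟨ENNReal.mul_lt_top ENNReal.coe_lt_top ?_, ?_⟩
    · rw [tsum_eq_sum (s := Finset.range 2)]
      · refine ENNReal.sum_lt_top.2 fun n _ => ?_
        exact (Set.indicator_le_self _ _ _).trans_lt ENNReal.one_lt_top
      · intro n hn
        simp only [Finset.mem_range, not_lt] at hn
        exact Set.indicator_of_notMem (erode_notMem_splitSet (by omega) (by omega)) _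
    · calc ∫⁻ x, paintbox x (splitSet i 0 1) ∂ν ≤ ∫⁻ x, 2 * defect i x ∂ν :=
            lintegral_mono fun x => paintbox_splitSet_le hi x
        _ = 2 * ∫⁻ x, defect i x ∂ν := lintegral_const_mul _ (measurable_defect i)
        _ < ∞ := ENNReal.mul_lt_top ENNReal.ofNat_lt_top h

theorem ae_hasFrequencies_add_bind :
    ∀ᵐ π ∂(c • erosion i hi + ν.bind paintbox), π.HasFrequencies := by
  have hm := (measurableSet_hasFrequencies (k := k)).compl
  change (c • erosion i hi + ν.bind paintbox) {π | π.HasFrequencies}ᶜ = 0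
  rw [add_bind_apply hm]
  have h1 : ∀ n, ({π : TypedPartition k ℕ | π.HasFrequencies}ᶜ).indicator (1 : TypedPartition k ℕ → ℝ≥0∞)
      (erode n i hi) = 0 := fun n =>
    Set.indicator_of_notMem (Set.notMem_compl_iff.2 (rank_erode hi n).1) _
  have h2 : ∀ x : MassPartition k, paintbox x {π | π.HasFrequencies}ᶜ = 0 := fun x =>
    (paintbox_ae_rank x).mono fun π h => h.1
  simp only [h1, h2, tsum_zero, mul_zero, lintegral_zero, add_zero]

/-- Erosion lives on rank `one`, which is removed, and the image of `paintbox x` under `rank` is the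
Dirac mass at `x`. What remains is `ν` off a `ν`-null point. -/
theorem dislocationMeasure_add_bind (hν : ν {MassPartition.one i hi} = 0) :
    dislocationMeasure i hi (c • erosion i hi + ν.bind paintbox) = ν := by
  ext E hE
  have hone : MeasurableSet {x | x ≠ MassPartition.one i hi} :=
    (measurableSet_singleton (MassPartition.one i hi)).compl
  have hE' := hE.inter hone
  rw [dislocationMeasure, Measure.restrict_apply hE, Measure.map_apply measurable_rank hE',
    add_bind_apply (measurable_rank hE')]
  have h1 : ∀ n, (rank ⁻¹' (E ∩ {x | x ≠ MassPartition.one i hi})).indicator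
      (1 : TypedPartition k ℕ → ℝ≥0∞) (erode n i hi) = 0 := fun n =>
    Set.indicator_of_notMem (fun e => e.2 (rank_erode hi n).2) _
  have h2 : ∀ x, paintbox x (rank ⁻¹' (E ∩ {x | x ≠ MassPartition.one i hi})) =
      (E ∩ {x | x ≠ MassPartition.one i hi}).indicator 1 x := fun x => by
    rw [← Measure.map_apply measurable_rank hE', paintbox_map_rank, Measure.dirac_apply' _ hE']
  simp only [h1, h2, tsum_zero, mul_zero, zero_add]
  rw [lintegral_indicator_one hE']
  refine measure_congr ?_
  filter_upwards [measure_eq_zero_iff_ae_notMem.1 hν] with x hx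
  exact propext ⟨fun h => h.1, fun h => ⟨h, hx⟩⟩

end Converse

end

theorem theorem2 (k : ℕ) (i : Fin (k + 1)) (hi : i ≠ 0) :
    Measurable (paintbox (k := k)) ∧
    (∀ μ : Measure (TypedPartition k ℕ), Exchangeable μ → SplittingCondition i hi μ →
      (∀ᵐ π ∂μ, π.HasFrequencies) ∧
      (AEMeasurable TypedPartition.rank μ ∧
        DislocationCondition i (dislocationMeasure i hi μ) ∧
        μ.restrict {π | π.rank ≠ MassPartition.one i hi} =
          (dislocationMeasure i hi μ).bind paintbox) ∧
      ∃ c : ℝ≥0, μ.restrict {π | π.rank = MassPartition.one i hi} = c • erosion i hi) ∧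
    (∀ (c : ℝ≥0) (ν : Measure (MassPartition k)), ν {MassPartition.one i hi} = 0 →
      DislocationCondition i ν →
      ∀ μ : Measure (TypedPartition k ℕ), μ = c • erosion i hi + ν.bind paintbox →
        Exchangeable μ ∧ SplittingCondition i hi μ ∧
        (∀ᵐ π ∂μ, π.HasFrequencies) ∧ AEMeasurable TypedPartition.rank μ ∧
        ν = dislocationMeasure i hi μ) := by
  refine ⟨measurable_paintbox, fun μ hμ hs => ⟨hμ.ae_hasFrequencies hs,
    ⟨TypedPartition.measurable_rank.aemeasurable, hμ.dislocationCondition hs, hμ.restrict_eq_bind hs⟩,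
    hμ.exists_restrict_eq_erosion hs⟩, ?_⟩
  rintro c ν hν hd μ rfl
  exact ⟨exchangeable_add_bind, splittingCondition_add_bind hν hd, ae_hasFrequencies_add_bind,
    TypedPartition.measurable_rank.aemeasurable, (dislocationMeasure_add_bind hν).symm⟩
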